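/- A \emph{non-blocking test-free counter machine} (NB-CM) is a tuple $M=(\mathrm{Loc},X,\Delta_b,\Delta_{nb},\ell_{in})$ where $\mathrm{Loc}$ is a finite set of locations, $\ell_{in}\in\mathrm{Loc}$, $X$ is a finite set of counters, $\Delta_b$ is a finite set of transitions $(\ell,op,\ell')$ between locations with $op\in\{\mathtt{x}{+},\mathtt{x}{-}\mid \mathtt{x}\in X\}\cup\{\bot\}$, and $\Delta_{nb}$ is a finite set of transitions $(\ell,\mathrm{nb}(\mathtt{x}{-}),\ell')$ with $\mathtt{x}\in X$. A configuration is a pair $(\ell,v)$ with $\ell\in\mathrm{Loc}$ and $v\in\mathbb{N}^X$. A transition from $\ell$ to $\ell'$ leads from $(\ell,v)$ to $(\ell',v')$, where $v'$ agrees with $v$ except possibly as follows: $\bot$ changes nothing; $\mathtt{x}{+}$ sets $v'(\mathtt{x})=v(\mathtt{x})+1$; the blocking decrement $\mathtt{x}{-}$ requires $v(\mathtt{x})\ge 1$ and sets $v'(\mathtt{x})=v(\mathtt{x})-1$; the non-blocking decrement $\mathrm{nb}(\mathtt{x}{-})$ sets $v'(\mathtt{x})=\max(0,v(\mathtt{x})-1)$.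 The machine $M$ is an \emph{NB-CM with restore} (NB-R-CM) if $(\ell,\bot,\ell_{in})\in\Delta_b$ for every $\ell\in\mathrm{Loc}$. For a class $\mathcal{M}$ of machines, the problem $\mathrm{Cover}[\mathcal{M}]$ takes as input a machine $M\in\mathcal{M}$ and a location $\ell_f$ of $M$, and asks whether there is $v\in\mathbb{N}^X$ such that $(\ell_f,v)$ is reachable from $(\ell_{in},\mathbf{0})$ by a finite (possibly empty) sequence of transitions. Inputs are given as words over a finite alphabet that list the transitions and write all numbers (the number of locations, the number of counters, and the indices of locations and counters) in unary; so the length of an input without repeated transitions is polynomially related to $|M|=|\mathrm{Loc}|+|X|+|\Delta_b|+|\Delta_{nb}|$. EXPSPACE is the class of languages decided by a deterministic Turing machine in space $2^{p(n)}$ on inputs of length $n$, for some polynomial $p$. \textbf{Theorem.} $\mathrm{Cover}[\text{NB-CM}]$ and $\mathrm{Cover}[\text{NB-R-CM}]$ are in EXPSPACE. -/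

import Mathlib

/-! ### Deterministic exponential space -/

namespace SpaceComplexity

open Turing

/-- The number of symbols that a configuration of a deterministic multi-stack Turing machine holds
on all its stacks together. (A two-way infinite tape is a pair of stacks.) -/
def cfgSpace (tm : FinTM2) (c : tm.Cfg) : ℕ :=
  letI := tm.kFin
  ∑ k : tm.K, (c.stk k).length

/-- The initial configuration on the input word `w`: the word is on the input stack, with its first
letter on top, and all other stacks are empty. Letters of the input alphabet `α` are identified
with symbols of the input stack by `ι`. -/
def start {α : Type} (tm : FinTM2) (ι : α ↪ tm.Γ tm.k₀) (w : List α) : tm.Cfg :=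
  initList tm (w.map ι)

/-- The machine `tm` with set `A` of accepting internal states decides the language `L` in
space `s`: on every input `w` it halts, in an accepting state if and only if `w ∈ L`, and no
configuration of its run holds more than `s |w|` symbols. -/
def DecidesInSpace {α : Type} (tm : FinTM2) (ι : α ↪ tm.Γ tm.k₀) (A : Set tm.σ)
    (L : Language α) (s : ℕ → ℕ) : Prop :=
  ∀ w : List α,
    (∃ c : tm.Cfg, StateTransition.Reaches tm.step (start tm ι w) c ∧ c.l = none ∧
      (c.var ∈ A ↔ w ∈ L)) ∧
    ∀ c : tm.Cfg, StateTransition.Reaches tm.step (start tm ι w) c →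
      cfgSpace tm c ≤ s w.length

/-- The class `EXPSPACE` of the languages over `α` that a deterministic machine with finite stack
alphabets decides in space `2 ^ p(n)`, for some polynomial `p`, on inputs of length `n`. -/
def EXPSPACE {α : Type} : Set (Language α) :=
  {L | ∃ (tm : FinTM2) (ι : α ↪ tm.Γ tm.k₀) (A : Set tm.σ) (p : Polynomial ℕ),
    (∀ k, Finite (tm.Γ k)) ∧ DecidesInSpace tm ι A L fun n => 2 ^ p.eval n}

end SpaceComplexity

/-! ### Non-blocking counter machines -/

namespace CounterMachine

/-- The actions of a counter machine over the set `X` of counters. -/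
inductive CAct (X : Type*)
  /-- increment a counter -/
  | inc (x : X)
  /-- decrement a counter (blocking) -/
  | dec (x : X)
  /-- test that a counter is zero -/
  | isZero (x : X)
  /-- the action without effect, written `⊥` -/
  | nop

/-- A counter machine with locations `Loc` and counters `X`. -/
structure CM (Loc X : Type*) where
  /-- the transitions -/
  Δ : Finset (Loc × CAct X × Loc)
  /-- the initial location -/
  init : Loc

/-- A counter machine is test-free if none of its transitions is a zero test. -/
def CM.TestFree {Loc X : Type*} (M : CM Loc X) : Prop :=
  ∀ ℓ x ℓ', (ℓ, CAct.isZero x, ℓ') ∉ M.Δ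

/-- The effect of an action on valuations. A blocking decrement needs a positive counter. -/
def CAct.Effect {X : Type*} [DecidableEq X] : CAct X → (X → ℕ) → (X → ℕ) → Prop
  | .inc x, v, v' => v' = Function.update v x (v x + 1)
  | .dec x, v, v' => 0 < v x ∧ v' = Function.update v x (v x - 1)
  | .isZero x, v, v' => v x = 0 ∧ v' = v
  | .nop, v, v' => v' = v

/-- A non-blocking test-free counter machine (NB-CM): a test-free counter machine, whose
transitions are the blocking ones (`Δ_b`), together with a finite set of non-blocking transitions.
The triple `(ℓ, x, ℓ')` in `Δnb` is the transition from `ℓ` to `ℓ'` labelled by the non-blocking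
decrement of the counter `x`. -/
structure NBCM (Loc X : Type*) extends CM Loc X where
  testFree : toCM.TestFree
  /-- the non-blocking transitions -/
  Δnb : Finset (Loc × X × Loc)

/-- One step between configurations, by a blocking or a non-blocking transition. A non-blocking
decrement replaces the value `v x` by `max 0 (v x - 1)`, which is truncated subtraction. -/
def NBCM.Step {Loc X : Type*} [DecidableEq X] (M : NBCM Loc X) (c c' : Loc × (X → ℕ)) : Prop :=
  (∃ a : CAct X, (c.1, a, c'.1) ∈ M.Δ ∧ a.Effect c.2 c'.2) ∨
  (∃ x : X, (c.1, x, c'.1) ∈ M.Δnb ∧ c'.2 = Function.update c.2 x (c.2 x - 1))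

/-- The location `ℓf` is coverable: some configuration `(ℓf, v)` is reachable from the initial
location with all counters zero. -/
def NBCM.Coverable {Loc X : Type*} [DecidableEq X] (M : NBCM Loc X) (ℓf : Loc) : Prop :=
  ∃ v : X → ℕ, Relation.ReflTransGen M.Step (M.init, fun _ => 0) (ℓf, v)

/-- An NB-CM is an NB-CM with restore (NB-R-CM) if each location has a transition without effect
to the initial location. -/
def NBCM.IsRestore {Loc X : Type*} (M : NBCM Loc X) : Prop :=
  ∀ ℓ : Loc, (ℓ, CAct.nop, M.init) ∈ M.Δ

/-! ### Instances as words -/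

/-- The input alphabet. -/
inductive Sym
  /-- the unary digit -/
  | tick
  /-- end of a number -/
  | sep
  | inc
  | dec
  | isZero
  | nop
  | nbdec

/-- A natural number in unary. -/
def unary (k : ℕ) : List Sym := List.replicate k Sym.tick

/-- The word of an action: a tag, followed by the counter it concerns, if there is one. -/
def encodeAct {m : ℕ} : CAct (Fin m) → List Sym
  | .inc x => Sym.inc :: unary x
  | .dec x => Sym.dec :: unary x
  | .isZero x => Sym.isZero :: unary x
  | .nop => [Sym.nop]

/-- The word of a transition: source, action, target. The left summand holds the blocking
transitions, the right summand the non-blocking ones. -/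
def encodeTrans {n m : ℕ} :
    (Fin n × CAct (Fin m) × Fin n) ⊕ (Fin n × Fin m × Fin n) → List Sym
  | .inl (ℓ, a, ℓ') => unary ℓ ++ encodeAct a ++ Sym.sep :: unary ℓ' ++ [Sym.sep]
  | .inr (ℓ, x, ℓ') => unary ℓ ++ Sym.nbdec :: unary x ++ Sym.sep :: unary ℓ' ++ [Sym.sep]

/-- The word that gives the numbers of locations and of counters, the initial location, the target
location, and a list of transitions. -/
def encodeInstance {n m : ℕ} (ℓin ℓf : Fin n)
    (l : List ((Fin n × CAct (Fin m) × Fin n) ⊕ (Fin n × Fin m × Fin n))) : List Sym :=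
  unary n ++ Sym.sep :: unary m ++ Sym.sep :: unary ℓin ++ Sym.sep :: unary ℓf ++
    Sym.sep :: l.flatMap encodeTrans

/-- The word `w` represents the machine `M`, with locations `0, …, n - 1` and counters
`0, …, m - 1`, and the target location `ℓf`: it lists all transitions of `M` and no others, in any
order. As numbers are in unary, the length of a representation without repetitions lies between
`|M|` and a polynomial in `|M|`, for the size `|M|` that counts locations, counters and
transitions. -/
def Represents {n m : ℕ} (w : List Sym) (M : NBCM (Fin n) (Fin m)) (ℓf : Fin n) : Prop :=
  ∃ l : List ((Fin n × CAct (Fin m) × Fin n) ⊕ (Fin n × Fin m × Fin n)),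
    (∀ t, Sum.inl t ∈ l ↔ t ∈ M.Δ) ∧ (∀ t, Sum.inr t ∈ l ↔ t ∈ M.Δnb) ∧
    w = encodeInstance M.init ℓf l

/-- The coverability problem for NB-CM: the words that represent an NB-CM and a location that is
coverable in it. -/
def coverNBCM : Language Sym :=
  {w | ∃ (n m : ℕ) (M : NBCM (Fin n) (Fin m)) (ℓf : Fin n), Represents w M ℓf ∧ M.Coverable ℓf}

/-- The coverability problem for NB-R-CM: the words that represent an NB-R-CM and a location that
is coverable in it. -/
def coverNBRCM : Language Sym :=
  {w | ∃ (n m : ℕ) (M : NBCM (Fin n) (Fin m)) (ℓf : Fin n),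
    Represents w M ℓf ∧ M.IsRestore ∧ M.Coverable ℓf}

end CounterMachine

/-!
# Coverability for non-blocking counter machines is in exponential space

The proof has three ingredients: a bound on the length of covering runs, a space-efficient search
for a run within this bound, and an implementation of the search by a stack machine.

**Short runs.** Rackoff's argument for vector addition systems applies to machines with non-blocking
decrements. The only properties it needs of a transition are that it lowers each counter by at most
one and that it is enabled whenever all counters are positive. By induction on the number of
counters that are taken into account, a shortest covering run either keeps these counters below a
threshold, and then it does not repeat a configuration, or it exceeds the threshold in some counter;
from there on, this counter is so large that it may be ignored. With `n` locations and `m` counters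
there is thus a covering run of at most `(n + 2) ^ (m + 5) ^ (m + 1)` steps
(`Rackoff.exists_short_of_reach`), and its counters are bounded by its length. The restore
transitions play no special role: they are checked as a condition on the input.

**Search.** Configurations within the bound are numbers with exponentially many bits. Whether one is
reachable from another in at most `2 ^ K` steps is decided by divide and conquer, with a stack of
`K` midpoints (`Savitch.decide_iff`). The instance is not parsed from the input word. Instead, all
instances are enumerated until one is found whose encoding is the input (`CoverCode.accepts_iff`).

**Implementation.** `StackProgram.Prog` is a small structured language on stacks, with a big-step
semantics that bounds the height of all stacks; its programs are compiled to stack machines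
(`StackProgram.exists_machine`). A stack is read as a number in bijective base 7, the alphabet
having seven letters, so a bound on the space is a bound on the numbers in the registers. The class
`StackProgram.LinSpace` consists of the functions on numbers and propositions that can be computed
while all registers stay below a fixed power of the arguments. It contains the arithmetic
operations, and it is closed under composition, under bounded quantification and under iteration, as
long as the iterates stay below such a power (`StackProgram.LinSpace.iterate`). Membership of the
search in this class is read off from its definition (`CoverCode.linSpace_accepts`). The search gets
as additional arguments a number `e` that is exponential in the square of the length of the input,
and the number `2 ^ e ^ 5`. They are computed first, and then all numbers have exponentially many
digits (`StackProgram.mem_EXPSPACE`).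
-/

/-! ### Structured stack programs -/

namespace StackProgram

open Function

/-- Structured programs on stacks of the seven digits `Fin 7`; the stacks are indexed by `ℕ`. -/
inductive Prog
  /-- do nothing -/
  | skip
  /-- push the digit `d` on the stack `r` -/
  | push (r : ℕ) (d : Fin 7)
  /-- pop the stack `r` and continue according to the digit found, if there is one -/
  | pop (r : ℕ) (f : Option (Fin 7) → Prog)
  /-- sequential composition -/
  | seq (P Q : Prog)
  /-- repeat `P` as long as the stack `r` is nonempty -/
  | loop (r : ℕ) (P : Prog)

/-- The contents of all stacks. -/
abbrev Store := ℕ → List (Fin 7)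

/-- Big-step semantics with a space bound: `Runs L P s s'` says that `P` leads from `s` to `s'`, and
that no stack ever holds more than `L` digits. -/
inductive Runs (L : ℕ) : Prog → Store → Store → Prop
  | skip {s} (h : ∀ r, (s r).length ≤ L) : Runs L .skip s s
  | push {s r d} (h : ∀ r, (s r).length ≤ L)
      (h' : ∀ r', (update s r (d :: s r) r').length ≤ L) :
      Runs L (.push r d) s (update s r (d :: s r))
  | pop {s s' r f} (h : ∀ r, (s r).length ≤ L)
      (h' : Runs L (f (s r).head?) (update s r (s r).tail) s') : Runs L (.pop r f) s s'
  | seq {s s' s'' P Q} (h : Runs L P s s') (h' : Runs L Q s' s'') : Runs L (.seq P Q) s s''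
  | done {s r P} (h : ∀ r, (s r).length ≤ L) (hr : s r = []) : Runs L (.loop r P) s s
  | again {s s' s'' r P} (hr : s r ≠ []) (h : Runs L P s s') (h' : Runs L (.loop r P) s' s'') :
      Runs L (.loop r P) s s''

theorem Runs.le_left {L : ℕ} {P : Prog} {s s' : Store} (h : Runs L P s s') :
    ∀ r, (s r).length ≤ L := by
  induction h <;> assumption

theorem Runs.le_right {L : ℕ} {P : Prog} {s s' : Store} (h : Runs L P s s') :
    ∀ r, (s' r).length ≤ L := by
  induction h <;> assumption

/-- All stacks that occur in the program have an index of at most `N`. -/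
def Prog.Uses (N : ℕ) : Prog → Prop
  | .skip => True
  | .push r _ => r ≤ N
  | .pop r f => r ≤ N ∧ ∀ o, (f o).Uses N
  | .seq P Q => P.Uses N ∧ Q.Uses N
  | .loop r P => r ≤ N ∧ P.Uses N

theorem Prog.Uses.mono {P : Prog} {N N' : ℕ} (h : P.Uses N) (hN : N ≤ N') : P.Uses N' := by
  induction P with
  | skip => trivial
  | push r d => exact le_trans (show r ≤ N from h) hN
  | pop r f ih => exact ⟨h.1.trans hN, fun o => ih o (h.2 o)⟩
  | seq P Q ihP ihQ => exact ⟨ihP h.1, ihQ h.2⟩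
  | loop r P ih => exact ⟨h.1.trans hN, ih h.2⟩

theorem Prog.exists_uses (P : Prog) : ∃ N, P.Uses N := by
  induction P with
  | skip => exact ⟨0, trivial⟩
  | push r d => exact ⟨r, le_refl r⟩
  | pop r f ih =>
    choose N hN using ih
    refine ⟨r + ∑ o, N o, Nat.le_add_right _ _, fun o => (hN o).mono ?_⟩
    exact (Finset.single_le_sum (fun _ _ => Nat.zero_le _) (Finset.mem_univ o)).trans
      (Nat.le_add_left _ _)
  | seq P Q ihP ihQ =>
    obtain ⟨N, hN⟩ := ihP
    obtain ⟨N', hN'⟩ := ihQ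
    exact ⟨N + N', hN.mono (by omega), hN'.mono (by omega)⟩
  | loop r P ih =>
    obtain ⟨N, hN⟩ := ih
    exact ⟨r + N, Nat.le_add_right _ _, hN.mono (by omega)⟩

/-! ### Compilation to stack machines -/

open Turing

/-- The labels of the machine that a program is compiled to. -/
def Lab : Prog → Type
  | .skip => Unit
  | .push _ _ => Unit
  | .pop _ f => Option (Σ o, Lab (f o))
  | .seq P Q => Lab P ⊕ Lab Q
  | .loop _ P => Option (Lab P)

theorem Lab.finite (P : Prog) : Finite (Lab P) := by
  induction P with
  | skip => exact inferInstanceAs (Finite Unit)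
  | push r d => exact inferInstanceAs (Finite Unit)
  | pop r f ih => exact inferInstanceAs (Finite (Option (Σ o, Lab (f o))))
  | seq P Q ihP ihQ => exact inferInstanceAs (Finite (Lab P ⊕ Lab Q))
  | loop r P ih => exact inferInstanceAs (Finite (Option (Lab P)))

/-- The label at which the execution of a program starts. -/
def entry : (P : Prog) → Lab P
  | .skip => ()
  | .push _ _ => ()
  | .pop _ _ => none
  | .seq P _ => .inl (entry P)
  | .loop _ _ => none

/-- Statements of machines with stacks `0, …, N` of digits. The internal state holds the digit read
last. -/
abbrev MStmt (N : ℕ) (Λ : Type) := TM2.Stmt (fun _ : Fin (N + 1) => Fin 7) Λ (Option (Fin 7))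

/-- The statement of each label of a program. The labels are embedded into the labels `Λ` of the
whole machine by `emb`, and control passes to `exit` at the end of the program. -/
def code (N : ℕ) {Λ : Type} (exit : Λ) : (P : Prog) → (Lab P → Λ) → Lab P → MStmt N Λ
  | .skip, _ => fun _ => .goto fun _ => exit
  | .push r d, _ => fun _ => .push (Fin.ofNat (N + 1) r) (fun _ => d) (.goto fun _ => exit)
  | .pop r f, emb => fun
    | none => .pop (Fin.ofNat (N + 1) r) (fun _ o => o)
        (.goto fun o => emb (some ⟨o, entry (f o)⟩))
    | some ⟨o, l⟩ => code N exit (f o) (fun l => emb (some ⟨o, l⟩)) l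
  | .seq P Q, emb => fun
    | .inl l => code N (emb (.inr (entry Q))) P (fun l => emb (.inl l)) l
    | .inr l => code N exit Q (fun l => emb (.inr l)) l
  | .loop r P, emb => fun
    | none => .peek (Fin.ofNat (N + 1) r) (fun _ o => o)
        (.goto fun o => if o.isSome then emb (some (entry P)) else exit)
    | some l => code N (emb none) P (fun l => emb (some l)) l

/-- A step of the machine `m` from a configuration whose stacks hold at most `L` digits each. -/
def BStep {N : ℕ} {Λ : Type} (m : Λ → MStmt N Λ) (L : ℕ)
    (c c' : TM2.Cfg (fun _ : Fin (N + 1) => Fin 7) Λ (Option (Fin 7))) : Prop :=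
  c' ∈ TM2.step m c ∧ ∀ k, (c.stk k).length ≤ L

theorem update_ofNat {N r : ℕ} (hr : r ≤ N) (s : Store) (x : List (Fin 7)) :
    update (fun k : Fin (N + 1) => s k) (Fin.ofNat (N + 1) r) x =
      fun k : Fin (N + 1) => update s r x k := by
  have hv : (Fin.ofNat (N + 1) r).val = r := by simp [Nat.mod_eq_of_lt (Nat.lt_succ_of_le hr)]
  funext k
  by_cases hk : k = Fin.ofNat (N + 1) r
  · subst hk
    rw [update_self]
    simp only [hv, update_self]
  · rw [update_of_ne hk, update_of_ne]
    intro h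
    exact hk (Fin.ext (h.trans hv.symm))

/-- A machine that contains the code of `P` simulates `P`. -/
theorem Runs.simulates {N L : ℕ} {Λ : Type} (m : Λ → MStmt N Λ) {P : Prog} {s s' : Store}
    (h : Runs L P s s') :
    ∀ (_ : P.Uses N) (exit : Λ) (emb : Lab P → Λ) (_ : ∀ l, m (emb l) = code N exit P emb l)
      (v : Option (Fin 7)), ∃ v', Relation.ReflTransGen (BStep m L)
        ⟨some (emb (entry P)), v, fun k => s k⟩ ⟨some exit, v', fun k => s' k⟩ := by
  induction h with
  | skip h =>
    intro hP exit emb hm v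
    refine ⟨v, .single ⟨?_, fun k => h k⟩⟩
    simp [hm, code]
  | @push s r d h h' =>
    intro hP exit emb hm v
    refine ⟨v, .single ⟨?_, fun k => h k⟩⟩
    have hv : (Fin.ofNat (N + 1) r).val = r := by
      simp [Nat.mod_eq_of_lt (Nat.lt_succ_of_le (show r ≤ N from hP))]
    rw [Option.mem_def, TM2.step, hm]
    simp only [code, TM2.stepAux]
    rw [update_ofNat hP, hv]
  | @pop s s' r f h h' ih =>
    intro hP exit emb hm v
    have hv : (Fin.ofNat (N + 1) r).val = r := by
      simp [Nat.mod_eq_of_lt (Nat.lt_succ_of_le (show r ≤ N from hP.1))]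
    obtain ⟨v', hv'⟩ := ih (hP.2 _) exit (fun l => emb (some ⟨_, l⟩))
      (fun l => by have := hm (some ⟨_, l⟩); rwa [code] at this) ((s r).head?)
    refine ⟨v', .head ⟨?_, fun k => h k⟩ hv'⟩
    rw [Option.mem_def, TM2.step, hm]
    simp only [entry, code, TM2.stepAux]
    rw [update_ofNat hP.1, hv]
  | @seq s s' s'' P Q h h' ih ih' =>
    intro hP exit emb hm v
    obtain ⟨v', hv'⟩ := ih hP.1 (emb (.inr (entry Q))) (fun l => emb (.inl l))
      (fun l => hm _) v
    obtain ⟨v'', hv''⟩ := ih' hP.2 exit (fun l => emb (.inr l))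
      (fun l => hm _) v'
    exact ⟨v'', hv'.trans hv''⟩
  | @done s r P h hr =>
    intro hP exit emb hm v
    have hv : (Fin.ofNat (N + 1) r).val = r := by
      simp [Nat.mod_eq_of_lt (Nat.lt_succ_of_le (show r ≤ N from hP.1))]
    refine ⟨none, .single ⟨?_, fun k => h k⟩⟩
    rw [Option.mem_def, TM2.step, hm]
    simp only [entry, code, TM2.stepAux]
    rw [hv, hr]
    simp
  | @again s s' s'' r P hr h h' ih ih' =>
    intro hP exit emb hm v
    have hv : (Fin.ofNat (N + 1) r).val = r := by
      simp [Nat.mod_eq_of_lt (Nat.lt_succ_of_le (show r ≤ N from hP.1))]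
    obtain ⟨v', hv'⟩ := ih hP.2 (emb none) (fun l => emb (some l))
      (fun l => hm _) ((s r).head?)
    obtain ⟨v'', hv''⟩ := ih' hP exit emb hm v'
    refine ⟨v'', .head ⟨?_, fun k => h.le_left k⟩ (hv'.trans hv'')⟩
    rw [Option.mem_def, TM2.step, hm]
    simp only [entry, code, TM2.stepAux]
    rw [hv]
    have : (s r).head?.isSome = true := by
      cases hs : s r with
      | nil => exact absurd hs hr
      | cons => rfl
    simp [this]

/-- The machine of a program, with input stack `rin`. After the program it reads the top of the
stack `rout` into its internal state and halts. -/
noncomputable def machine (P : Prog) (N rin rout : ℕ) : FinTM2 :=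
  haveI := Lab.finite P
  { K := Fin (N + 1)
    k₀ := Fin.ofNat (N + 1) rin
    k₁ := Fin.ofNat (N + 1) rout
    Γ := fun _ => Fin 7
    Λ := Option (Lab P)
    main := some (entry P)
    ΛFin := Fintype.ofFinite _
    σ := Option (Fin 7)
    initialState := none
    m := fun
      | none => .peek (Fin.ofNat (N + 1) rout) (fun _ o => o) .halt
      | some l => code N none P some l }

theorem reaches_bstep {N L : ℕ} {Λ : Type} {m : Λ → MStmt N Λ}
    {c c' : TM2.Cfg (fun _ : Fin (N + 1) => Fin 7) Λ (Option (Fin 7))}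
    (h : Relation.ReflTransGen (BStep m L) c c') (h' : ∀ k, (c'.stk k).length ≤ L)
    (hh : c'.l = none) {d} (hd : StateTransition.Reaches (TM2.step m) c d) :
    ∀ k, (d.stk k).length ≤ L := by
  induction h using Relation.ReflTransGen.head_induction_on with
  | refl =>
    rcases Relation.ReflTransGen.cases_head hd with rfl | ⟨e, he, _⟩
    · exact h'
    · obtain ⟨l, v, S⟩ := c'
      subst hh
      simp at he
  | head hb _ ih =>
    rcases Relation.ReflTransGen.cases_head hd with rfl | ⟨e, he, hed⟩
    · exact hb.2
    · rw [Option.mem_unique hb.1 he] at ih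
      exact ih hed

/-- A program that decides a language within the space bound `L` for each stack yields a machine
that decides the language in space `(N + 1) * L`. -/
theorem exists_machine {α : Type} (ι : α ↪ Fin 7) (P : Prog) (rin rout : ℕ) :
    ∃ (N : ℕ) (tm : FinTM2) (ι' : α ↪ tm.Γ tm.k₀) (A : Set tm.σ), (∀ k, Finite (tm.Γ k)) ∧
      ∀ (Lang : Language α) (L : ℕ → ℕ),
        (∀ w : List α, ∃ s', Runs (L w.length) P (update (fun _ => []) rin (w.map ι)) s' ∧
          (s' rout ≠ [] ↔ w ∈ Lang)) →
        SpaceComplexity.DecidesInSpace tm ι' A Lang fun n => (N + 1) * L n := by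
  obtain ⟨N₀, hN₀⟩ := P.exists_uses
  obtain ⟨N, hN, hin, hout⟩ : ∃ N, P.Uses N ∧ rin ≤ N ∧ rout ≤ N :=
    ⟨N₀ + rin + rout, hN₀.mono (by omega), by omega, by omega⟩
  refine ⟨N, machine P N rin rout, ι, {o | Option.isSome o},
    fun k => inferInstanceAs (Finite (Fin 7)), ?_⟩
  intro Lang L hL w
  obtain ⟨s', hs', hw⟩ := hL w
  have hv : (Fin.ofNat (N + 1) rout).val = rout := by
    simp [Nat.mod_eq_of_lt (Nat.lt_succ_of_le hout)]
  have hvin : (Fin.ofNat (N + 1) rin).val = rin := by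
    simp [Nat.mod_eq_of_lt (Nat.lt_succ_of_le hin)]
  have hstart : SpaceComplexity.start (machine P N rin rout) ι w =
      (⟨some (some (entry P)), none, fun k => update (fun _ => []) rin (w.map ι) k⟩ :
        TM2.Cfg (fun _ : Fin (N + 1) => Fin 7) (Option (Lab P)) (Option (Fin 7))) := by
    unfold SpaceComplexity.start initList
    congr 1
    rw [← update_ofNat hin]
    funext k
    by_cases hk : k = Fin.ofNat (N + 1) rin
    · subst hk
      rw [update_self]
      exact dif_pos rfl
    · have key : ∀ k : Fin (N + 1), k ≠ Fin.ofNat (N + 1) rin →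
          ([] : List (Fin 7)) = update (fun _ => []) (Fin.ofNat (N + 1) rin) (w.map ι) k :=
        fun k hk => by rw [update_of_ne hk]
      exact (dif_neg hk).trans (key k hk)
  obtain ⟨v', hv'⟩ := hs'.simulates (machine P N rin rout).m hN none some (fun l => rfl) none
  have hfin : BStep (N := N) (machine P N rin rout).m (L w.length) ⟨some none, v', fun k => s' k⟩
      ⟨none, (s' rout).head?, fun k => s' k⟩ := by
    refine ⟨?_, fun k => hs'.le_right k⟩
    have : (fun k : Fin (N + 1) => s' k) (Fin.ofNat (N + 1) rout) = s' rout := by simp only [hv]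
    rw [← this]
    rfl
  have hrun := hv'.tail hfin
  refine ⟨⟨(⟨none, (s' rout).head?, fun k => s' k⟩ :
    TM2.Cfg (fun _ : Fin (N + 1) => Fin 7) (Option (Lab P)) (Option (Fin 7))), ?_, rfl, ?_⟩, ?_⟩
  · rw [hstart]
    exact Relation.ReflTransGen.mono (fun _ _ h => h.1) _ _ hrun
  · rw [← hw]
    show (s' rout).head?.isSome ↔ _
    cases s' rout <;> simp
  · intro c hc
    rw [hstart] at hc
    have := reaches_bstep hrun (fun k => hs'.le_right k) rfl hc
    calc SpaceComplexity.cfgSpace (machine P N rin rout) c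
        = ∑ k : Fin (N + 1), (c.stk k).length := rfl
      _ ≤ ∑ _k : Fin (N + 1), L w.length := Finset.sum_le_sum fun k _ => this k
      _ = (N + 1) * L w.length := by simp

end StackProgram

/-! ### Numbers as stacks of digits -/

namespace StackProgram

open Function

/-- The number that a stack of digits denotes in bijective base 7: the digit `d` has the value
`d + 1`, and the top of the stack is the least significant digit. -/
def num : List (Fin 7) → ℕ
  | [] => 0
  | d :: l => 7 * num l + d + 1

/-- The stack of digits that denotes a number. -/
def dg (x : ℕ) : List (Fin 7) :=
  if x = 0 then [] else Fin.ofNat 7 (x - 1) :: dg ((x - 1) / 7)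
termination_by x
decreasing_by omega

theorem num_dg (x : ℕ) : num (dg x) = x := by
  induction x using Nat.strong_induction_on with
  | _ x ih =>
    rw [dg]
    split_ifs with h
    · simp [num, h]
    · rw [num, ih _ (by omega)]
      simp only [Fin.ofNat]
      omega

theorem dg_num (l : List (Fin 7)) : dg (num l) = l := by
  induction l with
  | nil => rw [num, dg, if_pos rfl]
  | cons d l ih =>
    have hd := d.isLt
    rw [num, dg, if_neg (by omega)]
    congr 1
    · ext
      simp only [Fin.ofNat]
      omega
    · rw [← ih]
      congr 1
      rw [ih]
      omega

@[simp] theorem dg_zero : dg 0 = [] := by rw [dg, if_pos rfl]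

theorem dg_eq_nil {x : ℕ} : dg x = [] ↔ x = 0 := by
  constructor
  · intro h
    rw [← num_dg x, h, num]
  · rintro rfl
    exact dg_zero

theorem num_add_two_le (l : List (Fin 7)) : num l + 2 ≤ 2 * 7 ^ l.length := by
  induction l with
  | nil => simp [num]
  | cons d l ih =>
    have hd := d.isLt
    rw [num, List.length_cons, pow_succ]
    omega

theorem two_pow_le_num (l : List (Fin 7)) : 2 ^ l.length ≤ num l + 1 := by
  induction l with
  | nil => simp [num]
  | cons d l ih =>
    rw [num, List.length_cons, pow_succ]
    omega

theorem length_dg_mono {x y : ℕ} (h : x ≤ y) : (dg x).length ≤ (dg y).length := by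
  induction y using Nat.strong_induction_on generalizing x with
  | _ y ih =>
    rw [dg, dg.eq_1 y]
    split_ifs with h1 h2 h2
    · simp
    · simp
    · omega
    · simp only [List.length_cons]
      exact Nat.succ_le_succ (ih _ (by omega) (by omega))

/-- A number below `2 ^ k` has at most `k` digits. -/
theorem length_dg_le {x k : ℕ} (h : x + 1 ≤ 2 ^ k) : (dg x).length ≤ k := by
  have := two_pow_le_num (dg x)
  rw [num_dg] at this
  exact (Nat.pow_le_pow_iff_right (by norm_num)).1 (this.trans h)

/-! ### Increment and decrement -/

/-- Increment on stacks of digits. -/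
def incL : List (Fin 7) → List (Fin 7)
  | [] => [0]
  | d :: l => if d = 6 then 0 :: incL l else (d + 1) :: l

/-- Decrement on stacks of digits. -/
def decL : List (Fin 7) → List (Fin 7)
  | [] => []
  | d :: l => if d = 0 then (if l = [] then [] else 6 :: decL l) else (d - 1) :: l

theorem num_incL (l : List (Fin 7)) : num (incL l) = num l + 1 := by
  induction l with
  | nil => rfl
  | cons d l ih =>
    unfold incL
    split_ifs with h
    · rw [num, num, ih, h]
      norm_num
      rfl
    · rw [num, num]
      have : ((d + 1 : Fin 7) : ℕ) = d + 1 := by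
        revert h; revert d; decide
      omega

theorem num_decL (l : List (Fin 7)) : num (decL l) = num l - 1 := by
  induction l with
  | nil => rfl
  | cons d l ih =>
    unfold decL
    split_ifs with h h'
    · rw [num, num, h, h', num]
      rfl
    · have : num l ≠ 0 := by
        intro h0
        rw [← dg_num l, h0, dg_zero] at h'
        exact h' rfl
      rw [num, num, ih, h]
      have h6 : ((6 : Fin 7) : ℕ) = 6 := rfl
      have h0 : ((0 : Fin 7) : ℕ) = 0 := rfl
      omega
    · rw [num, num]
      have : ((d - 1 : Fin 7) : ℕ) = d - 1 := by
        revert h; revert d; decide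
      have : (d : ℕ) ≠ 0 := fun h0 => h (Fin.ext h0)
      omega

theorem incL_dg (x : ℕ) : incL (dg x) = dg (x + 1) := by
  rw [← dg_num (incL (dg x)), num_incL, num_dg]

theorem decL_dg (x : ℕ) : decL (dg x) = dg (x - 1) := by
  rw [← dg_num (decL (dg x)), num_decL, num_dg]

/-- The store `s` with the stacks `0`, `1` and `r` replaced. The stacks `0` and `1` are auxiliary:
`0` is a flag, and `1` counts the digits that a carry has passed. -/
def tri (r : ℕ) (s : Store) (a b c : List (Fin 7)) : Store :=
  fun x => if x = 0 then a else if x = 1 then b else if x = r then c else s x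

section tri

variable {r : ℕ} {s : Store} {a b c : List (Fin 7)}

theorem tri_zero : tri r s a b c 0 = a := rfl

theorem tri_one : tri r s a b c 1 = b := rfl

theorem tri_self (hr : 2 ≤ r) : tri r s a b c r = c := by
  unfold tri
  rw [if_neg (by omega), if_neg (by omega), if_pos rfl]

theorem tri_update_zero {a'} : update (tri r s a b c) 0 a' = tri r s a' b c := by
  funext x
  by_cases h : x = 0 <;> simp [tri, h]

theorem tri_update_one {b'} : update (tri r s a b c) 1 b' = tri r s a b' c := by
  funext x
  by_cases h : x = 1 <;> simp [tri, h]

theorem tri_update_self (hr : 2 ≤ r) {c'} : update (tri r s a b c) r c' = tri r s a b c' := by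
  funext x
  by_cases h : x = r
  · subst h
    simp [tri_self hr]
  · simp [tri, h]

theorem tri_le {L : ℕ} (ha : a.length ≤ L) (hb : b.length ≤ L) (hc : c.length ≤ L)
    (hs : ∀ x, (s x).length ≤ L) (x : ℕ) : (tri r s a b c x).length ≤ L := by
  unfold tri
  split_ifs
  exacts [ha, hb, hc, hs x]

variable {L : ℕ}

theorem Runs.push_zero (d : Fin 7) (ha : a.length < L) (hb : b.length ≤ L) (hc : c.length ≤ L)
    (hs : ∀ x, (s x).length ≤ L) :
    Runs L (.push 0 d) (tri r s a b c) (tri r s (d :: a) b c) := by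
  have := Runs.push (L := L) (s := tri r s a b c) (r := 0) (d := d)
  rw [tri_zero, tri_update_zero] at this
  exact this (tri_le ha.le hb hc hs) (tri_le ha hb hc hs)

theorem Runs.push_one (d : Fin 7) (ha : a.length ≤ L) (hb : b.length < L) (hc : c.length ≤ L)
    (hs : ∀ x, (s x).length ≤ L) :
    Runs L (.push 1 d) (tri r s a b c) (tri r s a (d :: b) c) := by
  have := Runs.push (L := L) (s := tri r s a b c) (r := 1) (d := d)
  rw [tri_one, tri_update_one] at this
  exact this (tri_le ha hb.le hc hs) (tri_le ha hb hc hs)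

theorem Runs.push_self (hr : 2 ≤ r) (d : Fin 7) (ha : a.length ≤ L) (hb : b.length ≤ L)
    (hc : c.length < L) (hs : ∀ x, (s x).length ≤ L) :
    Runs L (.push r d) (tri r s a b c) (tri r s a b (d :: c)) := by
  have := Runs.push (L := L) (s := tri r s a b c) (r := r) (d := d)
  rw [tri_self hr, tri_update_self hr] at this
  exact this (tri_le ha hb hc.le hs) (tri_le ha hb hc hs)

theorem Runs.pop_zero (ha : a.length ≤ L) (hb : b.length ≤ L) (hc : c.length ≤ L)
    (hs : ∀ x, (s x).length ≤ L) :
    Runs L (.pop 0 fun _ => .skip) (tri r s a b c) (tri r s a.tail b c) := by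
  refine .pop (tri_le ha hb hc hs) ?_
  rw [tri_zero, tri_update_zero]
  exact .skip (tri_le (by simp; omega) hb hc hs)

end tri

/-- The second phase of increment and decrement: once the carry has been absorbed, every digit that
it has passed is replaced by `d`. -/
def unwind (r : ℕ) (d : Fin 7) : Prog := .loop 1 (.pop 1 fun _ => .push r d)

theorem Runs.unwind {L r : ℕ} (hr : 2 ≤ r) (d : Fin 7) {s : Store} (hs : ∀ x, (s x).length ≤ L)
    (k : ℕ) (c : List (Fin 7)) (hk : k + c.length ≤ L) :
    Runs L (unwind r d) (tri r s [] (List.replicate k 0) c)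
      (tri r s [] [] (List.replicate k d ++ c)) := by
  induction k generalizing c with
  | zero => exact .done (tri_le (by simp) (by simp) (by omega) hs) rfl
  | succ k ih =>
    refine .again (by rw [tri_one]; simp [List.replicate_succ]) (.pop (tri_le (by simp)
      (by simp; omega) (by omega) hs) ?_) (s' := tri r s [] (List.replicate k 0) (d :: c)) ?_
    · rw [tri_one, tri_update_one, List.replicate_succ, List.tail_cons]
      exact .push_self hr d (by simp) (by simp; omega) (by omega) hs
    · have := ih (d :: c) (by simp; omega)
      have e : List.replicate k d ++ d :: c = List.replicate (k + 1) d ++ c := by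
        rw [List.replicate_succ']
        simp
      rwa [e] at this

/-- The body of the loop of `inc`: treat one digit. -/
def incBody (r : ℕ) : Prog :=
  .pop r fun o => match o with
    | none => .seq (.push r 0) (.pop 0 fun _ => .skip)
    | some d => if d = 6 then .push 1 0 else .seq (.push r (d + 1)) (.pop 0 fun _ => .skip)

/-- The program that increments the number on the stack `r`. -/
def inc (r : ℕ) : Prog := .seq (.push 0 0) (.seq (.loop 0 (incBody r)) (unwind r 0))

theorem Runs.incLoop {L r : ℕ} (hr : 2 ≤ r) {s : Store} (hs : ∀ x, (s x).length ≤ L)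
    (hL : 1 ≤ L) (l : List (Fin 7)) (j : ℕ) (hj : j + l.length < L) :
    ∃ k c, Runs L (.loop 0 (incBody r)) (tri r s [0] (List.replicate j 0) l)
      (tri r s [] (List.replicate (j + k) 0) c) ∧ List.replicate k 0 ++ c = incL l ∧
      (incL l).length ≤ l.length + 1 := by
  induction l generalizing j with
  | nil =>
    refine ⟨0, [0], .again (by simp [tri_zero]) (.pop (tri_le (by simpa) (by simp; omega)
      (by simp) hs) ?_) (s' := tri r s [] (List.replicate j 0) [0])
      (.done (tri_le (by simp) (by simp; omega) (by simpa) hs) rfl), rfl, by simp [incL]⟩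
    rw [tri_self hr, tri_update_self hr]
    exact .seq (.push_self hr 0 (by simpa) (by simp; omega) (by simp; omega) hs)
      (.pop_zero (by simpa) (by simp; omega) (by simp; omega) hs)
  | cons d l ih =>
    simp only [List.length_cons] at hj
    by_cases h : d = 6
    · obtain ⟨k, c, h1, h2, h3⟩ := ih (j + 1) (by omega)
      refine ⟨k + 1, c, .again (by simp [tri_zero]) (.pop (tri_le (by simpa) (by simp; omega)
        (by simp; omega) hs) ?_) (s' := tri r s [0] (List.replicate (j + 1) 0) l) ?_, ?_, ?_⟩
      · rw [tri_self hr, tri_update_self hr]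
        simp only [List.head?_cons, h, if_true, List.tail_cons]
        exact .push_one 0 (by simpa) (by simp; omega) (by omega) hs
      · rwa [show j + (k + 1) = j + 1 + k by omega]
      · simp only [incL, h, if_true]
        rw [← h2, List.replicate_succ]
        rfl
      · simp only [incL, h, if_true, List.length_cons]
        omega
    · refine ⟨0, (d + 1) :: l, .again (by simp [tri_zero]) (.pop (tri_le (by simpa)
        (by simp; omega) (by simp; omega) hs) ?_)
        (s' := tri r s [] (List.replicate j 0) ((d + 1) :: l))
        (.done (tri_le (by simp) (by simp; omega) (by simp; omega) hs) rfl), ?_, ?_⟩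
      · rw [tri_self hr, tri_update_self hr]
        simp only [List.head?_cons, h, if_false, List.tail_cons]
        exact .seq (.push_self hr _ (by simpa) (by simp; omega) (by omega) hs)
          (.pop_zero (by simpa) (by simp; omega) (by simp; omega) hs)
      · simp [incL, h]
      · simp [incL, h]

/-- The body of the loop of `dec`: treat one digit. -/
def decBody (r : ℕ) : Prog :=
  .pop r fun o => match o with
    | none => .pop 0 fun _ => .skip
    | some d => if d = 0 then
        .pop r fun o => match o with
          | none => .pop 0 fun _ => .skip
          | some d' => .seq (.push r d') (.push 1 0)
      else .seq (.push r (d - 1)) (.pop 0 fun _ => .skip)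

/-- The program that decrements the number on the stack `r` (zero stays zero). -/
def dec (r : ℕ) : Prog := .seq (.push 0 0) (.seq (.loop 0 (decBody r)) (unwind r 6))

theorem Runs.decLoop {L r : ℕ} (hr : 2 ≤ r) {s : Store} (hs : ∀ x, (s x).length ≤ L)
    (hL : 1 ≤ L) (l : List (Fin 7)) (j : ℕ) (hj : j + l.length < L) :
    ∃ k c, Runs L (.loop 0 (decBody r)) (tri r s [0] (List.replicate j 0) l)
      (tri r s [] (List.replicate (j + k) 0) c) ∧ List.replicate k 6 ++ c = decL l ∧
      (decL l).length ≤ l.length := by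
  induction l generalizing j with
  | nil =>
    refine ⟨0, [], .again (by simp [tri_zero]) (.pop (tri_le (by simpa) (by simp; omega)
      (by simp) hs) ?_) (s' := tri r s [] (List.replicate j 0) [])
      (.done (tri_le (by simp) (by simp; omega) (by simp) hs) rfl), rfl, by simp [decL]⟩
    rw [tri_self hr, tri_update_self hr]
    exact .pop_zero (by simpa) (by simp; omega) (by simp) hs
  | cons d l ih =>
    simp only [List.length_cons] at hj
    by_cases h : d = 0
    · cases l with
      | nil =>
        refine ⟨0, [], .again (by simp [tri_zero]) (.pop (tri_le (by simpa) (by simp; omega)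
          (by simp; omega) hs) ?_) (s' := tri r s [] (List.replicate j 0) [])
          (.done (tri_le (by simp) (by simp; omega) (by simp) hs) rfl), by simp [decL, h],
          by simp [decL, h]⟩
        rw [tri_self hr, tri_update_self hr]
        simp only [List.head?_cons, h, if_true, List.tail_cons]
        refine .pop (tri_le (by simpa) (by simp; omega) (by simp) hs) ?_
        rw [tri_self hr, tri_update_self hr]
        exact .pop_zero (by simpa) (by simp; omega) (by simp) hs
      | cons d' l =>
        simp only [List.length_cons] at hj
        obtain ⟨k, c, h1, h2, h3⟩ := ih (j + 1) (by simp only [List.length_cons]; omega)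
        refine ⟨k + 1, c, .again (by simp [tri_zero]) (.pop (tri_le (by simpa) (by simp; omega)
          (by simp; omega) hs) ?_) (s' := tri r s [0] (List.replicate (j + 1) 0) (d' :: l)) ?_,
          ?_, ?_⟩
        · rw [tri_self hr, tri_update_self hr]
          simp only [List.head?_cons, h, if_true, List.tail_cons]
          refine .pop (tri_le (by simpa) (by simp; omega) (by simp; omega) hs) ?_
          rw [tri_self hr, tri_update_self hr]
          exact .seq (.push_self hr _ (by simpa) (by simp; omega) (by simp; omega) hs)
            (.push_one 0 (by simpa) (by simp; omega) (by simp; omega) hs)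
        · rwa [show j + (k + 1) = j + 1 + k by omega]
        · rw [decL, if_pos h, if_neg (by simp), ← h2, List.replicate_succ]
          rfl
        · rw [decL, if_pos h, if_neg (by simp), List.length_cons, List.length_cons]
          omega
    · refine ⟨0, (d - 1) :: l, .again (by simp [tri_zero]) (.pop (tri_le (by simpa)
        (by simp; omega) (by simp; omega) hs) ?_)
        (s' := tri r s [] (List.replicate j 0) ((d - 1) :: l))
        (.done (tri_le (by simp) (by simp; omega) (by simp; omega) hs) rfl), ?_, ?_⟩
      · rw [tri_self hr, tri_update_self hr]
        simp only [List.head?_cons, h, if_false, List.tail_cons]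
        exact .seq (.push_self hr _ (by simpa) (by simp; omega) (by omega) hs)
          (.pop_zero (by simpa) (by simp; omega) (by simp; omega) hs)
      · simp [decL, h]
      · simp [decL, h]

/-! ### Programs on registers -/

/-- The contents of all registers. -/
abbrev Regs := ℕ → ℕ

/-- The stacks that represent the contents of the registers. -/
def store (ρ : Regs) : Store := fun r => dg (ρ r)

/-- The program `P` leads from the register contents `ρ` to `ρ'`, using on each stack not more than
one digit in addition to those that the number `M` has. -/
def RRun (M : ℕ) (P : Prog) (ρ ρ' : Regs) : Prop :=
  Runs ((dg M).length + 1) P (store ρ) (store ρ')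

theorem store_tri {ρ : Regs} {r : ℕ} (hr : 2 ≤ r) (h0 : ρ 0 = 0) (h1 : ρ 1 = 0) (x : ℕ) :
    tri r (store ρ) [] [] (dg x) = store (update ρ r x) := by
  funext y
  unfold tri store
  split_ifs with hy hy' hy''
  · subst hy
    rw [update_of_ne (by omega), h0, dg_zero]
  · subst hy'
    rw [update_of_ne (by omega), h1, dg_zero]
  · subst hy''
    rw [update_self]
  · rw [update_of_ne hy'']

theorem store_le {ρ : Regs} {M : ℕ} (h : ∀ r, ρ r ≤ M) (r : ℕ) :
    (store ρ r).length ≤ (dg M).length + 1 :=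
  (length_dg_mono (h r)).trans (Nat.le_succ _)

theorem RRun.inc {M r : ℕ} {ρ : Regs} (hr : 2 ≤ r) (h0 : ρ 0 = 0) (h1 : ρ 1 = 0)
    (hM : ∀ r, ρ r ≤ M) : RRun M (inc r) ρ (update ρ r (ρ r + 1)) := by
  unfold RRun
  have hs := store_le hM
  have hl : (dg (ρ r)).length ≤ (dg M).length := length_dg_mono (hM r)
  obtain ⟨k, c, h2, h3, h4⟩ := Runs.incLoop hr hs (by omega) (dg (ρ r)) 0 (by omega)
  have h5 := Runs.unwind hr 0 hs k c (by
    have := congrArg List.length h3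
    simp at this
    omega)
  rw [h3, incL_dg, store_tri hr h0 h1] at h5
  refine .seq ?_ (.seq h2 (by simpa using h5))
  have := Runs.push_zero (r := r) (s := store ρ) (a := []) (b := []) (c := dg (ρ r))
    (L := (dg M).length + 1) 0 (by simp) (by simp) (by omega) hs
  rwa [store_tri hr h0 h1, update_eq_self] at this

theorem RRun.dec {M r : ℕ} {ρ : Regs} (hr : 2 ≤ r) (h0 : ρ 0 = 0) (h1 : ρ 1 = 0)
    (hM : ∀ r, ρ r ≤ M) : RRun M (dec r) ρ (update ρ r (ρ r - 1)) := by
  unfold RRun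
  have hs := store_le hM
  have hl : (dg (ρ r)).length ≤ (dg M).length := length_dg_mono (hM r)
  obtain ⟨k, c, h2, h3, h4⟩ := Runs.decLoop hr hs (by omega) (dg (ρ r)) 0 (by omega)
  have h5 := Runs.unwind hr 6 hs k c (by
    have := congrArg List.length h3
    simp at this
    omega)
  rw [h3, decL_dg, store_tri hr h0 h1] at h5
  refine .seq ?_ (.seq h2 (by simpa using h5))
  have := Runs.push_zero (r := r) (s := store ρ) (a := []) (b := []) (c := dg (ρ r))
    (L := (dg M).length + 1) 0 (by simp) (by simp) (by omega) hs
  rwa [store_tri hr h0 h1, update_eq_self] at this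

theorem RRun.skip {M : ℕ} {ρ : Regs} (hM : ∀ r, ρ r ≤ M) : RRun M .skip ρ ρ :=
  Runs.skip (store_le hM)

theorem RRun.seq {M : ℕ} {P Q : Prog} {ρ ρ' ρ'' : Regs} (h : RRun M P ρ ρ')
    (h' : RRun M Q ρ' ρ'') : RRun M (.seq P Q) ρ ρ'' :=
  Runs.seq h h'

/-- Removing the top digit divides by 7, up to the shift of bijective numeration. -/
theorem RRun.shift {M r : ℕ} {ρ : Regs} (hM : ∀ r, ρ r ≤ M) :
    RRun M (.pop r fun _ => .skip) ρ (update ρ r ((ρ r - 1) / 7)) := by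
  have e : store (update ρ r ((ρ r - 1) / 7)) = update (store ρ) r (store ρ r).tail := by
    funext x
    by_cases hx : x = r
    · subst hx
      simp only [store, update_self]
      rw [dg.eq_1 (ρ x)]
      split_ifs with h
      · simp [h]
      · simp
    · simp [store, hx]
  refine Runs.pop (store_le hM) ?_
  rw [e]
  refine .skip ?_
  rw [← e]
  refine store_le fun x => ?_
  by_cases hx : x = r
  · subst hx
    rw [update_self]
    have := hM x
    omega
  · rw [update_of_ne hx]
    exact hM x

/-- The rule for loops: the sequence `ρ` consists of the register contents before each pass through
the loop. -/
theorem RRun.loop {M r n : ℕ} {P : Prog} (ρ : ℕ → Regs)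
    (h : ∀ t < n, ρ t r ≠ 0 ∧ RRun M P (ρ t) (ρ (t + 1))) (hn : ρ n r = 0)
    (hM : ∀ x, ρ n x ≤ M) : RRun M (.loop r P) (ρ 0) (ρ n) := by
  induction n generalizing ρ with
  | zero => exact Runs.done (store_le hM) (dg_eq_nil.2 hn)
  | succ n ih =>
    have h0 := h 0 (by omega)
    exact Runs.again (fun hd => h0.1 (dg_eq_nil.1 hd)) h0.2
      (ih (fun t => ρ (t + 1)) (fun t ht => h (t + 1) (by omega)) hn hM)

end StackProgram

/-! ### Moving register contents -/

namespace StackProgram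

open Function

/-- The auxiliary registers `0`, `1` and all registers from `s` on are zero. -/
def Clean (s : ℕ) (ρ : Regs) : Prop := ρ 0 = 0 ∧ ρ 1 = 0 ∧ ∀ r, s ≤ r → ρ r = 0

theorem RRun.of_eq {M : ℕ} {P : Prog} {ρ ρ' σ σ' : Regs} (h : RRun M P ρ ρ') (e : ρ = σ)
    (e' : ρ' = σ') : RRun M P σ σ' := by
  rwa [← e, ← e']

/-- Set the register `r` to zero. -/
def clear (r : ℕ) : Prog := .loop r (dec r)

theorem RRun.clear {M r : ℕ} {ρ : Regs} (hr : 2 ≤ r) (h0 : ρ 0 = 0) (h1 : ρ 1 = 0)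
    (hM : ∀ r, ρ r ≤ M) : RRun M (clear r) ρ (update ρ r 0) := by
  have key := RRun.loop (M := M) (r := r) (n := ρ r) (P := StackProgram.dec r)
    (fun t => update ρ r (ρ r - t)) ?_ (by simp) ?_
  · simp only [Nat.sub_zero, Nat.sub_self, update_eq_self] at key
    exact key
  · intro t ht
    refine ⟨by simp; omega, ?_⟩
    have := RRun.dec (M := M) (r := r) (ρ := update ρ r (ρ r - t)) hr
      (by rwa [update_of_ne (by omega)]) (by rwa [update_of_ne (by omega)])
      (fun x => by have := hM x; have := hM r; rw [update_apply]; split_ifs <;> omega)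
    simpa [Nat.sub_sub] using this
  · intro x
    have := hM x
    rw [update_apply]
    split_ifs <;> omega

/-- Add the register `a` to the register `b`, and set `a` to zero. -/
def addTo (a b : ℕ) : Prog := .loop a (.seq (dec a) (inc b))

theorem RRun.addTo {M a b : ℕ} {ρ : Regs} (ha : 2 ≤ a) (hb : 2 ≤ b) (hab : a ≠ b) (h0 : ρ 0 = 0)
    (h1 : ρ 1 = 0) (hM : ∀ r, ρ r ≤ M) (h : ρ a + ρ b ≤ M) :
    RRun M (addTo a b) ρ (update (update ρ a 0) b (ρ b + ρ a)) := by
  have key := RRun.loop (M := M) (r := a) (n := ρ a) 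
    (P := .seq (StackProgram.dec a) (StackProgram.inc b))
    (fun t => update (update ρ a (ρ a - t)) b (ρ b + t)) ?_ (by simp [hab]) ?_
  · simp only [Nat.sub_zero, Nat.add_zero, Nat.sub_self, update_eq_self] at key
    exact key
  · intro t ht
    refine ⟨by simp [hab]; omega, ?_⟩
    have h2 := RRun.dec (M := M) (r := a) (ρ := update (update ρ a (ρ a - t)) b (ρ b + t)) ha
      (by rwa [update_of_ne (by omega), update_of_ne (by omega)])
      (by rwa [update_of_ne (by omega), update_of_ne (by omega)])
      (fun x => by have := hM x; simp only [update_apply]; split_ifs <;> omega)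
    refine h2.seq ?_
    have h3 := RRun.inc (M := M) (r := b)
      (ρ := update (update (update ρ a (ρ a - t)) b (ρ b + t)) a (ρ a - t - 1)) hb
      (by rwa [update_of_ne (by omega), update_of_ne (by omega), update_of_ne (by omega)])
      (by rwa [update_of_ne (by omega), update_of_ne (by omega), update_of_ne (by omega)])
      (fun x => by have := hM x; simp only [update_apply]; split_ifs <;> omega)
    convert h3 using 1
    · funext x
      simp only [update_apply]
      split_ifs <;> omega
    · funext x
      simp only [update_apply]
      split_ifs <;> omega
  · intro x
    have := hM x
    simp only [update_apply]
    split_ifs <;> omega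

/-- Add the register `a` to both registers `b` and `b'`, and set `a` to zero. -/
def addTo₂ (a b b' : ℕ) : Prog := .loop a (.seq (dec a) (.seq (inc b) (inc b')))

theorem RRun.addTo₂ {M a b b' : ℕ} {ρ : Regs} (ha : 2 ≤ a) (hb : 2 ≤ b) (hb' : 2 ≤ b')
    (hab : a ≠ b) (hab' : a ≠ b') (hbb : b ≠ b') (h0 : ρ 0 = 0) (h1 : ρ 1 = 0)
    (hM : ∀ r, ρ r ≤ M) (h : ρ a + ρ b ≤ M) (h' : ρ a + ρ b' ≤ M) :
    RRun M (addTo₂ a b b') ρ (update (update (update ρ a 0) b (ρ b + ρ a)) b' (ρ b' + ρ a)) := by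
  have key := RRun.loop (M := M) (r := a) (n := ρ a)
    (P := .seq (StackProgram.dec a) (.seq (StackProgram.inc b) (StackProgram.inc b')))
    (fun t => update (update (update ρ a (ρ a - t)) b (ρ b + t)) b' (ρ b' + t)) ?_
    (by simp [hab, hab']) ?_
  · simp only [Nat.sub_zero, Nat.add_zero, Nat.sub_self, update_eq_self] at key
    exact key
  · intro t ht
    refine ⟨by simp [hab, hab']; omega, ?_⟩
    have h2 := RRun.dec (M := M) (r := a)
      (ρ := update (update (update ρ a (ρ a - t)) b (ρ b + t)) b' (ρ b' + t)) ha
      (by simp only [update_apply]; split_ifs <;> omega)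
      (by simp only [update_apply]; split_ifs <;> omega)
      (fun x => by have := hM x; simp only [update_apply]; split_ifs <;> omega)
    have h3 := RRun.inc (M := M) (r := b)
      (ρ := update (update (update ρ a (ρ a - (t + 1))) b (ρ b + t)) b' (ρ b' + t)) hb
      (by simp only [update_apply]; split_ifs <;> omega)
      (by simp only [update_apply]; split_ifs <;> omega)
      (fun x => by have := hM x; simp only [update_apply]; split_ifs <;> omega)
    have h4 := RRun.inc (M := M) (r := b')
      (ρ := update (update (update ρ a (ρ a - (t + 1))) b (ρ b + (t + 1))) b' (ρ b' + t)) hb'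
      (by simp only [update_apply]; split_ifs <;> omega)
      (by simp only [update_apply]; split_ifs <;> omega)
      (fun x => by have := hM x; simp only [update_apply]; split_ifs <;> omega)
    refine (h2.of_eq rfl ?_).seq (h3.seq (h4.of_eq ?_ ?_))
    all_goals
      funext x
      simp only [update_apply]
      split_ifs <;> omega
  · intro x
    have := hM x
    simp only [update_apply]
    split_ifs <;> omega

/-- Copy the register `a` to the register `o`, using the registers `s` and `s + 1`. -/
def copy (a o s : ℕ) : Prog :=
  .seq (addTo₂ a s (s + 1)) (.seq (addTo (s + 1) a) (.seq (clear o) (addTo s o)))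

theorem RRun.copy {M a o s : ℕ} {ρ : Regs} (ha : 2 ≤ a) (has : a < s) (ho : 2 ≤ o) (hos : o < s)
    (hρ : Clean s ρ) (hM : ∀ r, ρ r ≤ M) : RRun M (copy a o s) ρ (update ρ o (ρ a)) := by
  obtain ⟨h0, h1, hs⟩ := hρ
  have hs0 := hs s le_rfl
  have hs1 := hs (s + 1) (by omega)
  have hMa := hM a
  have e1 := RRun.addTo₂ (M := M) (a := a) (b := s) (b' := s + 1) ha (by omega) (by omega)
    (by omega) (by omega) (by omega) h0 h1 hM (by omega) (by omega)
  have e2 := RRun.addTo (M := M) (a := s + 1) (b := a)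
    (ρ := update (update (update ρ a 0) s (ρ a)) (s + 1) (ρ a)) (by omega) ha (by omega)
    (by rwa [update_of_ne (by omega), update_of_ne (by omega), update_of_ne (by omega)])
    (by simp only [update_apply]; split_ifs <;> omega)
    (fun x => by have := hM x; simp only [update_apply]; split_ifs <;> omega)
    (by rw [update_self, update_of_ne (by omega), update_of_ne (by omega), update_self]; omega)
  have e3 := RRun.clear (M := M) (r := o) (ρ := update ρ s (ρ a)) ho
    (by simp only [update_apply]; split_ifs <;> omega)
    (by simp only [update_apply]; split_ifs <;> omega)
    (fun x => by have := hM x; simp only [update_apply]; split_ifs <;> omega)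
  have e4 := RRun.addTo (M := M) (a := s) (b := o)
    (ρ := update (update ρ s (ρ a)) o 0) (by omega) ho (by omega)
    (by simp only [update_apply]; split_ifs <;> omega)
    (by simp only [update_apply]; split_ifs <;> omega)
    (fun x => by have := hM x; simp only [update_apply]; split_ifs <;> omega)
    (by rw [update_self, update_of_ne (by omega), update_self]; omega)
  refine (e1.of_eq rfl ?_).seq (e2.seq ((e3.of_eq ?_ rfl).seq (e4.of_eq rfl ?_)))
  · rw [hs0, hs1]
    simp
  · funext x
    by_cases hx : x = s + 1
    · subst hx
      simp [show s + 1 ≠ a by omega, hs1]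
    · by_cases hx' : x = a
      · subst hx'
        simp [show x ≠ s + 1 by omega, show x ≠ s by omega]
      · simp [hx, hx', update_apply]
  · funext x
    by_cases hx : x = s
    · subst hx
      simp [show x ≠ o by omega, hs0]
    · by_cases hx' : x = o
      · subst hx'
        simp [show s ≠ x by omega]
      · simp [hx, hx']

/-- Set the registers `a, …, a + k - 1` to zero. -/
def clearN (a : ℕ) : ℕ → Prog
  | 0 => .skip
  | k + 1 => .seq (clearN a k) (clear (a + k))

theorem RRun.clearN {M a k : ℕ} {ρ : Regs} (ha : 2 ≤ a) (h0 : ρ 0 = 0) (h1 : ρ 1 = 0)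
    (hM : ∀ r, ρ r ≤ M) :
    RRun M (clearN a k) ρ (fun r => if a ≤ r ∧ r < a + k then 0 else ρ r) := by
  induction k with
  | zero =>
    refine (RRun.skip hM).of_eq rfl ?_
    funext x
    rw [if_neg (by omega)]
  | succ k ih =>
    refine ih.seq ?_
    refine (RRun.clear (M := M) (r := a + k) (ρ := fun r => if a ≤ r ∧ r < a + k then 0 else ρ r)
      (by omega) (by split_ifs <;> omega) (by split_ifs <;> omega)
      (fun x => by have := hM x; split_ifs <;> omega)).of_eq rfl ?_
    funext x
    simp only [update_apply]
    split_ifs <;> omega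

/-- Move the registers `a, …, a + k - 1` to `b, …, b + k - 1`. -/
def moveN (a b : ℕ) : ℕ → Prog
  | 0 => .skip
  | k + 1 => .seq (moveN a b k) (.seq (clear (b + k)) (addTo (a + k) (b + k)))

theorem RRun.moveN {M a b k : ℕ} {ρ : Regs} (hb : 2 ≤ b) (hab : b + k ≤ a) (h0 : ρ 0 = 0)
    (h1 : ρ 1 = 0) (hM : ∀ r, ρ r ≤ M) :
    RRun M (moveN a b k) ρ (fun r => if b ≤ r ∧ r < b + k then ρ (a + (r - b)) else
      if a ≤ r ∧ r < a + k then 0 else ρ r) := by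
  induction k with
  | zero =>
    refine (RRun.skip hM).of_eq rfl ?_
    funext x
    rw [if_neg (by omega), if_neg (by omega)]
  | succ k ih =>
    refine (ih (by omega)).seq ?_
    set σ : Regs := fun r => if b ≤ r ∧ r < b + k then ρ (a + (r - b)) else
      if a ≤ r ∧ r < a + k then 0 else ρ r with hσ
    have hσM : ∀ x, σ x ≤ M := fun x => by
      have := hM x
      have := hM (a + (x - b))
      simp only [hσ]
      split_ifs <;> omega
    have hσ0 : σ 0 = 0 := by simp only [hσ]; split_ifs <;> omega
    have hσ1 : σ 1 = 0 := by simp only [hσ]; split_ifs <;> omega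
    refine RRun.seq (RRun.clear (by omega) hσ0 hσ1 hσM) ?_
    have hak : σ (a + k) = ρ (a + k) := by
      simp only [hσ]
      rw [if_neg (by omega), if_neg (by omega)]
    have := hM (a + k)
    convert RRun.addTo (M := M) (a := a + k) (b := b + k) (ρ := update σ (b + k) 0)
      (by omega) (by omega) (by omega) (by rw [update_of_ne (by omega), hσ0])
      (by rw [update_of_ne (by omega), hσ1])
      (fun x => by have := hσM x; simp only [update_apply]; split_ifs <;> omega)
      (by rw [update_self, update_of_ne (by omega), hak]; omega) using 1
    funext x
    rw [update_self, update_of_ne (show a + k ≠ b + k by omega), hak]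
    by_cases hx : x = b + k
    · subst hx
      rw [update_self, if_pos (by omega)]
      simp
    · rw [update_of_ne hx]
      by_cases hx' : x = a + k
      · subst hx'
        rw [update_self, if_neg (by omega), if_pos (by omega)]
      · rw [update_of_ne hx', update_of_ne hx]
        simp only [hσ]
        split_ifs <;> omega

end StackProgram

/-! ### Functions computable in linear space -/

namespace StackProgram

open Function

/-- A type whose elements are represented by `dim` registers. -/
class Ctx (α : Type) where
  /-- the number of registers -/
  dim : ℕ
  /-- the contents of the `j`-th register, for `j < dim` -/
  put : α → ℕ → ℕ

open Ctx

instance : Ctx ℕ where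
  dim := 1
  put x _ := x

open Classical in
/-- A proposition is represented by the number 1 or 0, according to its truth value. -/
noncomputable instance : Ctx Prop where
  dim := 1
  put p _ := if p then 1 else 0

instance {α β : Type} [Ctx α] [Ctx β] : Ctx (α × β) where
  dim := dim α + dim β
  put x j := if j < dim α then put x.1 j else put x.2 (j - dim α)

variable {α β γ δ : Type} [Ctx α] [Ctx β] [Ctx γ] [Ctx δ]

/-- All registers of the representation of `c` hold at most `B`. -/
def AtMost (B : ℕ) (c : γ) : Prop := ∀ j < dim γ, put c j ≤ B

theorem AtMost.mono {B B' : ℕ} {c : γ} (h : AtMost B c) (hB : B ≤ B') : AtMost B' c :=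
  fun j hj => (h j hj).trans hB

@[simp] theorem atMost_nat {B x : ℕ} : AtMost B x ↔ x ≤ B :=
  ⟨fun h => h 0 Nat.one_pos, fun h _ _ => h⟩

open Classical in
theorem atMost_prop {B : ℕ} (hB : 1 ≤ B) (p : Prop) : AtMost B p := by
  intro j _
  show (if p then 1 else 0) ≤ B
  split_ifs <;> omega

@[simp] theorem atMost_prod {B : ℕ} {x : α × β} : AtMost B x ↔ AtMost B x.1 ∧ AtMost B x.2 := by
  constructor
  · intro h
    refine ⟨fun j hj => ?_, fun j hj => ?_⟩
    · have := h j (show j < dim α + dim β by omega)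
      simpa only [put, if_pos hj] using this
    · have := h (dim α + j) (show _ < dim α + dim β by omega)
      have e : ¬ dim α + j < dim α := by omega
      simpa only [put, if_neg e, Nat.add_sub_cancel_left] using this
  · rintro ⟨h1, h2⟩ j (hj : j < dim α + dim β)
    simp only [put]
    split_ifs with h
    · exact h1 j h
    · exact h2 _ (by omega)

/-- The values of `f` are bounded by a power of a bound on the argument. In terms of the lengths of
numerals this is a linear bound. -/
def PolyBdd (f : γ → δ) : Prop :=
  ∃ d, ∀ c B, 2 ≤ B → AtMost B c → AtMost (B ^ d) (f c)

/-- There are programs, within a bound of the same kind, for the assignment `o := f (c)`: the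
argument `c` is found in the registers `i 0, i 1, …`, and the registers from `s` on may be used as
scratch space. -/
def Assignable (f : γ → ℕ) : Prop :=
  ∀ (i : ℕ → ℕ) (s o : ℕ), (∀ j, 2 ≤ i j ∧ i j < s) → 2 ≤ o → o < s → ∃ P d,
    ∀ (c : γ) (ρ : Regs) (B M : ℕ), Clean s ρ → 2 ≤ B → (∀ j < dim γ, ρ (i j) = put c j) →
      AtMost B c → B ^ d ≤ M → (∀ r, ρ r ≤ M) → RRun M P ρ (update ρ o (f c))

/-- The functions computable in linear space: all values in the computation are bounded by a fixed
power of a bound on the arguments. -/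
@[fun_prop]
def LinSpace (f : γ → δ) : Prop :=
  PolyBdd f ∧ ∀ j < dim δ, Assignable fun c => put (f c) j

theorem pow_le_of_le {B d D M : ℕ} (hB : 2 ≤ B) (hd : d ≤ D) (hM : B ^ D ≤ M) : B ^ d ≤ M :=
  (Nat.pow_le_pow_right (by omega) hd).trans hM

/-- The register contents `ρ` with `v 0, …, v (k - 1)` in the registers `s, …, s + k - 1`. -/
def overlay (s k : ℕ) (v : ℕ → ℕ) (ρ : Regs) : Regs :=
  fun r => if s ≤ r ∧ r < s + k then v (r - s) else ρ r

section overlay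

variable {s k : ℕ} {v : ℕ → ℕ} {ρ : Regs}

theorem overlay_of_lt {r : ℕ} (h : r < s) : overlay s k v ρ r = ρ r := if_neg (by omega)

theorem overlay_of_ge {r : ℕ} (h : s + k ≤ r) : overlay s k v ρ r = ρ r := if_neg (by omega)

theorem overlay_add {j : ℕ} (h : j < k) : overlay s k v ρ (s + j) = v j := by
  rw [overlay, if_pos (by omega), Nat.add_sub_cancel_left]

theorem overlay_le {M : ℕ} (hv : ∀ j < k, v j ≤ M) (hρ : ∀ r, ρ r ≤ M) (r : ℕ) :
    overlay s k v ρ r ≤ M := by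
  unfold overlay
  split_ifs
  · exact hv _ (by omega)
  · exact hρ r

theorem Clean.overlay {s' : ℕ} (h : Clean s' ρ) (hs : 2 ≤ s) (hs' : s + k ≤ s') :
    Clean s' (overlay s k v ρ) := by
  refine ⟨?_, ?_, fun r hr => ?_⟩
  · rw [overlay_of_lt (by omega), h.1]
  · rw [overlay_of_lt (by omega), h.2.1]
  · rw [overlay_of_ge (by omega), h.2.2 r hr]

theorem Clean.mono {s' : ℕ} (h : Clean s ρ) (hs : s ≤ s') : Clean s' ρ :=
  ⟨h.1, h.2.1, fun r hr => h.2.2 r (hs.trans hr)⟩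

theorem Clean.update {o x : ℕ} (h : Clean s ρ) (ho : 2 ≤ o) (hos : o < s) :
    Clean s (update ρ o x) := by
  refine ⟨?_, ?_, fun r hr => ?_⟩
  · rw [update_of_ne (by omega), h.1]
  · rw [update_of_ne (by omega), h.2.1]
  · rw [update_of_ne (by omega), h.2.2 r hr]

theorem update_le {M o x : ℕ} (hx : x ≤ M) (hρ : ∀ r, ρ r ≤ M) (r : ℕ) : update ρ o x r ≤ M := by
  rw [update_apply]
  split_ifs
  exacts [hx, hρ r]

theorem overlay_succ : overlay s (k + 1) v ρ = update (overlay s k v ρ) (s + k) (v k) := by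
  funext r
  by_cases hr : r = s + k
  · subst hr
    rw [update_self, overlay_add (by omega)]
  · rw [update_of_ne hr, overlay, overlay]
    by_cases h' : s ≤ r ∧ r < s + k
    · rw [if_pos h', if_pos (by omega)]
    · rw [if_neg h', if_neg (by omega)]

/-- Clearing the scratch registers restores the values they had before. -/
theorem overlay_zero_eq {o x : ℕ} (h : Clean s ρ) (ho : o < s) :
    overlay s k (fun _ => 0) (update (overlay s k v ρ) o x) = update ρ o x := by
  funext r
  by_cases hr : r = o
  · subst hr
    rw [overlay_of_lt ho, update_self, update_self]
  · rw [update_of_ne hr, overlay, update_of_ne hr, overlay]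
    by_cases h' : s ≤ r ∧ r < s + k
    · rw [if_pos h', h.2.2 r h'.1]
    · rw [if_neg h', if_neg h']

end overlay

/-- Simultaneous assignment to the registers `t, …, t + k - 1`. -/
theorem exists_assignN (h : ℕ → γ → ℕ) {k : ℕ} (hh : ∀ j < k, Assignable (h j)) {i : ℕ → ℕ}
    {t s : ℕ} (hi : ∀ j, 2 ≤ i j ∧ i j < t) (hs : t + k ≤ s) : ∃ P d,
    ∀ (c : γ) (ρ : Regs) (B M : ℕ), Clean s ρ → 2 ≤ B → (∀ j < dim γ, ρ (i j) = put c j) →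
      AtMost B c → B ^ d ≤ M → (∀ r, ρ r ≤ M) → (∀ j < k, h j c ≤ M) →
      RRun M P ρ (overlay t k (fun j => h j c) ρ) := by
  induction k with
  | zero =>
    refine ⟨.skip, 0, fun c ρ B M _ _ _ _ _ hM _ => (RRun.skip hM).of_eq rfl ?_⟩
    funext r
    rw [overlay, if_neg (by omega)]
  | succ k ih =>
    obtain ⟨P, d, hP⟩ := ih (fun j hj => hh j (by omega)) (by omega)
    have hi0 := hi 0
    obtain ⟨Q, e, hQ⟩ := hh k (by omega) i s (t + k)
      (fun j => ⟨(hi j).1, by have := (hi j).2; omega⟩) (by omega) (by omega)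
    refine ⟨.seq P Q, d + e, fun c ρ B M hρ hB hc hcB hM hρM hhM => ?_⟩
    refine (hP c ρ B M hρ hB hc hcB (pow_le_of_le hB (Nat.le_add_right _ _) hM) hρM
      fun j hj => hhM j (by omega)).seq ?_
    refine (hQ c _ B M (hρ.overlay (by omega) (by omega)) hB ?_ hcB
      (pow_le_of_le hB (Nat.le_add_left _ _) hM)
      (overlay_le (fun j hj => hhM j (by omega)) hρM)).of_eq rfl overlay_succ.symm
    intro j hj
    rw [overlay_of_lt (hi j).2, hc j hj]

theorem PolyBdd.comp {f : γ → δ} {g : β → γ} (hf : PolyBdd f) (hg : PolyBdd g) :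
    PolyBdd fun c => f (g c) := by
  obtain ⟨d, hd⟩ := hf
  obtain ⟨e, he⟩ := hg
  refine ⟨(e + 1) * d, fun c B hB hc => ?_⟩
  rw [pow_mul]
  exact hd _ _ (hB.trans (Nat.le_self_pow (by omega) B))
    ((he c B hB hc).mono (Nat.pow_le_pow_right (by omega) (Nat.le_succ _)))

theorem Assignable.comp {f : γ → ℕ} {g : β → γ} (hf : Assignable f) (hfb : PolyBdd f)
    (hg : LinSpace g) : Assignable fun c => f (g c) := by
  obtain ⟨b, hb⟩ := hfb.comp hg.1
  obtain ⟨⟨e, he⟩, hg⟩ := hg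
  intro i s o hi ho hos
  obtain ⟨P, d, hP⟩ := exists_assignN (fun j c => put (g c) j) hg (s := s + dim γ) hi le_rfl
  have hi0 := hi 0
  obtain ⟨Q, d', hQ⟩ := hf (fun j => if j < dim γ then s + j else i 0) (s + dim γ) o
    (fun j => by split_ifs <;> omega) ho (by omega)
  refine ⟨.seq P (.seq Q (clearN s (dim γ))), d + e + (e + 1) * d' + b,
    fun c ρ B M hρ hB hc hcB hM hρM => ?_⟩
  have hMg : ∀ j < dim γ, put (g c) j ≤ M := fun j hj =>
    (he c B hB hcB j hj).trans (pow_le_of_le hB (by omega) hM)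
  have hMf : f (g c) ≤ M :=
    (hb c B hB hcB 0 Nat.one_pos).trans (pow_le_of_le hB (by omega) hM)
  have hρ' : Clean (s + dim γ) ρ := hρ.mono (by omega)
  have h1 := hP c ρ B M hρ' hB hc hcB (pow_le_of_le hB (by omega) hM) hρM hMg
  have h2 := hQ (g c) _ (B ^ (e + 1)) M (hρ'.overlay (v := put (g c)) (by omega) le_rfl)
    (hB.trans (Nat.le_self_pow (by omega) B))
    (fun j hj => by rw [if_pos hj, overlay_add hj])
    ((he c B hB hcB).mono (Nat.pow_le_pow_right (by omega) (Nat.le_succ _)))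
    (by rw [← pow_mul]; exact pow_le_of_le hB (by omega) hM) (overlay_le hMg hρM)
  have h3 := (hρ'.overlay (v := put (g c)) (by omega) le_rfl).update (x := f (g c)) ho (by omega)
  exact h1.seq (h2.seq ((RRun.clearN (by omega) h3.1 h3.2.1
    (update_le hMf (overlay_le hMg hρM))).of_eq rfl (overlay_zero_eq hρ hos)))

@[fun_prop]
theorem LinSpace.comp {f : γ → δ} {g : β → γ} (hf : LinSpace f) (hg : LinSpace g) :
    LinSpace fun c => f (g c) := by
  refine ⟨hf.1.comp hg.1, fun j hj => (hf.2 j hj).comp ?_ hg⟩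
  obtain ⟨d, hd⟩ := hf.1
  exact ⟨d, fun c B hB hc => atMost_nat.2 (hd c B hB hc j hj)⟩

/-- Reading a register is an assignment. -/
theorem assignable_put {j : ℕ} (hj : j < dim γ) : Assignable fun c : γ => put c j := by
  intro i s o hi ho hos
  refine ⟨copy (i j) o s, 0, fun c ρ B M hρ _ hc _ _ hM => ?_⟩
  exact (RRun.copy (hi j).1 (hi j).2 ho hos hρ hM).of_eq rfl (by rw [hc j hj])

@[fun_prop]
theorem LinSpace.prodMk {f : γ → α} {g : γ → β} (hf : LinSpace f) (hg : LinSpace g) :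
    LinSpace fun c => (f c, g c) := by
  obtain ⟨⟨d, hd⟩, hf⟩ := hf
  obtain ⟨⟨e, he⟩, hg⟩ := hg
  refine ⟨⟨d + e, fun c B hB hc => atMost_prod.2 ⟨?_, ?_⟩⟩, fun j (hj : j < dim α + dim β) => ?_⟩
  · exact (hd c B hB hc).mono (Nat.pow_le_pow_right (by omega) (Nat.le_add_right _ _))
  · exact (he c B hB hc).mono (Nat.pow_le_pow_right (by omega) (Nat.le_add_left _ _))
  · by_cases h : j < dim α
    · simpa only [put, if_pos h] using hf j h
    · simpa only [put, if_neg h] using hg (j - dim α) (by omega)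

@[fun_prop]
theorem LinSpace.fst : LinSpace fun c : α × β => c.1 := by
  refine ⟨⟨1, fun c B _ hc => ?_⟩, fun j hj => ?_⟩
  · rw [pow_one]
    exact (atMost_prod.1 hc).1
  · have := assignable_put (γ := α × β) (j := j) (show j < dim α + dim β by omega)
    simpa only [put, if_pos hj] using this

@[fun_prop]
theorem LinSpace.snd : LinSpace fun c : α × β => c.2 := by
  refine ⟨⟨1, fun c B _ hc => ?_⟩, fun j hj => ?_⟩
  · rw [pow_one]
    exact (atMost_prod.1 hc).2
  · have := assignable_put (γ := α × β) (j := dim α + j) (show _ < dim α + dim β by omega)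
    have e : ¬ dim α + j < dim α := by omega
    simpa only [put, if_neg e, Nat.add_sub_cancel_left] using this

/-- Increment the register `o` `n` times. -/
def incTimes (o : ℕ) : ℕ → Prog
  | 0 => .skip
  | n + 1 => .seq (incTimes o n) (inc o)

theorem assignable_const (n : ℕ) : Assignable fun _ : γ => n := by
  intro i s o hi ho hos
  refine ⟨.seq (clear o) (incTimes o n), n, fun c ρ B M hρ hB hc hcB hM hρM => ?_⟩
  refine (RRun.clear ho hρ.1 hρ.2.1 hρM).seq ?_
  have hn : n ≤ M := (Nat.lt_pow_self (by omega)).le.trans hM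
  clear hM hc hcB hB
  induction n with
  | zero => exact RRun.skip (update_le hn hρM)
  | succ n ih =>
    have h := hρ.update (x := n) ho hos
    refine (ih (by omega)).seq ((RRun.inc ho h.1 h.2.1 (update_le (by omega) hρM)).of_eq rfl ?_)
    simp

@[fun_prop]
theorem LinSpace.const (a : α) : LinSpace fun _ : γ => a := by
  refine ⟨⟨∑ j ∈ Finset.range (dim α), put a j, fun c B hB hc j hj => ?_⟩,
    fun j hj => assignable_const _⟩
  exact (Finset.single_le_sum (f := put a) (fun _ _ => Nat.zero_le _)
    (Finset.mem_range.2 hj)).trans (Nat.lt_pow_self (by omega)).le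

theorem LinSpace.succ' : LinSpace fun x : ℕ => x + 1 := by
  refine ⟨⟨2, fun c B hB hc => ?_⟩, fun j hj => ?_⟩
  · rw [atMost_nat] at *
    nlinarith
  · intro i s o hi ho hos
    refine ⟨.seq (copy (i 0) o s) (inc o), 0, fun c ρ B M hρ hB hc hcB hM hρM => ?_⟩
    have h := hρ.update (x := ρ (i 0)) ho hos
    refine (RRun.copy (hi 0).1 (hi 0).2 ho hos hρ hρM).seq
      ((RRun.inc ho h.1 h.2.1 (update_le (hρM _) hρM)).of_eq rfl ?_)
    rw [update_self, update_idem, hc 0 Nat.one_pos]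
    rfl

theorem LinSpace.pred' : LinSpace fun x : ℕ => x - 1 := by
  refine ⟨⟨1, fun c B hB hc => ?_⟩, fun j hj => ?_⟩
  · rw [atMost_nat, pow_one]
    exact (Nat.sub_le _ _).trans (atMost_nat.1 hc)
  · intro i s o hi ho hos
    refine ⟨.seq (copy (i 0) o s) (dec o), 0, fun c ρ B M hρ hB hc hcB hM hρM => ?_⟩
    have h := hρ.update (x := ρ (i 0)) ho hos
    refine (RRun.copy (hi 0).1 (hi 0).2 ho hos hρ hρM).seq
      ((RRun.dec ho h.1 h.2.1 (update_le (hρM _) hρM)).of_eq rfl ?_)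
    rw [update_self, update_idem, hc 0 Nat.one_pos]
    rfl

/-- Linear space computability is preserved by iteration, as long as the values of the iteration
obey a bound of the same kind. -/
theorem LinSpace.iterate {h : γ → δ → δ} {g : γ → δ} {n : γ → ℕ}
    (hh : LinSpace fun x : γ × δ => h x.1 x.2) (hg : LinSpace g) (hn : LinSpace n)
    (hb : ∃ d, ∀ c B, 2 ≤ B → AtMost B c → ∀ t ≤ n c, AtMost (B ^ d) ((h c)^[t] (g c))) :
    LinSpace fun c => (h c)^[n c] (g c) := by
  obtain ⟨d, hd⟩ := hb
  refine ⟨⟨d, fun c B hB hc => hd c B hB hc _ le_rfl⟩, fun j hj => ?_⟩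
  obtain ⟨⟨b, hb⟩, hn⟩ := hn
  intro i s o hi ho hos
  have hi0 := hi 0
  -- The state of the iteration is in `s, …, s + k - 1`, the counter in `s + k`, and the next state
  -- is computed in `s + k + 1, …, s + k + k`.
  set k := dim δ with hk
  set s' := s + k + 1 + k with hs'
  obtain ⟨P₁, d₁, hP₁⟩ := exists_assignN (fun j c => put (g c) j) hg.2 (s := s') hi (by omega)
  obtain ⟨P₂, d₂, hP₂⟩ := hn 0 Nat.one_pos i s' (s + k)
    (fun j => ⟨(hi j).1, by have := (hi j).2; omega⟩) (by omega) (by omega)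
  obtain ⟨P₃, d₃, hP₃⟩ := exists_assignN (fun j (x : γ × δ) => put (h x.1 x.2) j) hh.2 (s := s')
    (t := s + k + 1) (i := fun j => if j < dim γ then i j else
      if j - dim γ < k then s + (j - dim γ) else i 0)
    (fun j => by have := hi j; split_ifs <;> omega) (by omega)
  refine ⟨.seq P₁ (.seq P₂ (.seq (.loop (s + k) (.seq (dec (s + k)) (.seq P₃
    (moveN (s + k + 1) s k)))) (.seq (copy (s + j) o s') (clearN s k)))),
    d + 1 + d₁ + d₂ + b + (d + 1) * d₃,
    fun c ρ B M hρ hB hc hcB hM hρM => ?_⟩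
  have hB' : 2 ≤ B ^ (d + 1) := hB.trans (Nat.le_self_pow (by omega) B)
  have hdB : ∀ t ≤ n c, AtMost (B ^ (d + 1)) ((h c)^[t] (g c)) := fun t ht =>
    (hd c B hB hcB t ht).mono (Nat.pow_le_pow_right (by omega) (Nat.le_succ _))
  have hdM : ∀ t ≤ n c, ∀ j < k, put ((h c)^[t] (g c)) j ≤ M := fun t ht j hj =>
    (hdB t ht j hj).trans (pow_le_of_le hB (by omega) hM)
  have hnM : n c ≤ M := (hb c B hB hcB 0 Nat.one_pos).trans (pow_le_of_le hB (by omega) hM)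
  have hρ' : Clean s' ρ := hρ.mono (by omega)
  -- The contents of the registers before the pass `t`.
  let σ : ℕ → Regs := fun t => update (overlay s k (put ((h c)^[t] (g c))) ρ) (s + k) (n c - t)
  have hσc : ∀ t, Clean s' (σ t) := fun t =>
    (hρ'.overlay (by omega) (by omega)).update (by omega) (by omega)
  have hσM : ∀ t ≤ n c, ∀ r, σ t r ≤ M := fun t ht =>
    update_le (by omega) (overlay_le (hdM t ht) hρM)
  have h1 := hP₁ c ρ B M hρ' hB hc hcB (pow_le_of_le hB (by omega) hM) hρM (hdM 0 (by omega))
  have h2 := hP₂ c _ B M (hρ'.overlay (s := s) (k := k) (v := put (g c)) (by omega) (by omega)) hB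
    (fun j hj => by rw [overlay_of_lt (hi j).2, hc j hj]) hcB (pow_le_of_le hB (by omega) hM)
    (overlay_le (hdM 0 (by omega)) hρM)
  have h3 : RRun M (.loop (s + k) (.seq (dec (s + k)) (.seq P₃ (moveN (s + k + 1) s k))))
      (σ 0) (σ (n c)) := by
    refine RRun.loop σ (fun t ht => ⟨?_, ?_⟩) (by simp [σ]) (hσM _ le_rfl)
    · simp only [σ, update_self]
      omega
    · have e1 := RRun.dec (M := M) (r := s + k) (ρ := σ t) (by omega) (hσc t).1 (hσc t).2.1
        (hσM t ht.le)
      set τ : Regs := update (overlay s k (put ((h c)^[t] (g c))) ρ) (s + k) (n c - (t + 1)) with hτ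
      have hτc : Clean s' τ := (hρ'.overlay (by omega) (by omega)).update (by omega) (by omega)
      have hτM : ∀ r, τ r ≤ M := update_le (by omega) (overlay_le (hdM t ht.le) hρM)
      have hnext : (h c)^[t + 1] (g c) = h c ((h c)^[t] (g c)) := iterate_succ_apply' _ _ _
      have e2 := hP₃ (c, (h c)^[t] (g c)) τ (B ^ (d + 1)) M hτc hB' (by
          intro j (hj : j < dim γ + k)
          have hij := hi j
          by_cases hj' : j < dim γ
          · simp only [put, if_pos hj']
            rw [hτ, update_of_ne (by omega), overlay_of_lt (by omega), hc j hj']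
          · simp only [put, if_neg hj']
            rw [if_pos (by omega), hτ, update_of_ne (by omega), overlay_add (by omega)])
        (atMost_prod.2 ⟨hcB.mono (Nat.le_self_pow (by omega) B), hdB t ht.le⟩)
        (by rw [← pow_mul]; exact pow_le_of_le hB (by omega) hM) hτM
        (fun j hj => by dsimp only; rw [← hnext]; exact hdM (t + 1) ht j hj)
      have hτo := hτc.overlay (s := s + k + 1) (k := k) (v := put ((h c)^[t + 1] (g c)))
        (by omega) le_rfl
      have e3 := RRun.moveN (M := M) (a := s + k + 1) (b := s) (k := k) (by omega) (by omega)
        hτo.1 hτo.2.1 (overlay_le (hdM (t + 1) ht) hτM)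
      refine (e1.of_eq rfl ?_).seq ((e2.of_eq rfl ?_).seq (e3.of_eq rfl ?_))
      · simp only [σ, update_self, update_idem, hτ, Nat.sub_sub]
      · rw [hnext]
      · funext r
        simp only [σ]
        by_cases hr : s ≤ r ∧ r < s + k
        · obtain ⟨j, rfl⟩ := Nat.exists_eq_add_of_le hr.1
          rw [if_pos hr, update_of_ne (by omega), overlay_add (by omega),
            Nat.add_sub_cancel_left, overlay_add (by omega)]
        · rw [if_neg hr]
          by_cases hr' : s + k + 1 ≤ r ∧ r < s + k + 1 + k
          · rw [if_pos hr', update_of_ne (by omega), overlay_of_ge (by omega),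
              hρ.2.2 r (by omega)]
          · rw [if_neg hr', overlay, if_neg hr', hτ, update_apply, update_apply, overlay, overlay,
              if_neg hr, if_neg hr]
  have h4 := RRun.copy (M := M) (a := s + j) (o := o) (s := s') (by omega) (by omega) ho (by omega)
    (hσc (n c)) (hσM _ le_rfl)
  have hj' : σ (n c) (s + j) = put ((h c)^[n c] (g c)) j := by
    simp only [σ]
    rw [update_of_ne (by omega), overlay_add hj]
  rw [hj'] at h4
  have h5c := (hσc (n c)).update (x := put ((h c)^[n c] (g c)) j) ho (by omega)
  have h5 := RRun.clearN (M := M) (a := s) (k := k) (by omega) h5c.1 h5c.2.1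
    (update_le (hdM _ le_rfl j hj) (hσM _ le_rfl))
  refine h1.seq ((h2.of_eq rfl rfl).seq (h3.seq (h4.seq (h5.of_eq rfl ?_))))
  · have e : σ (n c) = overlay s k (put ((h c)^[n c] (g c))) ρ := by
      simp only [σ, Nat.sub_self]
      rw [update_eq_self_iff, overlay_of_ge le_rfl, hρ.2.2 _ (by omega)]
    rw [e]
    exact overlay_zero_eq hρ hos

end StackProgram

/-! ### Arithmetic, logic and bounded quantifiers in linear space -/

namespace StackProgram

open Function Ctx

variable {α β γ δ : Type} [Ctx α] [Ctx β] [Ctx γ] [Ctx δ]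

/-- A version of `LinSpace.iterate` in which the bound on the iterates is a function `b`. -/
theorem LinSpace.iterate_of_le {h : γ → δ → δ} {g : γ → δ} {n : γ → ℕ} {b : γ → ℕ}
    (hh : LinSpace fun x : γ × δ => h x.1 x.2) (hg : LinSpace g) (hn : LinSpace n)
    (hb : PolyBdd b) (hle : ∀ c, ∀ t ≤ n c, AtMost (b c) ((h c)^[t] (g c))) :
    LinSpace fun c => (h c)^[n c] (g c) := by
  obtain ⟨d, hd⟩ := hb
  exact hh.iterate hg hn ⟨d, fun c B hB hc t ht => (hle c t ht).mono (atMost_nat.1 (hd c B hB hc))⟩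

theorem LinSpace.succ {f : γ → ℕ} (hf : LinSpace f) : LinSpace fun c => f c + 1 :=
  LinSpace.succ'.comp hf

theorem LinSpace.pred {f : γ → ℕ} (hf : LinSpace f) : LinSpace fun c => f c - 1 :=
  LinSpace.pred'.comp hf

theorem PolyBdd.add' : PolyBdd fun x : ℕ × ℕ => x.1 + x.2 := by
  refine ⟨2, fun c B hB hc => ?_⟩
  simp only [atMost_prod, atMost_nat] at *
  nlinarith

theorem PolyBdd.mul' : PolyBdd fun x : ℕ × ℕ => x.1 * x.2 := by
  refine ⟨2, fun c B hB hc => ?_⟩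
  simp only [atMost_prod, atMost_nat] at *
  nlinarith

theorem iterate_add_one (a t : ℕ) : (fun y => y + 1)^[t] a = a + t := by
  induction t with
  | zero => rfl
  | succ t ih => rw [iterate_succ_apply', ih]; rfl

theorem iterate_sub_one (a t : ℕ) : (fun y => y - 1)^[t] a = a - t := by
  induction t with
  | zero => rfl
  | succ t ih => rw [iterate_succ_apply', ih]; rfl

@[fun_prop]
theorem LinSpace.add {f g : γ → ℕ} (hf : LinSpace f) (hg : LinSpace g) :
    LinSpace fun c => f c + g c := by
  have h : LinSpace fun x : ℕ × ℕ => (fun y => y + 1)^[x.2] x.1 := by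
    refine LinSpace.iterate_of_le (h := fun (_ : ℕ × ℕ) y => y + 1) ?_ LinSpace.fst LinSpace.snd
      PolyBdd.add' (fun c t ht => ?_)
    · exact LinSpace.snd.succ
    · simp only [atMost_nat, iterate_add_one]
      omega
  simpa only [iterate_add_one] using h.comp (hf.prodMk hg)

@[fun_prop]
theorem LinSpace.sub {f g : γ → ℕ} (hf : LinSpace f) (hg : LinSpace g) :
    LinSpace fun c => f c - g c := by
  have h : LinSpace fun x : ℕ × ℕ => (fun y => y - 1)^[x.2] x.1 := by
    refine LinSpace.iterate_of_le (h := fun (_ : ℕ × ℕ) y => y - 1) ?_ LinSpace.fst LinSpace.snd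
      LinSpace.fst.1 (fun c t ht => ?_)
    · exact LinSpace.snd.pred
    · simp only [atMost_nat, iterate_sub_one]
      omega
  simpa only [iterate_sub_one] using h.comp (hf.prodMk hg)

@[fun_prop]
theorem LinSpace.mul {f g : γ → ℕ} (hf : LinSpace f) (hg : LinSpace g) :
    LinSpace fun c => f c * g c := by
  have e : ∀ a t : ℕ, (fun y => y + a)^[t] 0 = a * t := fun a t => by
    induction t with
    | zero => rfl
    | succ t ih => rw [iterate_succ_apply', ih]; ring
  have h : LinSpace fun x : ℕ × ℕ => (fun y => y + x.1)^[x.2] 0 := by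
    refine LinSpace.iterate_of_le (h := fun (x : ℕ × ℕ) y => y + x.1) (by fun_prop) (by fun_prop)
      (by fun_prop) PolyBdd.mul' (fun c t ht => ?_)
    rw [atMost_nat, e]
    exact Nat.mul_le_mul_left _ ht
  simpa only [e] using h.comp (hf.prodMk hg)

open Classical in
theorem linSpace_prop_iff {p : γ → Prop} :
    LinSpace p ↔ LinSpace fun c => if p c then 1 else 0 := by
  constructor
  · intro h
    refine ⟨⟨0, fun c B hB hc => ?_⟩, fun j hj => h.2 j hj⟩
    rw [atMost_nat, pow_zero]
    beta_reduce
    split_ifs <;> omega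
  · intro h
    exact ⟨⟨0, fun c B hB hc => atMost_prop (by simp) _⟩, fun j hj => h.2 j hj⟩

theorem LinSpace.of_indicator {p : γ → Prop} {f : γ → ℕ} (hf : LinSpace f)
    (h1 : ∀ c, p c → f c = 1) (h0 : ∀ c, ¬ p c → f c = 0) : LinSpace p := by
  classical
  rw [linSpace_prop_iff]
  convert hf using 2 with c
  split_ifs with h
  exacts [(h1 c h).symm, (h0 c h).symm]

@[fun_prop]
theorem LinSpace.lt {f g : γ → ℕ} (hf : LinSpace f) (hg : LinSpace g) :
    LinSpace fun c => f c < g c :=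
  LinSpace.of_indicator (f := fun c => 1 - (1 - (g c - f c))) (by fun_prop)
    (fun c h => by omega) (fun c h => by omega)

@[fun_prop]
theorem LinSpace.eq {f g : γ → ℕ} (hf : LinSpace f) (hg : LinSpace g) :
    LinSpace fun c => f c = g c :=
  LinSpace.of_indicator (f := fun c => 1 - ((g c - f c) + (f c - g c))) (by fun_prop)
    (fun c h => by omega) (fun c h => by omega)

@[fun_prop]
theorem LinSpace.not {p : γ → Prop} (hp : LinSpace p) : LinSpace fun c => ¬ p c := by
  classical
  have h := linSpace_prop_iff.1 hp
  exact LinSpace.of_indicator (f := fun c => 1 - if p c then 1 else 0) (by fun_prop)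
    (fun c h => by simp [h]) (fun c h => by simp [not_not.1 h])

@[fun_prop]
theorem LinSpace.and {p q : γ → Prop} (hp : LinSpace p) (hq : LinSpace q) :
    LinSpace fun c => p c ∧ q c := by
  classical
  have h := linSpace_prop_iff.1 hp
  have h' := linSpace_prop_iff.1 hq
  exact LinSpace.of_indicator (f := fun c => (if p c then 1 else 0) * if q c then 1 else 0)
    (by fun_prop) (fun c h => by simp [h]) (fun c h => by simp; tauto)

@[fun_prop]
theorem LinSpace.or {p q : γ → Prop} (hp : LinSpace p) (hq : LinSpace q) :
    LinSpace fun c => p c ∨ q c := by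
  have h : LinSpace fun c => ¬ (¬ p c ∧ ¬ q c) := by fun_prop
  convert h using 2 with c
  tauto

theorem LinSpace.imp {p q : γ → Prop} (hp : LinSpace p) (hq : LinSpace q) :
    LinSpace fun c => p c → q c := by
  have h : LinSpace fun c => ¬ p c ∨ q c := by fun_prop
  convert h using 2 with c
  tauto

@[fun_prop]
theorem LinSpace.le {f g : γ → ℕ} (hf : LinSpace f) (hg : LinSpace g) :
    LinSpace fun c => f c ≤ g c := by
  have h : LinSpace fun c => ¬ g c < f c := by fun_prop
  simpa only [not_lt] using h

@[fun_prop]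
theorem LinSpace.ite {p : γ → Prop} [∀ c, Decidable (p c)] {f g : γ → δ} (hp : LinSpace p)
    (hf : LinSpace f) (hg : LinSpace g) : LinSpace fun c => if p c then f c else g c := by
  have h : LinSpace fun c => if p c then 1 else 0 := by
    convert linSpace_prop_iff.1 hp
  obtain ⟨⟨d, hd⟩, hf'⟩ := hf
  obtain ⟨⟨e, he⟩, hg'⟩ := hg
  refine ⟨⟨d + e, fun c B hB hc => ?_⟩, fun j hj => ?_⟩
  · beta_reduce
    split_ifs
    · exact (hd c B hB hc).mono (Nat.pow_le_pow_right (by omega) (Nat.le_add_right _ _))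
    · exact (he c B hB hc).mono (Nat.pow_le_pow_right (by omega) (Nat.le_add_left _ _))
  · have h1 : LinSpace fun c => put (f c) j :=
      ⟨⟨d, fun c B hB hc => atMost_nat.2 (hd c B hB hc j hj)⟩, fun _ _ => hf' j hj⟩
    have h2 : LinSpace fun c => put (g c) j :=
      ⟨⟨e, fun c B hB hc => atMost_nat.2 (he c B hB hc j hj)⟩, fun _ _ => hg' j hj⟩
    have h3 : LinSpace fun c => (if p c then 1 else 0) * put (f c) j +
        (1 - if p c then 1 else 0) * put (g c) j := by fun_prop
    convert h3.2 0 Nat.one_pos using 2 with c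
    by_cases hc : p c <;> simp [put, hc]

@[fun_prop]
theorem LinSpace.min {f g : γ → ℕ} (hf : LinSpace f) (hg : LinSpace g) :
    LinSpace fun c => Min.min (f c) (g c) := by
  simp only [min_def]
  fun_prop

/-- Bounded existential quantification: all candidates are tried in turn. -/
theorem LinSpace.exists_lt {n : γ → ℕ} {p : γ → ℕ → Prop} (hn : LinSpace n)
    (hp : LinSpace fun x : γ × ℕ => p x.1 x.2) : LinSpace fun c => ∃ z, z < n c ∧ p c z := by
  have e : ∀ c t, (fun x : ℕ × Prop => (x.1 + 1, x.2 ∨ p c x.1))^[t] (0, False) =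
      (t, ∃ z, z < t ∧ p c z) := fun c t => by
    induction t with
    | zero => simp
    | succ t ih =>
      rw [iterate_succ_apply', ih]
      refine Prod.ext rfl (propext ?_)
      simp only [Nat.lt_succ_iff_lt_or_eq]
      constructor
      · rintro (⟨z, h, h'⟩ | h)
        exacts [⟨z, Or.inl h, h'⟩, ⟨t, Or.inr rfl, h⟩]
      · rintro ⟨z, h | rfl, h'⟩
        exacts [Or.inl ⟨z, h, h'⟩, Or.inr h']
  have h : LinSpace fun c => (fun x : ℕ × Prop => (x.1 + 1, x.2 ∨ p c x.1))^[n c] (0, False) := by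
    refine LinSpace.iterate_of_le (h := fun c (x : ℕ × Prop) => (x.1 + 1, x.2 ∨ p c x.1))
      (b := fun c => n c + 1) ?_ (by fun_prop) hn hn.succ.1 (fun c t ht => ?_)
    · have : LinSpace fun x : γ × ℕ × Prop => p x.1 x.2.1 :=
        hp.comp (g := fun x : γ × ℕ × Prop => (x.1, x.2.1)) (by fun_prop)
      fun_prop
    · rw [e, atMost_prod, atMost_nat]
      exact ⟨by dsimp only; omega, atMost_prop (by omega) _⟩
  simp only [e] at h
  exact LinSpace.snd.comp h

theorem LinSpace.forall_lt {n : γ → ℕ} {p : γ → ℕ → Prop} (hn : LinSpace n)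
    (hp : LinSpace fun x : γ × ℕ => p x.1 x.2) : LinSpace fun c => ∀ z, z < n c → p c z := by
  have h := (LinSpace.exists_lt (p := fun c z => ¬ p c z) hn hp.not).not
  simpa only [not_exists, not_and, not_not] using h

@[fun_prop]
theorem LinSpace.div {f g : γ → ℕ} (hf : LinSpace f) (hg : LinSpace g) :
    LinSpace fun c => f c / g c := by
  have e : ∀ a b t : ℕ, 0 < b → (fun y => if (y + 1) * b ≤ a then y + 1 else y)^[t] 0 =
      Min.min t (a / b) := fun a b t hb => by
    induction t with
    | zero => simp
    | succ t ih =>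
      rw [iterate_succ_apply', ih]
      simp only [← Nat.le_div_iff_mul_le hb]
      split_ifs <;> omega
  have h : LinSpace fun x : ℕ × ℕ =>
      (fun y => if (y + 1) * x.2 ≤ x.1 then y + 1 else y)^[x.1] 0 := by
    refine LinSpace.iterate_of_le
      (h := fun (x : ℕ × ℕ) y => if (y + 1) * x.2 ≤ x.1 then y + 1 else y)
      (by fun_prop) (by fun_prop) (by fun_prop) LinSpace.fst.1 (fun c t ht => ?_)
    rw [atMost_nat]
    refine le_trans ?_ ht
    clear ht
    induction t with
    | zero => simp
    | succ t ih =>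
      rw [iterate_succ_apply']
      split_ifs <;> omega
  have h' : LinSpace fun x : ℕ × ℕ => if x.2 = 0 then 0 else
      (fun y => if (y + 1) * x.2 ≤ x.1 then y + 1 else y)^[x.1] 0 := by fun_prop
  convert h'.comp (hf.prodMk hg) using 2 with c
  dsimp only
  split_ifs with h0
  · rw [h0, Nat.div_zero]
  · rw [e _ _ _ (Nat.pos_of_ne_zero h0), min_eq_right (Nat.div_le_self _ _)]

@[fun_prop]
theorem LinSpace.mod {f g : γ → ℕ} (hf : LinSpace f) (hg : LinSpace g) :
    LinSpace fun c => f c % g c := by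
  have h : LinSpace fun c => f c - g c * (f c / g c) := by fun_prop
  convert h using 2 with c
  have := Nat.div_add_mod (f c) (g c)
  omega

end StackProgram

/-! ### Short covering runs -/

namespace Rackoff

variable {L X τ : Type*} (src tgt : τ → L) (eff : τ → X → ℕ → ℕ → Prop)

/-- A step by one of the transitions `τ` in which only the counters in `I` are taken into account;
the values of the others are arbitrary before and after the step. The transition `t` may change the
value of the counter `x` from `a` to `b` if `eff t x a b`. -/
def Step (I : Finset X) (c c' : L × (X → ℕ)) : Prop :=
  ∃ t, src t = c.1 ∧ tgt t = c'.1 ∧ ∀ x ∈ I, eff t x (c.2 x) (c'.2 x)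

/-- A run of `k` steps leads from `c` to the location `ℓ`. -/
def Cov (I : Finset X) (ℓ : L) (k : ℕ) (c : L × (X → ℕ)) : Prop :=
  ∃ p : ℕ → L × (X → ℕ), p 0 = c ∧ (∀ j < k, Step src tgt eff I (p j) (p (j + 1))) ∧ (p k).1 = ℓ

variable {src tgt eff}

/-- A shortest run does not visit two configurations that agree on the counters in `I`. -/
theorem shortest_injective {I : Finset X} {ℓ : L} {k : ℕ} {c : L × (X → ℕ)}
    (hmin : ∀ k' < k, ¬ Cov src tgt eff I ℓ k' c) {p : ℕ → L × (X → ℕ)} (h0 : p 0 = c)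
    (hp : ∀ j < k, Step src tgt eff I (p j) (p (j + 1))) (hk : (p k).1 = ℓ) {a b : ℕ}
    (hab : a < b) (hb : b ≤ k) (h1 : (p a).1 = (p b).1) (h2 : ∀ x ∈ I, (p a).2 x = (p b).2 x) :
    False := by
  refine hmin (k - (b - a)) (by omega)
    ⟨fun j => if j ≤ a then p j else p (j + (b - a)), by simp [h0], fun j hj => ?_, ?_⟩
  · beta_reduce
    rcases lt_trichotomy j a with h | rfl | h
    · rw [if_pos (by omega), if_pos (by omega)]
      exact hp j (by omega)
    · rw [if_pos le_rfl, if_neg (by omega), show j + 1 + (b - j) = b + 1 by omega]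
      obtain ⟨t, e1, e2, e3⟩ := hp b (by omega)
      exact ⟨t, e1.trans h1.symm, e2, fun x hx => by rw [h2 x hx]; exact e3 x hx⟩
    · rw [if_neg (by omega), if_neg (by omega), show j + 1 + (b - a) = j + (b - a) + 1 by omega]
      exact hp _ (by omega)
  · beta_reduce
    split_ifs with h
    · obtain rfl : b = k := by omega
      rw [show b - (b - a) = a by omega, h1, hk]
    · rw [show k - (b - a) + (b - a) = k by omega, hk]

/-- A run that ignores the counter `x` can be completed to a run that takes it into account, if `x`
is initially at least the number of steps: `x` is then positive before each step, and each
transition has some effect on it. -/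
theorem Cov.of_erase [DecidableEq X] (hdec : ∀ t x a b, eff t x a b → a ≤ b + 1)
    (hex : ∀ t x a, 1 ≤ a → ∃ b, eff t x a b) {I : Finset X} {x : X} {ℓ : L} {k : ℕ}
    {c : L × (X → ℕ)} (h : Cov src tgt eff (I.erase x) ℓ k c) (hx : k ≤ c.2 x) :
    Cov src tgt eff I ℓ k c := by
  induction k generalizing c with
  | zero =>
    obtain ⟨p, h0, -, hk⟩ := h
    exact ⟨p, h0, fun j hj => absurd hj (by omega), hk⟩
  | succ k ih =>
    obtain ⟨p, h0, hp, hk⟩ := h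
    obtain ⟨t, e1, e2, e3⟩ := hp 0 (by omega)
    obtain ⟨b, hb⟩ := hex t x (c.2 x) (by omega)
    have hb1 := hdec _ _ _ _ hb
    -- The run with the new value of `x` after the first step.
    obtain ⟨q, q0, hq, qk⟩ := ih (c := ((p 1).1, Function.update (p 1).2 x b))
      ⟨fun j => if j = 0 then ((p 1).1, Function.update (p 1).2 x b) else p (j + 1), by simp,
        fun j hj => by
          obtain ⟨u, u1, u2, u3⟩ := hp (j + 1) (by omega)
          beta_reduce
          rw [if_neg (show ¬ j + 1 = 0 by omega)]
          split_ifs with hj0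
          · subst hj0
            refine ⟨u, u1, u2, fun y hy => ?_⟩
            have hyx := Finset.ne_of_mem_erase hy
            simp only [Function.update_of_ne hyx]
            exact u3 y hy
          · exact ⟨u, u1, u2, u3⟩, by
          beta_reduce
          split_ifs with hk0
          · subst hk0
            exact hk
          · exact hk⟩ (by simp; omega)
    refine ⟨fun j => if j = 0 then c else q (j - 1), by simp, fun j hj => ?_, by simpa using qk⟩
    beta_reduce
    rw [if_neg (show ¬ j + 1 = 0 by omega), Nat.add_sub_cancel]
    split_ifs with hj0
    · subst hj0
      rw [q0]
      refine ⟨t, by rw [e1, h0], e2, fun y hy => ?_⟩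
      by_cases hyx : y = x
      · subst hyx
        simpa using hb
      · have := e3 y (Finset.mem_erase.2 ⟨hyx, hy⟩)
        rw [h0] at this
        simpa [hyx] using this
    · have := hq (j - 1) (by omega)
      rwa [show j - 1 + 1 = j by omega] at this

/-- Rackoff's bound on the length of a shortest covering run, by induction on the number of counters
taken into account. Before some counter reaches the value `F i`, a shortest run does not repeat a
configuration; and once it has reached this value, the counter may be ignored. -/
theorem exists_short [Fintype L] [DecidableEq X] (hdec : ∀ t x a b, eff t x a b → a ≤ b + 1)
    (hex : ∀ t x a, 1 ≤ a → ∃ b, eff t x a b) {F : ℕ → ℕ} {m : ℕ}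
    (hF0 : Fintype.card L ≤ F 0)
    (hF : ∀ i < m, Fintype.card L * F i ^ (i + 1) + F i ≤ F (i + 1)) {i : ℕ} (hi : i ≤ m)
    {I : Finset X} (hI : I.card = i) {ℓ : L} {k : ℕ} {c : L × (X → ℕ)}
    (h : Cov src tgt eff I ℓ k c) : ∃ k' ≤ F i, Cov src tgt eff I ℓ k' c := by
  classical
  induction i generalizing I k c with
  | zero =>
    have hex : ∃ k, Cov src tgt eff I ℓ k c := ⟨k, h⟩
    obtain ⟨p, h0, hp, hk⟩ := Nat.find_spec hex
    refine ⟨_, ?_, ⟨p, h0, hp, hk⟩⟩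
    have hinj : Function.Injective fun j : Fin (Nat.find hex + 1) => (p j).1 := by
      refine Function.Injective.of_lt_imp_ne fun a b hab e => ?_
      refine shortest_injective (fun k' hk' => Nat.find_min hex hk') h0 hp hk
        (a := a) (b := b) hab (by omega) e fun x hx => ?_
      rw [Finset.card_eq_zero.1 hI] at hx
      exact absurd hx (Finset.notMem_empty x)
    have := Fintype.card_le_of_injective _ hinj
    rw [Fintype.card_fin] at this
    omega
  | succ i ih =>
    have hex' : ∃ k, Cov src tgt eff I ℓ k c := ⟨k, h⟩
    obtain ⟨p, h0, hp, hk⟩ := Nat.find_spec hex'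
    have hmin : ∀ k' < Nat.find hex', ¬ Cov src tgt eff I ℓ k' c :=
      fun k' hk' => Nat.find_min hex' hk'
    refine ⟨_, ?_, ⟨p, h0, hp, hk⟩⟩
    set K := Nat.find hex'
    -- A prefix of a shortest run in which the counters in `I` stay below `F i`.
    have key : ∀ n ≤ K + 1, (∀ j < n, ∀ x ∈ I, (p j).2 x < F i) →
        n ≤ Fintype.card L * F i ^ (i + 1) := by
      intro n hn hlt
      have hinj : Function.Injective fun j : Fin n =>
          ((p j).1, fun x : I => (⟨(p j).2 x, hlt j j.2 x x.2⟩ : Fin (F i))) := by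
        refine Function.Injective.of_lt_imp_ne fun a b hab e => ?_
        refine shortest_injective hmin h0 hp hk (a := a) (b := b) hab (by omega)
          (Prod.ext_iff.1 e).1 fun x hx => ?_
        have := congrFun (Prod.ext_iff.1 e).2 ⟨x, hx⟩
        exact congrArg Fin.val this
      have := Fintype.card_le_of_injective _ hinj
      simpa [hI] using this
    have hFi := hF i (by omega)
    by_cases hbig : ∃ j, j ≤ K ∧ ∃ x ∈ I, F i ≤ (p j).2 x
    · obtain ⟨hjK, x, hx, hxF⟩ := Nat.find_spec hbig
      set j := Nat.find hbig
      have hj : j ≤ Fintype.card L * F i ^ (i + 1) := key j (by omega) fun j' hj' x hx => by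
        by_contra hlt
        exact Nat.find_min hbig hj' ⟨by omega, x, hx, not_lt.1 hlt⟩
      obtain ⟨k', hk', hcov⟩ := ih (by omega) (I := I.erase x) (k := K - j) (c := p j)
        (by rw [Finset.card_erase_of_mem hx, hI]; rfl)
        ⟨fun a => p (j + a), rfl, fun a ha => by
          obtain ⟨t, e1, e2, e3⟩ := hp (j + a) (by omega)
          exact ⟨t, e1, e2, fun y hy => e3 y (Finset.mem_of_mem_erase hy)⟩, by
          beta_reduce
          rw [show j + (K - j) = K by omega, hk]⟩
      obtain ⟨q, q0, hq, qk⟩ := hcov.of_erase hdec hex (hk'.trans hxF)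
      by_contra hlt
      refine hmin (j + k') (by omega) ⟨fun a => if a ≤ j then p a else q (a - j), by simp [h0],
        fun a ha => ?_, ?_⟩
      · beta_reduce
        rcases lt_trichotomy a j with h | h | h
        · rw [if_pos (by omega), if_pos (by omega)]
          exact hp a (by omega)
        · rw [h, if_pos le_rfl, if_neg (by omega), ← q0, Nat.add_sub_cancel_left]
          exact hq 0 (by omega)
        · rw [if_neg (by omega), if_neg (by omega), show a + 1 - j = a - j + 1 by omega]
          exact hq _ (by omega)
      · beta_reduce
        split_ifs with h'
        · obtain rfl : k' = 0 := by omega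
          rw [← qk, q0]
          rfl
        · rw [Nat.add_sub_cancel_left, qk]
    · have := key (K + 1) le_rfl fun j hj x hx => by
        by_contra hlt
        exact hbig ⟨j, by omega, x, hx, not_lt.1 hlt⟩
      omega

/-- With `n` locations and `m` counters, the bound on the length of a shortest covering run is
doubly exponential. -/
theorem exists_short_of_reach {n m : ℕ} {src tgt : τ → Fin n} {eff : τ → Fin m → ℕ → ℕ → Prop}
    (hdec : ∀ t x a b, eff t x a b → a ≤ b + 1) (hex : ∀ t x a, 1 ≤ a → ∃ b, eff t x a b)
    {ℓ : Fin n} {k : ℕ} {c : Fin n × (Fin m → ℕ)} (h : Cov src tgt eff Finset.univ ℓ k c) :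
    ∃ k' ≤ (n + 2) ^ (m + 5) ^ (m + 1), Cov src tgt eff Finset.univ ℓ k' c := by
  refine exists_short hdec hex (F := fun i => (n + 2) ^ (m + 5) ^ (i + 1)) (m := m) ?_ ?_ le_rfl
    (by simp) h
  · rw [Fintype.card_fin]
    exact (Nat.le_add_right n 2).trans (Nat.le_self_pow (by positivity) _)
  · intro i hi
    rw [Fintype.card_fin]
    set a := (m + 5) ^ (i + 1) with ha
    have ha1 : 1 ≤ a := Nat.one_le_pow _ _ (by omega)
    have h1 : ((n + 2) ^ a) ^ (i + 1) ≤ (n + 2) ^ (a * m) := by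
      rw [← pow_mul]
      exact Nat.pow_le_pow_right (by omega) (Nat.mul_le_mul_left _ hi)
    calc n * ((n + 2) ^ a) ^ (i + 1) + (n + 2) ^ a
        ≤ (n + 2) * (n + 2) ^ (a * m) + (n + 2) ^ a := by gcongr; omega
      _ ≤ (n + 2) ^ (a * m + 1 + a) + (n + 2) ^ (a * m + 1 + a) := by
        refine add_le_add ?_ (Nat.pow_le_pow_right (by omega) (by omega))
        rw [← pow_succ']
        exact Nat.pow_le_pow_right (by omega) (by omega)
      _ = 2 * (n + 2) ^ (a * m + 1 + a) := by ring
      _ ≤ (n + 2) * (n + 2) ^ (a * m + 1 + a) := by gcongr; omega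
      _ = (n + 2) ^ (a * m + 1 + a + 1) := (pow_succ' _ _).symm
      _ ≤ (n + 2) ^ (m + 5) ^ (i + 1 + 1) := by
        refine Nat.pow_le_pow_right (by omega) ?_
        rw [pow_succ (m + 5) (i + 1), ← ha]
        nlinarith

end Rackoff

/-! ### Reachability by divide and conquer -/

namespace Savitch

open Function StackProgram

/-- Reachability in at most `2 ^ k` steps of `R` between numbers below `C`, the midpoints of all
intervals being below `C`. -/
def Sav (C : ℕ) (R : ℕ → ℕ → Prop) : ℕ → ℕ → ℕ → Prop
  | 0, a, b => a = b ∨ R a b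
  | k + 1, a, b => ∃ c, c < C ∧ Sav C R k a c ∧ Sav C R k c b

variable {C : ℕ} {R : ℕ → ℕ → Prop}

theorem Sav.reaches {k a b : ℕ} (ha : a < C) (hb : b < C) (h : Sav C R k a b) :
    Relation.ReflTransGen (fun x y => x < C ∧ y < C ∧ R x y) a b := by
  induction k generalizing a b with
  | zero =>
    rcases h with rfl | h
    exacts [.refl, .single ⟨ha, hb, h⟩]
  | succ k ih =>
    obtain ⟨c, hc, h1, h2⟩ := h
    exact (ih ha hc h1).trans (ih hc hb h2)

theorem sav_of_path {k n : ℕ} (hn : n ≤ 2 ^ k) {p : ℕ → ℕ} (hC : ∀ j ≤ n, p j < C)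
    (hR : ∀ j < n, R (p j) (p (j + 1))) : Sav C R k (p 0) (p n) := by
  induction k generalizing n p with
  | zero =>
    rcases (show n = 0 ∨ n = 1 by simp at hn; omega) with rfl | rfl
    exacts [Or.inl rfl, Or.inr (hR 0 (by omega))]
  | succ k ih =>
    rw [pow_succ] at hn
    refine ⟨p (n / 2), hC _ (by omega), ih (by omega) (fun j hj => hC j (by omega))
      (fun j hj => hR j (by omega)), ?_⟩
    have := ih (n := n - n / 2) (p := fun j => p (n / 2 + j)) (by omega)
      (fun j hj => hC _ (by omega)) (fun j hj => hR _ (by omega))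
    simpa [show n / 2 + (n - n / 2) = n by omega] using this

/-- The subproblems of the problem coded by `p = a * C + b`: with the midpoint `c`, they are the
problem from `a` to `c`, for `i = 2 * c`, and the problem from `c` to `b`, for `i = 2 * c + 1`. -/
def child (C p i : ℕ) : ℕ := if i % 2 = 0 then p / C * C + i / 2 else i / 2 * C + p % C

theorem child_lt {p i : ℕ} (hp : p < C * C) (hi : i < 2 * C) : child C p i < C * C := by
  have h1 : p / C < C := Nat.div_lt_of_lt_mul hp
  have h2 : p % C < C := Nat.mod_lt _ (by omega)
  unfold child
  split_ifs
  · nlinarith [show i / 2 < C by omega]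
  · nlinarith [show i / 2 < C by omega]

theorem mul_add_div_mod {a b : ℕ} (hb : b < C) : (a * C + b) / C = a ∧ (a * C + b) % C = b := by
  rw [mul_comm, Nat.mul_add_div (by omega), Nat.div_eq_of_lt hb, Nat.mul_add_mod,
    Nat.mod_eq_of_lt hb]
  exact ⟨rfl, rfl⟩

theorem child_even {p c : ℕ} : child C p (2 * c) = p / C * C + c := by
  rw [child, if_pos (by omega), Nat.mul_div_cancel_left _ (by norm_num)]

theorem child_odd {p c : ℕ} : child C p (2 * c + 1) = c * C + p % C := by
  rw [child, if_neg (by omega), show (2 * c + 1) / 2 = c by omega]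

/-- The base of the digits on the recursion stack. -/
def base (C : ℕ) : ℕ := (2 * C + 1) * (2 * C + 1)

/-- Push the problem `p` and the index `i` of the current subproblem on the recursion stack, which
is a number in base `base C`. The value is cut off at `B`. -/
def push (B C p i s : ℕ) : ℕ := min B ((s * base C + p) * base C + i)

open Classical in
/-- One step of the recursive evaluation. In the state `(m, k, p, s)`, the problem `p` is to be
solved at level `k`, if `m = 0`; otherwise the answer to a problem at level `k` has just been found,
negative if `m = 1`, and positive if `m = 2`. The pending problems are on the stack `s`. At level
`0` the answer to `p` is `leaf p`. The final states have `m ≠ 0` and `k = K`. -/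
noncomputable def step (leaf : ℕ → Prop) (B C K : ℕ) (x : ℕ × ℕ × ℕ × ℕ) : ℕ × ℕ × ℕ × ℕ :=
  if x.1 = 0 then
    if x.2.1 = 0 then (if leaf x.2.2.1 then 2 else 1, 0, 0, x.2.2.2)
    else (0, x.2.1 - 1, min B (child C x.2.2.1 0), push B C x.2.2.1 0 x.2.2.2)
  else if x.2.1 = K then x
  else if x.1 = 2 ∧ x.2.2.2 % base C % 2 = 1 then
    (2, x.2.1 + 1, 0, x.2.2.2 / base C / base C)
  else if x.1 = 2 then
    (0, x.2.1, min B (child C (x.2.2.2 / base C % base C) (x.2.2.2 % base C + 1)),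
      push B C (x.2.2.2 / base C % base C) (x.2.2.2 % base C + 1) (x.2.2.2 / base C / base C))
  else if x.2.2.2 % base C / 2 + 1 < C then
    (0, x.2.1, min B (child C (x.2.2.2 / base C % base C) ((x.2.2.2 % base C / 2 + 1) * 2)),
      push B C (x.2.2.2 / base C % base C) ((x.2.2.2 % base C / 2 + 1) * 2)
        (x.2.2.2 / base C / base C))
  else (1, x.2.1 + 1, 0, x.2.2.2 / base C / base C)

theorem linSpace_step {γ : Type} [Ctx γ] {leaf : γ → ℕ → Prop} {B C K : γ → ℕ}
    (hl : LinSpace fun x : γ × ℕ => leaf x.1 x.2) (hB : LinSpace B) (hC : LinSpace C)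
    (hK : LinSpace K) :
    LinSpace fun x : γ × ℕ × ℕ × ℕ × ℕ => step (leaf x.1) (B x.1) (C x.1) (K x.1) x.2 := by
  have h : LinSpace fun x : γ × ℕ × ℕ × ℕ × ℕ => leaf x.1 x.2.2.2.1 :=
    hl.comp (g := fun x : γ × ℕ × ℕ × ℕ × ℕ => (x.1, x.2.2.2.1)) (by fun_prop)
  unfold step push child base
  fun_prop

open Classical in
/-- The answer to a problem at level `k`, as a truth value. -/
def Tree (leaf : ℕ → Prop) (C : ℕ) : ℕ → ℕ → Prop
  | 0, p => leaf p
  | k + 1, p => ∃ c, c < C ∧ Tree leaf C k (child C p (2 * c)) ∧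
      Tree leaf C k (child C p (2 * c + 1))

theorem tree_iff_sav {k a b : ℕ} (ha : a < C) (hb : b < C) :
    Tree (fun p => p / C = p % C ∨ R (p / C) (p % C)) C k (a * C + b) ↔ Sav C R k a b := by
  induction k generalizing a b with
  | zero =>
    obtain ⟨h1, h2⟩ := mul_add_div_mod (a := a) hb
    simp only [Tree, Sav, h1, h2]
  | succ k ih =>
    obtain ⟨h1, h2⟩ := mul_add_div_mod (a := a) hb
    simp only [Tree, Sav, child_even, child_odd, h1, h2]
    refine exists_congr fun c => and_congr_right fun hc => ?_
    rw [ih ha hc, ih hc hb]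

end Savitch

/-! ### Evaluation with a recursion stack -/

namespace Savitch

open Function StackProgram

variable {leaf : ℕ → Prop} {B C K : ℕ}

open Classical in
/-- The state in which the answer to a problem at level `k` has just been found. -/
noncomputable def answer (q : Prop) (k s : ℕ) : ℕ × ℕ × ℕ × ℕ := (if q then 2 else 1, k, 0, s)

theorem two_mul_lt_base : 2 * C < base C := by unfold base; nlinarith

theorem sq_lt_base : C * C < base C := by unfold base; nlinarith

theorem pop_push {p i s : ℕ} (hp : p < C * C) (hi : i < 2 * C)
    (hB : (s * base C + p) * base C + i ≤ B) :
    push B C p i s % base C = i ∧ push B C p i s / base C % base C = p ∧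
      push B C p i s / base C / base C = s := by
  have h1 := mul_add_div_mod (a := s * base C + p) (b := i) (hi.trans (two_mul_lt_base (C := C)))
  have h2 := mul_add_div_mod (a := s) (b := p) (hp.trans (sq_lt_base (C := C)))
  rw [push, min_eq_right hB, h1.1, h1.2, h2.1, h2.2]
  exact ⟨rfl, rfl, rfl⟩

section steps

variable {k p i s : ℕ}

theorem step_answer_odd (hk : k ≠ K) (hp : p < C * C) (hi : i < 2 * C)
    (hB : (s * base C + p) * base C + i ≤ B) (hodd : i % 2 = 1) :
    step leaf B C K (answer True k (push B C p i s)) = answer True (k + 1) s := by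
  obtain ⟨h1, h2, h3⟩ := pop_push hp hi hB
  simp [step, answer, h1, h3, hk, hodd]

theorem step_answer_even (hk : k ≠ K) (hp : p < C * C) (hi : i < 2 * C)
    (hB : (s * base C + p) * base C + i ≤ B) (hev : i % 2 = 0) :
    step leaf B C K (answer True k (push B C p i s)) =
      (0, k, min B (child C p (i + 1)), push B C p (i + 1) s) := by
  obtain ⟨h1, h2, h3⟩ := pop_push hp hi hB
  simp [step, answer, h1, h2, h3, hk, hev]

theorem step_answer_false (hk : k ≠ K) (hp : p < C * C) (hi : i < 2 * C)
    (hB : (s * base C + p) * base C + i ≤ B) :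
    step leaf B C K (answer False k (push B C p i s)) =
      if i / 2 + 1 < C then
        (0, k, min B (child C p (2 * (i / 2 + 1))), push B C p (2 * (i / 2 + 1)) s)
      else answer False (k + 1) s := by
  obtain ⟨h1, h2, h3⟩ := pop_push hp hi hB
  simp [step, answer, h1, h2, h3, hk, mul_comm 2]

end steps

/-- The recursive evaluation is correct, and takes at most `2 * (2 * C + 1) ^ k - 1` steps for a
problem at level `k`. -/
theorem exists_iterate (hC : 0 < C) (hB : base C ^ (2 * K) ≤ B) {k : ℕ} (hk : k ≤ K) {p s : ℕ}
    (hp : p < C * C) (hs : s < base C ^ (2 * (K - k))) :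
    ∃ t, t + 1 ≤ 2 * (2 * C + 1) ^ k ∧
      (step leaf B C K)^[t] (0, k, p, s) = answer (Tree leaf C k p) k s := by
  induction k generalizing p s with
  | zero =>
    refine ⟨1, by simp, ?_⟩
    simp only [iterate_one, step, if_true]
    rfl
  | succ k ih =>
    set T := 2 * (2 * C + 1) ^ k with hT
    have hkK : k ≠ K := by omega
    have hs' : ∀ i < 2 * C, (s * base C + p) * base C + i < base C ^ (2 * (K - k)) := by
      intro i hi
      have e : base C ^ (2 * (K - k)) = base C ^ (2 * (K - (k + 1))) * base C * base C := by
        rw [show 2 * (K - k) = 2 * (K - (k + 1)) + 1 + 1 by omega, pow_succ, pow_succ]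
      rw [e]
      have h1 := sq_lt_base (C := C)
      have h2 := two_mul_lt_base (C := C)
      have h3 : s * base C + p + 1 ≤ base C ^ (2 * (K - (k + 1))) * base C := by nlinarith
      nlinarith
    have hBi : ∀ i < 2 * C, (s * base C + p) * base C + i ≤ B := fun i hi =>
      (hs' i hi).le.trans ((Nat.pow_le_pow_right (by unfold base; positivity) (by omega)).trans hB)
    have hpush : ∀ i < 2 * C, push B C p i s < base C ^ (2 * (K - k)) := fun i hi =>
      (min_le_right _ _).trans_lt (hs' i hi)
    have hch : ∀ i < 2 * C, min B (child C p i) = child C p i := fun i hi => by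
      refine min_eq_right ((child_lt hp hi).le.trans (sq_lt_base.le.trans (le_trans ?_ hB)))
      exact Nat.le_self_pow (by omega) _
    -- From the subproblem with midpoint `C - d` on, `d` midpoints are left.
    have inner : ∀ d, 0 < d → d ≤ C → ∃ t, t ≤ 2 * d * T ∧
        (step leaf B C K)^[t] (0, k, child C p (2 * (C - d)), push B C p (2 * (C - d)) s) =
          answer (∃ c, c < C ∧ C - d ≤ c ∧ Tree leaf C k (child C p (2 * c)) ∧
            Tree leaf C k (child C p (2 * c + 1))) (k + 1) s := by
      intro d
      induction d with
      | zero => intro h; exact absurd h (lt_irrefl 0)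
      | succ d ihd =>
        intro _ hd
        set c := C - (d + 1) with hc
        have hc0 : 2 * c < 2 * C := by omega
        have hc1 : 2 * c + 1 < 2 * C := by omega
        obtain ⟨t, ht, e⟩ := ih (by omega) (child_lt hp hc0) (hpush _ hc0)
        have hT1 : 2 * (d + 1) * T = 2 * d * T + T + T := by ring
        -- After a negative answer for the midpoint `c`, the next midpoint is tried.
        have next : ¬ (Tree leaf C k (child C p (2 * c)) ∧ Tree leaf C k (child C p (2 * c + 1))) →
            ∀ i, i / 2 = c → i < 2 * C → ∃ t, t ≤ 2 * d * T + 1 ∧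
            (step leaf B C K)^[t] (answer False k (push B C p i s)) =
            answer (∃ c', c' < C ∧ c ≤ c' ∧ Tree leaf C k (child C p (2 * c')) ∧
              Tree leaf C k (child C p (2 * c' + 1))) (k + 1) s := by
          intro hno i hi hiC
          have hstep := step_answer_false (leaf := leaf) hkK hp hiC (hBi i hiC)
          rw [hi] at hstep
          by_cases hd0 : d = 0
          · refine ⟨1, by omega, ?_⟩
            rw [iterate_one, hstep, if_neg (by omega)]
            congr 1
            refine propext ⟨False.elim, ?_⟩
            rintro ⟨c', h1, h2, h3⟩
            obtain rfl : c' = c := by omega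
            exact hno h3
          · obtain ⟨t', ht', e'⟩ := ihd (by omega) (by omega)
            refine ⟨t' + 1, by omega, ?_⟩
            rw [show C - d = c + 1 by omega] at e'
            rw [iterate_succ_apply, hstep, if_pos (by omega), hch _ (by omega), e']
            congr 1
            refine propext ⟨?_, ?_⟩
            · rintro ⟨c', h1, h2, h3⟩
              exact ⟨c', h1, by omega, h3⟩
            · rintro ⟨c', h1, h2, h3⟩
              refine ⟨c', h1, ?_, h3⟩
              rcases Nat.lt_or_ge c c' with h | h
              · exact h
              · obtain rfl : c' = c := by omega
                exact absurd h3 hno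
        by_cases h1 : Tree leaf C k (child C p (2 * c))
        · obtain ⟨t', ht', e'⟩ := ih (by omega) (child_lt hp hc1) (hpush _ hc1)
          have hst := step_answer_even (leaf := leaf) hkK hp hc0 (hBi _ hc0) (by omega)
          have e1 : (step leaf B C K)^[t + 1]
              (0, k, child C p (2 * c), push B C p (2 * c) s) =
              (0, k, child C p (2 * c + 1), push B C p (2 * c + 1) s) := by
            rw [iterate_succ_apply', e, eq_true h1, hst, hch _ hc1]
          by_cases h2 : Tree leaf C k (child C p (2 * c + 1))
          · refine ⟨1 + (t' + (t + 1)), by omega, ?_⟩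
            rw [iterate_add_apply, iterate_add_apply, e1, e', eq_true h2, iterate_one,
              step_answer_odd hkK hp hc1 (hBi _ hc1) (by omega)]
            congr 1
            exact propext ⟨fun _ => ⟨c, by omega, le_rfl, h1, h2⟩, fun _ => trivial⟩
          · obtain ⟨t'', ht'', e''⟩ := next (fun h => h2 h.2) (2 * c + 1) (by omega) hc1
            refine ⟨t'' + (t' + (t + 1)), by omega, ?_⟩
            rw [iterate_add_apply, iterate_add_apply, e1, e', eq_false h2, e'']
        · obtain ⟨t'', ht'', e''⟩ := next (fun h => h1 h.1) (2 * c) (by omega) hc0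
          refine ⟨t'' + t, by omega, ?_⟩
          rw [iterate_add_apply, e, eq_false h1, e'']
    obtain ⟨t, ht, e⟩ := inner C hC le_rfl
    refine ⟨t + 1, ?_, ?_⟩
    · have hT2 : 2 ≤ T := by
        have : 1 ≤ (2 * C + 1) ^ k := Nat.one_le_pow _ _ (by omega)
        omega
      have : 2 * (2 * C + 1) ^ (k + 1) = (2 * C + 1) * T := by rw [pow_succ, hT]; ring
      rw [this]
      nlinarith
    · have hst : step leaf B C K (0, k + 1, p, s) = (0, k, child C p 0, push B C p 0 s) := by
        simp [step, hch 0 (by omega)]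
      rw [Nat.sub_self, Nat.mul_zero] at e
      rw [iterate_succ_apply, hst, e]
      simp [Tree]

/-- After `B` steps the evaluation has found the answer. -/
theorem iterate_eq_answer (hC : 0 < C) (hK : 0 < K) (hB : base C ^ (2 * K) ≤ B) {p : ℕ}
    (hp : p < C * C) :
    (step leaf B C K)^[B] (0, K, p, 0) = answer (Tree leaf C K p) K 0 := by
  obtain ⟨t, ht, e⟩ := exists_iterate (leaf := leaf) hC hB le_rfl hp (s := 0)
    (by unfold base; positivity)
  have htB : t ≤ B := by
    have h1 : (2 * C + 1) * (2 * C + 1) ^ K ≤ (2 * C + 1) ^ K * (2 * C + 1) ^ K :=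
      Nat.mul_le_mul_right _ (Nat.le_self_pow (by omega) _)
    have h2 : base C ^ (2 * K) = (2 * C + 1) ^ K * (2 * C + 1) ^ K * base C ^ K := by
      rw [two_mul, pow_add]
      rw [show base C ^ K = (2 * C + 1) ^ K * (2 * C + 1) ^ K by rw [base, mul_pow]]
    have h3 : 1 ≤ base C ^ K := Nat.one_le_pow _ _ (by unfold base; positivity)
    have h4 : 2 * (2 * C + 1) ^ K ≤ (2 * C + 1) * (2 * C + 1) ^ K :=
      Nat.mul_le_mul_right _ (by omega)
    nlinarith
  have hfix : step leaf B C K (answer (Tree leaf C K p) K 0) = answer (Tree leaf C K p) K 0 := by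
    unfold step answer
    split_ifs <;> simp_all
  obtain ⟨u, hu⟩ := Nat.exists_eq_add_of_le' htB
  calc (step leaf B C K)^[B] (0, K, p, 0) = (step leaf B C K)^[u + t] (0, K, p, 0) := by rw [← hu]
    _ = _ := by rw [iterate_add_apply, e, iterate_fixed hfix]

/-- The decision of `Sav C R K a b` by recursive evaluation. -/
def Decide (R : ℕ → ℕ → Prop) (B C K a b : ℕ) : Prop :=
  ((step (fun p => p / C = p % C ∨ R (p / C) (p % C)) B C K)^[B] (0, K, a * C + b, 0)).1 = 2

theorem decide_iff {R : ℕ → ℕ → Prop} {B C K a b : ℕ} (hK : 0 < K) (ha : a < C) (hb : b < C)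
    (hB : base C ^ (2 * K) ≤ B) : Decide R B C K a b ↔ Sav C R K a b := by
  rw [Decide, iterate_eq_answer (by omega) hK hB (by nlinarith), ← tree_iff_sav ha hb]
  simp [answer]

/-- Bounded reachability is computable in linear space, given a number `B` that is large enough for
the recursion stack. -/
theorem linSpace_decide {γ : Type} [Ctx γ] {R : γ → ℕ → ℕ → Prop} {B C K a b : γ → ℕ}
    (hR : LinSpace fun x : γ × ℕ × ℕ => R x.1 x.2.1 x.2.2) (hB : LinSpace B) (hC : LinSpace C)
    (hK : LinSpace K) (ha : LinSpace a) (hb : LinSpace b) :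
    LinSpace fun c => Decide (R c) (B c) (C c) (K c) (a c) (b c) := by
  unfold Decide
  set leaf : γ → ℕ → Prop := fun c p => p / C c = p % C c ∨ R c (p / C c) (p % C c) with hleaf
  have hl : LinSpace fun x : γ × ℕ => leaf x.1 x.2 := by
    have : LinSpace fun x : γ × ℕ => R x.1 (x.2 / C x.1) (x.2 % C x.1) :=
      hR.comp (g := fun x : γ × ℕ => (x.1, x.2 / C x.1, x.2 % C x.1)) (by fun_prop)
    fun_prop
  have hit : LinSpace fun c => (step (leaf c) (B c) (C c) (K c))^[B c]
      (0, K c, a c * C c + b c, 0) := by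
    refine LinSpace.iterate_of_le (b := fun c => B c + K c + (a c * C c + b c) + 2)
      (h := fun c => step (leaf c) (B c) (C c) (K c)) (linSpace_step hl hB hC hK) (by fun_prop) hB
      (by have : LinSpace fun c => B c + K c + (a c * C c + b c) + 2 := by fun_prop
          exact this.1) (fun c t _ => ?_)
    have key : ∀ t, let x := (step (leaf c) (B c) (C c) (K c))^[t] (0, K c, a c * C c + b c, 0)
        x.1 ≤ 2 ∧ x.2.1 ≤ K c ∧ x.2.2.1 ≤ B c + (a c * C c + b c) ∧ x.2.2.2 ≤ B c := by
      intro t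
      induction t with
      | zero => simp
      | succ t ih =>
        rw [iterate_succ_apply']
        generalize (step (leaf c) (B c) (C c) (K c))^[t] (0, K c, a c * C c + b c, 0) = x at ih
        obtain ⟨m, k, p, s⟩ := x
        obtain ⟨h1, h2, h3, h4⟩ := ih
        dsimp only at h1 h2 h3 h4
        have h5 : s / base (C c) / base (C c) ≤ B c :=
          (Nat.div_le_self _ _).trans ((Nat.div_le_self _ _).trans h4)
        have h6 : ∀ y, min (B c) y ≤ B c + (a c * C c + b c) := fun y =>
          (min_le_left _ _).trans (Nat.le_add_right _ _)
        have h7 : ∀ p i s, push (B c) (C c) p i s ≤ B c := fun _ _ _ => min_le_left _ _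
        simp only [step]
        split_ifs <;> refine ⟨?_, ?_, ?_, ?_⟩ <;> dsimp only <;>
          first | exact h6 _ | exact h7 _ _ _ | omega
    obtain ⟨h1, h2, h3, h4⟩ := key t
    simp only [atMost_prod, atMost_nat]
    refine ⟨?_, ?_, ?_, ?_⟩ <;> omega
  exact (LinSpace.fst.comp hit).eq (LinSpace.const 2)

end Savitch

/-! ### Instances as numbers -/

namespace CoverCode

open Function StackProgram

variable {γ : Type} [Ctx γ]

/-- The digit with index `i` of `z` in base `q`. -/
def dig (q i z : ℕ) : ℕ := (fun y => y / q)^[i] z % q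

@[fun_prop]
theorem LinSpace.dig {q i z : γ → ℕ} (hq : LinSpace q) (hi : LinSpace i) (hz : LinSpace z) :
    LinSpace fun c => dig (q c) (i c) (z c) := by
  have h : LinSpace fun c => (fun y => y / q c)^[i c] (z c) := by
    refine LinSpace.iterate_of_le (h := fun c y => y / q c) (by fun_prop) hz hi hz.1
      (fun c t ht => ?_)
    rw [atMost_nat]
    clear ht
    induction t with
    | zero => exact le_rfl
    | succ t ih =>
      rw [iterate_succ_apply']
      exact (Nat.div_le_self _ _).trans ih
  unfold CoverCode.dig
  fun_prop

/-- The power `b ^ k`, cut off at `B`. -/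
def cpow (B b k : ℕ) : ℕ := (fun y => min B (y * b))^[k] 1

@[fun_prop]
theorem LinSpace.cpow {B b k : γ → ℕ} (hB : LinSpace B) (hb : LinSpace b) (hk : LinSpace k) :
    LinSpace fun c => cpow (B c) (b c) (k c) := by
  refine LinSpace.iterate_of_le (h := fun c y => min (B c) (y * b c)) (b := fun c => B c + 1)
    (by fun_prop) (by fun_prop) hk hB.succ.1 (fun c t _ => ?_)
  rw [atMost_nat]
  cases t with
  | zero => simp
  | succ t =>
    rw [iterate_succ_apply']
    exact (min_le_left _ _).trans (Nat.le_succ _)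

theorem cpow_eq {B b k : ℕ} (hb : 0 < b) (h : b ^ k ≤ B) : cpow B b k = b ^ k := by
  unfold cpow
  induction k with
  | zero => rfl
  | succ k ih =>
    rw [iterate_succ_apply', ih ((Nat.pow_le_pow_right hb (Nat.le_succ k)).trans h), ← pow_succ,
      min_eq_right h]

/-- Prefix the digit `d` to a numeral, cut off at `W`. -/
def pre (W d y : ℕ) : ℕ := min W (7 * y + d + 1)

/-- Prefix the unary numeral of `k`, cut off at `W`. -/
def preN (W k y : ℕ) : ℕ := (fun y => pre W 0 y)^[k] y

theorem pre_min {W d y : ℕ} : pre W d (min W y) = min W (7 * y + d + 1) := by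
  unfold pre
  omega

theorem pre_num {W : ℕ} {d : Fin 7} {l : List (Fin 7)} :
    pre W d (min W (num l)) = min W (num (d :: l)) := pre_min

theorem preN_num {W k : ℕ} {l : List (Fin 7)} :
    preN W k (min W (num l)) = min W (num (List.replicate k 0 ++ l)) := by
  unfold preN
  induction k with
  | zero => rfl
  | succ k ih =>
    rw [iterate_succ_apply', ih]
    exact pre_num (d := 0)

@[fun_prop]
theorem LinSpace.pre {W d y : γ → ℕ} (hW : LinSpace W) (hd : LinSpace d) (hy : LinSpace y) :
    LinSpace fun c => pre (W c) (d c) (y c) := by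
  unfold CoverCode.pre
  fun_prop

@[fun_prop]
theorem LinSpace.preN {W k y : γ → ℕ} (hW : LinSpace W) (hk : LinSpace k) (hy : LinSpace y) :
    LinSpace fun c => preN (W c) (k c) (y c) := by
  refine LinSpace.iterate_of_le (h := fun c y => CoverCode.pre (W c) 0 y) (b := fun c => W c + y c)
    (LinSpace.pre (by fun_prop) (by fun_prop) (by fun_prop)) hy hk (hW.add hy).1 (fun c t _ => ?_)
  rw [atMost_nat]
  cases t with
  | zero => exact Nat.le_add_left _ _
  | succ t =>
    rw [iterate_succ_apply']
    exact (min_le_left _ _).trans (Nat.le_add_right _ _)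

/-- The word, as a list of digits, of a transition with source `s`, operation `o`, counter `x` and
target `t`. The operation is given by its digit; a transition without effect has `x = 0`. -/
def transWord (s o x t : ℕ) : List (Fin 7) :=
  List.replicate s 0 ++ Fin.ofNat 7 o :: (List.replicate x 0 ++ 1 :: (List.replicate t 0 ++ [1]))

/-- Prefix the word of a transition, cut off at `W`. -/
def preTrans (W s o x t y : ℕ) : ℕ :=
  preN W s (pre W (o % 7) (preN W x (pre W 1 (preN W t (pre W 1 y)))))

theorem preTrans_num {W s o x t : ℕ} {l : List (Fin 7)} :
    preTrans W s o x t (min W (num l)) = min W (num (transWord s o x t ++ l)) := by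
  unfold preTrans transWord
  have h1 : ∀ l, pre W 1 (min W (num l)) = min W (num (1 :: l)) := fun l => pre_num (d := 1)
  have h2 : ∀ l, pre W (o % 7) (min W (num l)) = min W (num (Fin.ofNat 7 o :: l)) := fun l =>
    pre_num (d := Fin.ofNat 7 o)
  rw [h1, preN_num, h1, preN_num, h2, preN_num]
  simp

@[fun_prop]
theorem LinSpace.preTrans {W s o x t y : γ → ℕ} (hW : LinSpace W) (hs : LinSpace s)
    (ho : LinSpace o) (hx : LinSpace x) (ht : LinSpace t) (hy : LinSpace y) :
    LinSpace fun c => preTrans (W c) (s c) (o c) (x c) (t c) (y c) := by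
  unfold CoverCode.preTrans
  fun_prop

theorem preTrans_le {W s o x t y : ℕ} : preTrans W s o x t y ≤ W := by
  have h1 : ∀ {d y}, pre W d y ≤ W := min_le_left _ _
  have h2 : ∀ {k y}, y ≤ W → preN W k y ≤ W := by
    intro k y hy
    unfold preN
    cases k with
    | zero => exact hy
    | succ k =>
      rw [iterate_succ_apply']
      exact h1
  exact h2 h1

/-- The word of the first `r` transitions coded by `z`, in reverse order. The source, operation,
counter and target of the `j`-th transition are the digits of `z` in base `q` from the index `4 * j`
on. -/
def transWords (q z : ℕ) : ℕ → List (Fin 7)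
  | 0 => []
  | r + 1 => transWord (dig q (4 * r) z) (dig q (4 * r + 1) z) (dig q (4 * r + 2) z)
      (dig q (4 * r + 3) z) ++ transWords q z r

/-- The numeral of the word of the first `r` transitions coded by `z`, cut off at `W`. -/
def encTrans (W q z r : ℕ) : ℕ :=
  ((fun x : ℕ × ℕ => (x.1 + 1, preTrans W (dig q (4 * x.1) z) (dig q (4 * x.1 + 1) z)
    (dig q (4 * x.1 + 2) z) (dig q (4 * x.1 + 3) z) x.2))^[r] (0, 0)).2

theorem encTrans_eq {W q z r : ℕ} : encTrans W q z r = min W (num (transWords q z r)) := by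
  have h : (fun x : ℕ × ℕ => (x.1 + 1, preTrans W (dig q (4 * x.1) z) (dig q (4 * x.1 + 1) z)
      (dig q (4 * x.1 + 2) z) (dig q (4 * x.1 + 3) z) x.2))^[r] (0, 0) =
      (r, min W (num (transWords q z r))) := by
    induction r with
    | zero => simp [transWords, num]
    | succ r ih =>
      rw [iterate_succ_apply', ih, transWords]
      exact Prod.ext rfl preTrans_num
  rw [encTrans, h]

@[fun_prop]
theorem LinSpace.encTrans {W q z r : γ → ℕ} (hW : LinSpace W) (hq : LinSpace q) (hz : LinSpace z)
    (hr : LinSpace r) : LinSpace fun c => encTrans (W c) (q c) (z c) (r c) := by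
  have h : LinSpace fun c => (fun x : ℕ × ℕ => (x.1 + 1, CoverCode.preTrans (W c)
      (CoverCode.dig (q c) (4 * x.1) (z c)) (CoverCode.dig (q c) (4 * x.1 + 1) (z c))
      (CoverCode.dig (q c) (4 * x.1 + 2) (z c)) (CoverCode.dig (q c) (4 * x.1 + 3) (z c))
      x.2))^[r c] (0, 0) := by
    refine LinSpace.iterate_of_le (b := fun c => r c + W c)
      (h := fun c (x : ℕ × ℕ) => (x.1 + 1, CoverCode.preTrans (W c)
      (CoverCode.dig (q c) (4 * x.1) (z c)) (CoverCode.dig (q c) (4 * x.1 + 1) (z c))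
      (CoverCode.dig (q c) (4 * x.1 + 2) (z c)) (CoverCode.dig (q c) (4 * x.1 + 3) (z c)) x.2))
      ?_ (by fun_prop) hr (hr.add hW).1 (fun c t ht => ?_)
    · fun_prop
    · have key : ∀ t, AtMost t ((fun x : ℕ × ℕ => (x.1 + 1, CoverCode.preTrans (W c)
          (CoverCode.dig (q c) (4 * x.1) (z c)) (CoverCode.dig (q c) (4 * x.1 + 1) (z c))
          (CoverCode.dig (q c) (4 * x.1 + 2) (z c)) (CoverCode.dig (q c) (4 * x.1 + 3) (z c))
          x.2))^[t] (0, 0)).1 ∧ AtMost (W c) ((fun x : ℕ × ℕ => (x.1 + 1, CoverCode.preTrans (W c)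
          (CoverCode.dig (q c) (4 * x.1) (z c)) (CoverCode.dig (q c) (4 * x.1 + 1) (z c))
          (CoverCode.dig (q c) (4 * x.1 + 2) (z c)) (CoverCode.dig (q c) (4 * x.1 + 3) (z c))
          x.2))^[t] (0, 0)).2 := by
        simp only [atMost_nat]
        intro t
        induction t with
        | zero => simp
        | succ t ih =>
          rw [iterate_succ_apply']
          exact ⟨Nat.succ_le_succ ih.1, preTrans_le⟩
      obtain ⟨h1, h2⟩ := key t
      exact atMost_prod.2 ⟨h1.mono (by omega), h2.mono (by omega)⟩
  exact LinSpace.snd.comp h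

/-- The word of an instance, as a list of digits. -/
def instWord (q n m i f z r : ℕ) : List (Fin 7) :=
  List.replicate n 0 ++ 1 :: (List.replicate m 0 ++ 1 :: (List.replicate i 0 ++
    1 :: (List.replicate f 0 ++ 1 :: transWords q z r)))

/-- The numeral of the word of an instance, cut off at `W`. -/
def encInst (W q n m i f z r : ℕ) : ℕ :=
  preN W n (pre W 1 (preN W m (pre W 1 (preN W i (pre W 1 (preN W f (pre W 1
    (encTrans W q z r))))))))

theorem encInst_eq {W q n m i f z r : ℕ} :
    encInst W q n m i f z r = min W (num (instWord q n m i f z r)) := by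
  have h1 : ∀ l, pre W 1 (min W (num l)) = min W (num (1 :: l)) := fun l => pre_num (d := 1)
  rw [encInst, encTrans_eq, h1, preN_num, h1, preN_num, h1, preN_num, h1, preN_num, instWord]

@[fun_prop]
theorem LinSpace.encInst {W q n m i f z r : γ → ℕ} (hW : LinSpace W) (hq : LinSpace q)
    (hn : LinSpace n) (hm : LinSpace m) (hi : LinSpace i) (hf : LinSpace f) (hz : LinSpace z)
    (hr : LinSpace r) :
    LinSpace fun c => encInst (W c) (q c) (n c) (m c) (i c) (f c) (z c) (r c) := by
  unfold CoverCode.encInst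
  fun_prop

/-! ### The decision procedure -/

/-- The operation `o` may change the value of the counter that it concerns from `a` to `b`. The
operations are an increment (`2`), a blocking decrement (`3`) and a non-blocking one (`6`). -/
def OpEff (o a b : ℕ) : Prop :=
  (o = 2 ∧ b = a + 1) ∨ (o = 3 ∧ 0 < a ∧ b = a - 1) ∨ (o = 6 ∧ b = a - 1)

/-- A transition with operation `o` on the counter `x` may change the value of the counter `y` from
`a` to `b`. The operation `5` has no effect. -/
def Eff (o x y a b : ℕ) : Prop := ((o ≠ 5 ∧ y = x) ∧ OpEff o a b) ∨ (¬ (o ≠ 5 ∧ y = x) ∧ b = a)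

@[fun_prop]
theorem LinSpace.eff {o x y a b : γ → ℕ} (ho : LinSpace o) (hx : LinSpace x) (hy : LinSpace y)
    (ha : LinSpace a) (hb : LinSpace b) : LinSpace fun c => Eff (o c) (x c) (y c) (a c) (b c) := by
  unfold Eff OpEff
  fun_prop

/-- A step between configurations that are coded by numbers: the digits of `a` in base `D` are the
location and the values of the counters. -/
def NumStep (D q m z r a b : ℕ) : Prop :=
  ∃ j, j < r ∧ dig D 0 a = dig q (4 * j) z ∧ dig D 0 b = dig q (4 * j + 3) z ∧
    ∀ y, y < m → Eff (dig q (4 * j + 1) z) (dig q (4 * j + 2) z) y (dig D (y + 1) a)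
      (dig D (y + 1) b)

@[fun_prop]
theorem LinSpace.numStep {D q m z r a b : γ → ℕ} (hD : LinSpace D) (hq : LinSpace q)
    (hm : LinSpace m) (hz : LinSpace z) (hr : LinSpace r) (ha : LinSpace a) (hb : LinSpace b) :
    LinSpace fun c => NumStep (D c) (q c) (m c) (z c) (r c) (a c) (b c) := by
  unfold NumStep
  exact LinSpace.exists_lt hr (LinSpace.and (by fun_prop) (LinSpace.and (by fun_prop)
    (LinSpace.forall_lt (by fun_prop) (by fun_prop))))

/-- A transition of a machine with `n` locations and `m` counters. -/
def ValidTrans (n m s o x t : ℕ) : Prop :=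
  s < n ∧ t < n ∧ (((o = 2 ∨ o = 3 ∨ o = 6) ∧ x < m) ∨ (o = 5 ∧ x = 0))

/-- The numbers are those of an instance with `r` transitions. If `φ` is true, then the machine is
required to have restore transitions. -/
def Valid (φ : Prop) (q n m i f z r : ℕ) : Prop :=
  i < n ∧ f < n ∧ (∀ j, j < r → ValidTrans n m (dig q (4 * j) z) (dig q (4 * j + 1) z)
    (dig q (4 * j + 2) z) (dig q (4 * j + 3) z)) ∧
  (φ → ∀ s, s < n → ∃ j, j < r ∧ dig q (4 * j) z = s ∧ dig q (4 * j + 1) z = 5 ∧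
    dig q (4 * j + 3) z = i)

@[fun_prop]
theorem LinSpace.valid (φ : Prop) {q n m i f z r : γ → ℕ} (hq : LinSpace q) (hn : LinSpace n)
    (hm : LinSpace m) (hi : LinSpace i) (hf : LinSpace f) (hz : LinSpace z) (hr : LinSpace r) :
    LinSpace fun c => Valid φ (q c) (n c) (m c) (i c) (f c) (z c) (r c) := by
  unfold Valid ValidTrans
  exact LinSpace.and (by fun_prop) (LinSpace.and (by fun_prop) (LinSpace.and
    (LinSpace.forall_lt hr (by fun_prop)) (LinSpace.imp (by fun_prop) (LinSpace.forall_lt hn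
      (LinSpace.exists_lt (by fun_prop) (by fun_prop))))))

/-- The target location `f` is coverable by a run of at most `2 ^ e` steps in which all counters
stay below `2 ^ e`, as decided by divide and conquer. -/
def Cover (q e B m i f z r : ℕ) : Prop :=
  ∃ b, b < cpow B (cpow B 2 e) (m + 1) ∧ dig (cpow B 2 e) 0 b = f ∧
    Savitch.Decide (NumStep (cpow B 2 e) q m z r) B (cpow B (cpow B 2 e) (m + 1)) e i b

@[fun_prop]
theorem LinSpace.cover {q e B m i f z r : γ → ℕ} (hq : LinSpace q) (he : LinSpace e)
    (hB : LinSpace B) (hm : LinSpace m) (hi : LinSpace i) (hf : LinSpace f) (hz : LinSpace z)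
    (hr : LinSpace r) :
    LinSpace fun c => Cover (q c) (e c) (B c) (m c) (i c) (f c) (z c) (r c) := by
  unfold Cover
  exact LinSpace.exists_lt (by fun_prop) (LinSpace.and (by fun_prop) (Savitch.linSpace_decide
    (by fun_prop) (by fun_prop) (by fun_prop) (by fun_prop) (by fun_prop) (by fun_prop)))

/-- The decision procedure for coverability. The word is given by its numeral `w`, and `e` and `B`
bound the search: `e` is an exponent for the size of configurations and the length of runs, and `B`
is a bound on all numbers. An instance whose word is `w` is found by exhaustive search. -/
def Accepts (φ : Prop) (x : ℕ × ℕ × ℕ) : Prop :=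
  ∃ z, z < x.2.2 ∧ ∃ n, n < x.1 ∧ ∃ m, m < x.1 ∧ ∃ i, i < x.1 ∧ ∃ f, f < x.1 ∧ ∃ r, r < x.1 ∧
    Valid φ (x.1 + 8) n m i f z r ∧ encInst (x.1 + 1) (x.1 + 8) n m i f z r = x.1 ∧
    Cover (x.1 + 8) x.2.1 x.2.2 m i f z r

theorem linSpace_accepts (φ : Prop) : LinSpace (Accepts φ) := by
  unfold Accepts
  exact LinSpace.exists_lt (by fun_prop) (LinSpace.exists_lt (by fun_prop) (LinSpace.exists_lt
    (by fun_prop) (LinSpace.exists_lt (by fun_prop) (LinSpace.exists_lt (by fun_prop)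
    (LinSpace.exists_lt (by fun_prop) (by fun_prop))))))

end CoverCode

/-! ### Transitions and configurations as numbers -/

namespace CoverCode

open Function StackProgram CounterMachine

/-- The digits of the letters of the input alphabet. -/
def symCode : Sym ↪ Fin 7 where
  toFun
    | .tick => 0
    | .sep => 1
    | .inc => 2
    | .dec => 3
    | .isZero => 4
    | .nop => 5
    | .nbdec => 6
  inj' := by
    intro a b h
    cases a <;> cases b <;> first | rfl | exact absurd h (by decide)

/-- Transitions, blocking and non-blocking. -/
abbrev Trans (n m : ℕ) := (Fin n × CAct (Fin m) × Fin n) ⊕ (Fin n × Fin m × Fin n)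

variable {n m : ℕ}

/-- The operation and the counter of an action; an action without effect has the counter `0`. -/
def actCode : CAct (Fin m) → ℕ × ℕ
  | .inc x => (2, x)
  | .dec x => (3, x)
  | .isZero x => (4, x)
  | .nop => (5, 0)

/-- The source location of a transition. -/
def Trans.src : Trans n m → Fin n
  | .inl t => t.1
  | .inr t => t.1

/-- The target location of a transition. -/
def Trans.tgt : Trans n m → Fin n
  | .inl t => t.2.2
  | .inr t => t.2.2

/-- The operation and the counter of a transition. -/
def Trans.act : Trans n m → ℕ × ℕ
  | .inl t => actCode t.2.1
  | .inr t => (6, t.2.1)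

/-- Source, operation, counter and target of a transition. -/
def Trans.fields (t : Trans n m) : ℕ × ℕ × ℕ × ℕ := (t.src, t.act.1, t.act.2, t.tgt)

theorem map_unary (k : ℕ) : (unary k).map symCode = List.replicate k 0 := List.map_replicate

theorem map_encodeTrans (t : Trans n m) :
    (encodeTrans t).map symCode = transWord t.src t.act.1 t.act.2 t.tgt := by
  rcases t with ⟨s, a, t⟩ | ⟨s, x, t⟩
  · cases a <;>
      simp [encodeTrans, encodeAct, transWord, map_unary, Trans.src, Trans.tgt, Trans.act,
        actCode] <;> exact ⟨rfl, rfl⟩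
  · simp [encodeTrans, transWord, map_unary, Trans.src, Trans.tgt, Trans.act]
    exact ⟨rfl, rfl⟩

/-- The fields of the `j`-th transition coded by `z`. -/
def fieldsAt (q z j : ℕ) : ℕ × ℕ × ℕ × ℕ :=
  (dig q (4 * j) z, dig q (4 * j + 1) z, dig q (4 * j + 2) z, dig q (4 * j + 3) z)

/-- The number `z` codes the transitions in the list, the last one first. -/
def Codes (q z : ℕ) : List (Trans n m) → Prop
  | [] => True
  | t :: l => fieldsAt q z l.length = t.fields ∧ Codes q z l

theorem Codes.transWords_eq {q z : ℕ} {l : List (Trans n m)} (h : Codes q z l) :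
    transWords q z l.length = (l.flatMap encodeTrans).map symCode := by
  induction l with
  | nil => rfl
  | cons t l ih =>
    obtain ⟨h1, h2⟩ := h
    simp only [fieldsAt, Trans.fields, Prod.mk.injEq] at h1
    rw [List.length_cons, transWords, h1.1, h1.2.1, h1.2.2.1, h1.2.2.2, ih h2, List.flatMap_cons,
      List.map_append, map_encodeTrans]

theorem Codes.instWord_eq {q z : ℕ} {l : List (Trans n m)} (h : Codes q z l) (i f : Fin n) :
    instWord q n m i f z l.length = (encodeInstance i f l).map symCode := by
  simp [instWord, encodeInstance, map_unary, h.transWords_eq]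
  rfl

theorem Codes.exists_iff {q z : ℕ} {l : List (Trans n m)} (h : Codes q z l)
    (p : ℕ × ℕ × ℕ × ℕ → Prop) :
    (∃ j, j < l.length ∧ p (fieldsAt q z j)) ↔ ∃ t ∈ l, p t.fields := by
  induction l with
  | nil => simp
  | cons t l ih =>
    simp only [List.length_cons, Nat.lt_succ_iff_lt_or_eq, or_and_right, exists_or, ih h.2,
      exists_eq_left, h.1, List.mem_cons]
    exact or_comm

theorem Codes.forall_iff {q z : ℕ} {l : List (Trans n m)} (h : Codes q z l)
    (p : ℕ × ℕ × ℕ × ℕ → Prop) :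
    (∀ j, j < l.length → p (fieldsAt q z j)) ↔ ∀ t ∈ l, p t.fields := by
  have := h.exists_iff fun x => ¬ p x
  rw [← not_iff_not]
  push Not
  exact this

theorem exists_trans {s o x t : ℕ} (h : ValidTrans n m s o x t) :
    ∃ a : Trans n m, a.fields = (s, o, x, t) := by
  obtain ⟨hs, ht, ⟨ho, hx⟩ | ⟨rfl, rfl⟩⟩ := h
  · rcases ho with rfl | rfl | rfl
    exacts [⟨.inl (⟨s, hs⟩, .inc ⟨x, hx⟩, ⟨t, ht⟩), rfl⟩,
      ⟨.inl (⟨s, hs⟩, .dec ⟨x, hx⟩, ⟨t, ht⟩), rfl⟩, ⟨.inr (⟨s, hs⟩, ⟨x, hx⟩, ⟨t, ht⟩), rfl⟩]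
  · exact ⟨.inl (⟨s, hs⟩, .nop, ⟨t, ht⟩), rfl⟩

theorem exists_codes {q z r : ℕ} (h : ∀ j, j < r → ValidTrans n m (dig q (4 * j) z)
    (dig q (4 * j + 1) z) (dig q (4 * j + 2) z) (dig q (4 * j + 3) z)) :
    ∃ l : List (Trans n m), l.length = r ∧ Codes q z l := by
  induction r with
  | zero => exact ⟨[], rfl, trivial⟩
  | succ r ih =>
    obtain ⟨l, hl, hc⟩ := ih fun j hj => h j (by omega)
    obtain ⟨t, ht⟩ := exists_trans (h r (by omega))
    exact ⟨t :: l, by rw [List.length_cons, hl], by rw [hl, ht]; rfl, hc⟩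

theorem validTrans_fields {t : Trans n m} (h : t.act.1 ≠ 4) :
    ValidTrans n m t.src t.act.1 t.act.2 t.tgt := by
  refine ⟨t.src.isLt, t.tgt.isLt, ?_⟩
  rcases t with ⟨s, a, t⟩ | ⟨s, x, t⟩
  · cases a <;> simp_all [Trans.act, actCode]
  · simp [Trans.act]

theorem dig_eq (q i z : ℕ) : dig q i z = z / q ^ i % q := by
  unfold dig
  congr 1
  induction i with
  | zero => simp
  | succ i ih => rw [iterate_succ_apply', ih, Nat.div_div_eq_div_mul, pow_succ]

/-- The number with the digits `d 0, …, d (k - 1)` in base `q`. -/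
def undig (q : ℕ) : (ℕ → ℕ) → ℕ → ℕ
  | _, 0 => 0
  | d, k + 1 => d 0 + q * undig q (fun i => d (i + 1)) k

theorem undig_lt {q k : ℕ} {d : ℕ → ℕ} (hd : ∀ i < k, d i < q) : undig q d k < q ^ k := by
  induction k generalizing d with
  | zero => simp [undig]
  | succ k ih =>
    have h1 := ih (d := fun i => d (i + 1)) fun i hi => hd _ (by omega)
    have h2 := hd 0 (by omega)
    rw [undig, pow_succ']
    nlinarith

theorem dig_undig {q k i : ℕ} {d : ℕ → ℕ} (hd : ∀ i < k, d i < q) (hi : i < k) :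
    dig q i (undig q d k) = d i := by
  induction k generalizing d i with
  | zero => omega
  | succ k ih =>
    have h2 := hd 0 (by omega)
    unfold dig at ih ⊢
    cases i with
    | zero => rw [undig, iterate_zero_apply, Nat.add_mul_mod_self_left, Nat.mod_eq_of_lt h2]
    | succ i =>
      rw [undig, iterate_succ_apply, Nat.add_mul_div_left _ _ (by omega), Nat.div_eq_of_lt h2,
        Nat.zero_add, ih (fun i hi => hd _ (by omega)) (by omega)]

/-- The digits of the code of a list of transitions. -/
def listDigit : List (Trans n m) → ℕ → ℕ
  | [], _ => 0
  | t :: l, i =>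
    if i < 4 * l.length then listDigit l i
    else if i = 4 * l.length then t.src
    else if i = 4 * l.length + 1 then t.act.1
    else if i = 4 * l.length + 2 then t.act.2
    else t.tgt

theorem codes_of_dig {q z : ℕ} {l : List (Trans n m)}
    (h : ∀ i < 4 * l.length, dig q i z = listDigit l i) : Codes q z l := by
  induction l with
  | nil => trivial
  | cons t l ih =>
    rw [List.length_cons] at h
    refine ⟨?_, ih fun i hi => ?_⟩
    · rw [fieldsAt, h _ (by omega), h _ (by omega), h _ (by omega), h _ (by omega)]
      simp [listDigit, Trans.fields]
    · rw [h i (by omega), listDigit, if_pos hi]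

theorem exists_codes_of_list {q : ℕ} (l : List (Trans n m))
    (hl : ∀ t ∈ l, t.src < q ∧ t.act.1 < q ∧ t.act.2 < q ∧ t.tgt < q) (hq : 0 < q) :
    ∃ z < q ^ (4 * l.length), Codes q z l := by
  have h : ∀ i, listDigit l i < q := by
    induction l with
    | nil => exact fun _ => hq
    | cons t l ih =>
      intro i
      obtain ⟨h1, h2, h3, h4⟩ := hl t (by simp)
      unfold listDigit
      split_ifs
      exacts [ih (fun t ht => hl t (by simp [ht])) i, h1, h2, h3, h4]
  exact ⟨_, undig_lt fun i _ => h i, codes_of_dig fun i hi => dig_undig (fun i _ => h i) hi⟩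

/-! ### Steps of counter machines -/

/-- The effect of an action other than a zero test, counter by counter. -/
theorem effect_iff {a : CAct (Fin m)} (ha : (actCode a).1 ≠ 4) {v v' : Fin m → ℕ} :
    a.Effect v v' ↔ ∀ y : Fin m, Eff (actCode a).1 (actCode a).2 y (v y) (v' y) := by
  cases a with
  | inc x =>
    simp only [CAct.Effect, funext_iff, update_apply, Eff, OpEff, actCode, Fin.val_inj]
    refine forall_congr' fun y => ?_
    by_cases hy : y = x
    · subst hy; simp
    · simp [hy]
  | dec x =>
    simp only [CAct.Effect, funext_iff, update_apply, Eff, OpEff, actCode, Fin.val_inj]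
    constructor
    · rintro ⟨h1, h2⟩ y
      by_cases hy : y = x
      · subst hy; simpa [h1] using h2 y
      · simpa [hy] using h2 y
    · intro h
      refine ⟨by have := h x; simp at this; omega, fun y => ?_⟩
      by_cases hy : y = x
      · subst hy; have := h y; simp at this; simp; omega
      · simpa [hy] using h y
  | isZero x => exact absurd rfl ha
  | nop => simp [CAct.Effect, funext_iff, Eff, actCode]

/-- The steps of a machine are described by a list of its transitions, counter by counter. -/
theorem step_iff {M : NBCM (Fin n) (Fin m)} {l : List (Trans n m)}
    (hb : ∀ t, Sum.inl t ∈ l ↔ t ∈ M.Δ) (hnb : ∀ t, Sum.inr t ∈ l ↔ t ∈ M.Δnb)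
    {c c' : Fin n × (Fin m → ℕ)} : M.Step c c' ↔
      ∃ t ∈ l, t.src = c.1 ∧ t.tgt = c'.1 ∧
        ∀ y : Fin m, Eff t.act.1 t.act.2 y (c.2 y) (c'.2 y) := by
  have h6 : ∀ x : Fin m, c'.2 = update c.2 x (c.2 x - 1) ↔
      ∀ y : Fin m, Eff 6 x y (c.2 y) (c'.2 y) := by
    intro x
    simp only [funext_iff, update_apply, Eff, OpEff, Fin.val_inj]
    refine forall_congr' fun y => ?_
    by_cases hy : y = x
    · subst hy; simp
    · simp [hy]
  constructor
  · rintro (⟨a, ha, h⟩ | ⟨x, hx, h⟩)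
    · refine ⟨.inl (c.1, a, c'.1), (hb _).2 ha, rfl, rfl, (effect_iff ?_).1 h⟩
      cases a with
      | isZero x => exact absurd ha (M.testFree _ _ _)
      | _ => simp [actCode]
    · exact ⟨.inr (c.1, x, c'.1), (hnb _).2 hx, rfl, rfl, (h6 x).1 h⟩
  · rintro ⟨⟨s, a, t⟩ | ⟨s, x, t⟩, ht, h1, h2, h⟩
    · refine .inl ⟨a, by rw [← h1, ← h2]; exact (hb _).1 ht, (effect_iff ?_).2 h⟩
      cases a with
      | isZero x => exact absurd ((hb _).1 ht) (M.testFree _ _ _)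
      | _ => simp [actCode]
    · exact .inr ⟨x, by rw [← h1, ← h2]; exact (hnb _).1 ht, (h6 x).2 h⟩

/-- The number `a` codes the configuration `c` in base `D`. -/
def IsCfg (D a : ℕ) (c : Fin n × (Fin m → ℕ)) : Prop :=
  dig D 0 a = c.1 ∧ ∀ y : Fin m, dig D (y + 1) a = c.2 y

theorem exists_isCfg {D : ℕ} {c : Fin n × (Fin m → ℕ)} (h1 : c.1 < D) (h2 : ∀ y, c.2 y < D) :
    ∃ a < D ^ (m + 1), IsCfg D a c := by
  let d : ℕ → ℕ := fun i => if h : i - 1 < m then (if i = 0 then c.1 else c.2 ⟨i - 1, h⟩) else c.1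
  have hd : ∀ i < m + 1, d i < D := by
    intro i _
    simp only [d]
    split_ifs
    exacts [h1, h2 _, h1]
  refine ⟨_, undig_lt hd, ?_, fun y => ?_⟩
  · rw [dig_undig hd (by omega)]
    simp [d]
  · rw [dig_undig hd (by omega)]
    simp [d]

theorem isCfg_start {D : ℕ} {i : Fin n} (h : i < D) :
    IsCfg D i (i, fun _ : Fin m => 0) := by
  refine ⟨?_, fun y => ?_⟩
  · rw [dig_eq, pow_zero, Nat.div_one, Nat.mod_eq_of_lt h]
  · rw [dig_eq, Nat.div_eq_of_lt (h.trans_le (Nat.le_self_pow (by omega) _)), Nat.zero_mod]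

section

variable {M : NBCM (Fin n) (Fin m)} {l : List (Trans n m)} {q z D : ℕ}

theorem numStep_iff (hz : Codes q z l) {a b : ℕ} : NumStep D q m z l.length a b ↔
    ∃ t ∈ l, dig D 0 a = t.src ∧ dig D 0 b = t.tgt ∧
      ∀ y, y < m → Eff t.act.1 t.act.2 y (dig D (y + 1) a) (dig D (y + 1) b) :=
  hz.exists_iff fun x => dig D 0 a = x.1 ∧ dig D 0 b = x.2.2.2 ∧
      ∀ y, y < m → Eff x.2.1 x.2.2.1 y (dig D (y + 1) a) (dig D (y + 1) b)

theorem numStep_iff_step (hb : ∀ t, Sum.inl t ∈ l ↔ t ∈ M.Δ) (hnb : ∀ t, Sum.inr t ∈ l ↔ t ∈ M.Δnb)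
    (hz : Codes q z l) {a b : ℕ} {c c' : Fin n × (Fin m → ℕ)} (ha : IsCfg D a c)
    (hc : IsCfg D b c') : NumStep D q m z l.length a b ↔ M.Step c c' := by
  rw [numStep_iff hz, step_iff hb hnb, ha.1, hc.1]
  refine exists_congr fun t => and_congr_right fun _ => and_congr ?_ (and_congr ?_ ?_)
  · rw [Fin.val_inj, eq_comm]
  · rw [Fin.val_inj, eq_comm]
  · constructor
    · intro h y
      rw [← ha.2, ← hc.2]
      exact h y y.isLt
    · intro h y hy
      have := h ⟨y, hy⟩
      rwa [← ha.2, ← hc.2] at this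

/-- Runs of numbers are runs of the machine. -/
theorem reaches_of_numStep (hb : ∀ t, Sum.inl t ∈ l ↔ t ∈ M.Δ)
    (hnb : ∀ t, Sum.inr t ∈ l ↔ t ∈ M.Δnb) (hz : Codes q z l) {a b C : ℕ}
    {c : Fin n × (Fin m → ℕ)} (ha : IsCfg D a c) (h : Relation.ReflTransGen
      (fun x y => x < C ∧ y < C ∧ NumStep D q m z l.length x y) a b) :
    ∃ c', IsCfg D b c' ∧ Relation.ReflTransGen M.Step c c' := by
  induction h with
  | refl => exact ⟨c, ha, .refl⟩
  | @tail x y _ hxy ih =>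
    obtain ⟨d, hd, h⟩ := ih
    obtain ⟨t, -, -, h2, -⟩ := (numStep_iff hz).1 hxy.2.2
    have hy : IsCfg D y (t.tgt, fun i : Fin m => dig D (i + 1) y) := ⟨h2, fun _ => rfl⟩
    exact ⟨_, hy, h.tail ((numStep_iff_step hb hnb hz hd hy).1 hxy.2.2)⟩

/-- The operation `4` is the zero test, which a test-free machine does not have. -/
theorem act_ne_four (hb : ∀ t, Sum.inl t ∈ l ↔ t ∈ M.Δ) {t : Trans n m} (ht : t ∈ l) :
    t.act.1 ≠ 4 := by
  rcases t with ⟨s, a, t⟩ | ⟨s, x, t⟩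
  · cases a with
    | isZero y => exact absurd ((hb _).1 ht) (M.testFree _ _ _)
    | _ => simp [Trans.act, actCode]
  · simp [Trans.act]

theorem Eff.le {o x y a b : ℕ} (h : Eff o x y a b) : b ≤ a + 1 ∧ a ≤ b + 1 := by
  rcases h with ⟨-, h | h | h⟩ | ⟨-, h⟩ <;> omega

/-- A covering run within the bounds of Rackoff, as a run of numbers. -/
theorem sav_of_coverable (hb : ∀ t, Sum.inl t ∈ l ↔ t ∈ M.Δ)
    (hnb : ∀ t, Sum.inr t ∈ l ↔ t ∈ M.Δnb) (hz : Codes q z l) {e : ℕ} (hD : D = 2 ^ e) (hn : n ≤ D)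
    (he : (n + 2) ^ (m + 5) ^ (m + 1) < D) {f : Fin n} (h : M.Coverable f) :
    ∃ b < D ^ (m + 1), dig D 0 b = f ∧
      Savitch.Sav (D ^ (m + 1)) (NumStep D q m z l.length) e M.init b := by
  obtain ⟨v, h⟩ := h
  let src : {t // t ∈ l} → Fin n := fun t => t.1.src
  let tgt : {t // t ∈ l} → Fin n := fun t => t.1.tgt
  let eff : {t // t ∈ l} → Fin m → ℕ → ℕ → Prop := fun t x a b => Eff t.1.act.1 t.1.act.2 x a b
  have hstep : ∀ c c', M.Step c c' ↔ Rackoff.Step src tgt eff Finset.univ c c' := by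
    intro c c'
    rw [step_iff hb hnb]
    constructor
    · rintro ⟨t, ht, h1, h2, h3⟩
      exact ⟨⟨t, ht⟩, h1, h2, fun x _ => h3 x⟩
    · rintro ⟨⟨t, ht⟩, h1, h2, h3⟩
      exact ⟨t, ht, h1, h2, fun x => h3 x (Finset.mem_univ x)⟩
  have hcov : ∃ k, Rackoff.Cov src tgt eff Finset.univ f k (M.init, fun _ => 0) := by
    generalize ((M.init, fun _ => 0) : Fin n × (Fin m → ℕ)) = c at h
    induction h using Relation.ReflTransGen.head_induction_on with
    | refl => exact ⟨0, fun _ => (f, v), rfl, by simp, rfl⟩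
    | @head c c' hc _ ih =>
      obtain ⟨k, p, p0, hp, pk⟩ := ih
      refine ⟨k + 1, fun j => Nat.casesOn j c p, rfl, fun j hj => ?_, pk⟩
      cases j with
      | zero => exact (hstep _ _).1 (by simpa [p0] using hc)
      | succ j => exact hp j (by omega)
  obtain ⟨k, hcov⟩ := hcov
  have hex : ∀ t x a, 1 ≤ a → ∃ b, eff t x a b := by
    intro t x a ha
    have h4 := (validTrans_fields (act_ne_four hb t.2)).2.2
    by_cases hx : t.1.act.1 ≠ 5 ∧ (x : ℕ) = t.1.act.2
    · rcases h4 with ⟨h | h | h, -⟩ | ⟨h, -⟩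
      · exact ⟨a + 1, .inl ⟨hx, .inl ⟨h, rfl⟩⟩⟩
      · exact ⟨a - 1, .inl ⟨hx, .inr (.inl ⟨h, ha, rfl⟩)⟩⟩
      · exact ⟨a - 1, .inl ⟨hx, .inr (.inr ⟨h, rfl⟩)⟩⟩
      · exact absurd h hx.1
    · exact ⟨a, .inr ⟨hx, rfl⟩⟩
  obtain ⟨k', hk, p, p0, hp, pk⟩ := Rackoff.exists_short_of_reach
    (fun t x a b h => h.le.2) hex hcov
  have hval : ∀ j ≤ k', ∀ x, (p j).2 x ≤ j := by
    intro j
    induction j with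
    | zero => simp [p0]
    | succ j ih =>
      intro hj x
      obtain ⟨t, -, -, h⟩ := hp j (by omega)
      have := (h x (Finset.mem_univ x)).le.1
      have := ih (by omega) x
      omega
  have hcode : ∀ j, ∃ a, j ≤ k' →
      a < D ^ (m + 1) ∧ IsCfg D a (p j) ∧ (j = 0 → a = M.init) := by
    intro j
    rcases Nat.eq_zero_or_pos j with rfl | hj
    · have := M.init.isLt
      refine ⟨M.init, fun _ => ⟨?_, ?_, fun _ => rfl⟩⟩
      · exact (this.trans_le hn).trans_le (Nat.le_self_pow (by omega) _)
      · rw [p0]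
        exact isCfg_start (this.trans_le hn)
    · by_cases hjk : j ≤ k'
      · obtain ⟨a, h1, h2⟩ := exists_isCfg (D := D) (c := p j) ((p j).1.isLt.trans_le hn)
          fun x => by have := hval j hjk x; omega
        exact ⟨a, fun _ => ⟨h1, h2, by omega⟩⟩
      · exact ⟨0, fun h => absurd h hjk⟩
  choose a ha using hcode
  refine ⟨a k', (ha k' le_rfl).1, by rw [(ha k' le_rfl).2.1.1, pk], ?_⟩
  rw [← (ha 0 (by omega)).2.2 rfl]
  refine Savitch.sav_of_path (by omega) (fun j hj => (ha j hj).1) fun j hj => ?_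
  exact (numStep_iff_step hb hnb hz (ha j (by omega)).2.1 (ha (j + 1) (by omega)).2.1).2
    ((hstep _ _).2 (hp j hj))

end

end CoverCode

/-! ### Correctness of the decision procedure -/

namespace CoverCode

open Function StackProgram CounterMachine

variable {n m : ℕ}

/-- The numerical facts about the bounds of the search. The number `w` is the numeral of a word of
length `N` that represents an instance with `n` locations and `m` counters. -/
theorem bounds {w N e B : ℕ} (hn : 1 ≤ n) (hN : n + m + 4 ≤ N) (hw : 2 ^ N ≤ w + 1)
    (he : e = (w + 2) ^ N) (hB : B = 2 ^ e ^ 5) :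
    N ≤ w ∧ n ≤ 2 ^ e ∧ (n + 2) ^ (m + 5) ^ (m + 1) < 2 ^ e ∧ 0 < e ∧
      cpow B 2 e = 2 ^ e ∧ cpow B (2 ^ e) (m + 1) = (2 ^ e) ^ (m + 1) ∧
      Savitch.base ((2 ^ e) ^ (m + 1)) ^ (2 * e) ≤ B ∧ ∀ r ≤ N, (w + 8) ^ (4 * r) ≤ B := by
  have hNw : N ≤ w := by
    have : N < 2 ^ N := Nat.lt_two_pow_self
    omega
  have he5 : (w + 2) ^ 5 ≤ e := he ▸ Nat.pow_le_pow_right (by omega) (by omega)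
  have hwe : w + 2 ≤ e := (Nat.le_self_pow (by norm_num) _).trans he5
  have hee : e ≤ e ^ 5 := Nat.le_self_pow (by norm_num) _
  have h2 : ∀ {x}, x ≤ e ^ 5 → 2 ^ x ≤ B := fun h => hB ▸ Nat.pow_le_pow_right (by norm_num) h
  -- A configuration takes `e * (m + 1)` bits, a digit of the recursion stack about twice as many,
  -- and the stack has two digits for each of the `e` levels. As `m` is less than `e`, the exponent
  -- of `B` has to be a multiple of the cube of `e`.
  have hem : e * (m + 1) + 2 ≤ e ^ 2 := by nlinarith
  have h25 : 4 * e * e ^ 2 ≤ e ^ 5 := by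
    have : 4 * e ^ 3 ≤ e ^ 2 * e ^ 3 := Nat.mul_le_mul_right _ (by nlinarith)
    calc 4 * e * e ^ 2 = 4 * e ^ 3 := by ring
      _ ≤ e ^ 2 * e ^ 3 := this
      _ = e ^ 5 := by ring
  refine ⟨hNw, ?_, ?_, by omega, cpow_eq (by norm_num) (h2 hee), cpow_eq (by positivity) ?_, ?_, ?_⟩
  · exact (show n ≤ e by omega).trans Nat.lt_two_pow_self.le
  · have h1 : n + 2 ≤ 2 ^ N := (show n + 2 ≤ N by omega).trans Nat.lt_two_pow_self.le
    calc (n + 2) ^ (m + 5) ^ (m + 1) ≤ (2 ^ N) ^ (m + 5) ^ (m + 1) := Nat.pow_le_pow_left h1 _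
      _ = 2 ^ (N * (m + 5) ^ (m + 1)) := (pow_mul _ _ _).symm
      _ < 2 ^ e := Nat.pow_lt_pow_right (by norm_num) ?_
    calc N * (m + 5) ^ (m + 1) ≤ N * N ^ (m + 1) :=
          Nat.mul_le_mul_left _ (Nat.pow_le_pow_left (by omega) _)
      _ = N ^ (m + 2) := (pow_succ' _ _).symm
      _ ≤ N ^ N := Nat.pow_le_pow_right (by omega) (by omega)
      _ < (w + 2) ^ N := Nat.pow_lt_pow_left (by omega) (by omega)
      _ = e := he.symm
  · rw [← pow_mul]
    exact h2 (by nlinarith)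
  · rw [← pow_mul 2 e]
    generalize e * (m + 1) = k at hem ⊢
    have h1 : 1 ≤ 2 ^ k := Nat.one_le_two_pow
    calc Savitch.base (2 ^ k) ^ (2 * e) ≤ (2 ^ (2 * (k + 2))) ^ (2 * e) := by
          refine Nat.pow_le_pow_left ?_ _
          rw [mul_comm 2 (k + 2), pow_mul, pow_add, sq, Savitch.base]
          exact Nat.mul_le_mul (by omega) (by omega)
      _ = 2 ^ (2 * (k + 2) * (2 * e)) := (pow_mul _ _ _).symm
      _ ≤ B := h2 (le_trans (by nlinarith) h25)
  · intro r hr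
    calc (w + 8) ^ (4 * r) ≤ (2 ^ (w + 8)) ^ (4 * r) :=
          Nat.pow_le_pow_left Nat.lt_two_pow_self.le _
      _ = 2 ^ ((w + 8) * (4 * r)) := (pow_mul _ _ _).symm
      _ ≤ B := h2 (le_trans ?_ (he5.trans hee))
    have h3 : 16 ≤ (w + 2) ^ 2 := by nlinarith
    calc (w + 8) * (4 * r) ≤ (4 * (w + 2)) * (4 * (w + 2)) := Nat.mul_le_mul (by omega) (by omega)
      _ = 16 * (w + 2) ^ 2 := by ring
      _ ≤ (w + 2) ^ 2 * (w + 2) ^ 2 := Nat.mul_le_mul_right _ h3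
      _ = (w + 2) ^ 4 := by ring
      _ ≤ (w + 2) ^ 5 := Nat.pow_le_pow_right (by omega) (by omega)

theorem length_encodeInstance (i f : Fin n) (l : List (Trans n m)) :
    n + m + i + f + 4 + l.length ≤ (encodeInstance i f l).length := by
  have h : ∀ l : List (Trans n m), l.length ≤ (l.flatMap encodeTrans).length := by
    intro l
    induction l with
    | nil => simp
    | cons t l ih =>
      have : 1 ≤ (encodeTrans t).length := by
        rcases t with ⟨s, a, t⟩ | ⟨s, x, t⟩ <;> simp [encodeTrans] <;> omega
      simp only [List.length_cons, List.flatMap_cons, List.length_append]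
      omega
  have := h l
  simp only [encodeInstance, unary, List.length_append, List.length_cons, List.length_replicate]
  omega

section

variable {M : NBCM (Fin n) (Fin m)} {l : List (Trans n m)} {q z w N e B : ℕ}

/-- The bounded search for a covering run is complete by Rackoff's bound. -/
theorem cover_iff (hb : ∀ t, Sum.inl t ∈ l ↔ t ∈ M.Δ) (hnb : ∀ t, Sum.inr t ∈ l ↔ t ∈ M.Δnb)
    (hz : Codes q z l) (hN : n + m + 4 ≤ N) (hw : 2 ^ N ≤ w + 1) (he : e = (w + 2) ^ N)
    (hB : B = 2 ^ e ^ 5) (f : Fin n) : Cover q e B m M.init f z l.length ↔ M.Coverable f := by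
  have hn : 1 ≤ n := M.init.pos
  obtain ⟨-, h1, h2, h3, h4, h5, h6, -⟩ := bounds hn hN hw he hB
  have hi : (M.init : ℕ) < 2 ^ e := M.init.isLt.trans_le h1
  have hi' : (M.init : ℕ) < (2 ^ e) ^ (m + 1) := hi.trans_le (Nat.le_self_pow (by omega) _)
  unfold Cover
  rw [h4, h5]
  constructor
  · rintro ⟨b, hb', hf, h⟩
    rw [Savitch.decide_iff h3 hi' hb' h6] at h
    obtain ⟨⟨f', v⟩, hc, h⟩ := reaches_of_numStep hb hnb hz (isCfg_start hi) (h.reaches hi' hb')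
    obtain rfl : f' = f := Fin.ext (hc.1.symm.trans hf)
    exact ⟨v, h⟩
  · intro h
    obtain ⟨b, hb', hf, h⟩ := sav_of_coverable hb hnb hz rfl h1 h2 h
    exact ⟨b, hb', hf, (Savitch.decide_iff h3 hi' hb' h6).2 h⟩

/-- For a list of transitions of a machine, validity amounts to the restore condition. -/
theorem valid_iff {φ : Prop} (hb : ∀ t, Sum.inl t ∈ l ↔ t ∈ M.Δ) (hz : Codes q z l) (f : Fin n) :
    Valid φ q n m M.init f z l.length ↔ (φ → M.IsRestore) := by
  have h : (∀ s, s < n → ∃ j, j < l.length ∧ dig q (4 * j) z = s ∧ dig q (4 * j + 1) z = 5 ∧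
      dig q (4 * j + 3) z = M.init) ↔ M.IsRestore := by
    have key : ∀ s : Fin n, (∃ j, j < l.length ∧ dig q (4 * j) z = s ∧ dig q (4 * j + 1) z = 5 ∧
        dig q (4 * j + 3) z = M.init) ↔ (s, CAct.nop, M.init) ∈ M.Δ := by
      intro s
      refine (hz.exists_iff fun x => x.1 = s ∧ x.2.1 = 5 ∧ x.2.2.2 = M.init).trans ?_
      rw [← hb]
      constructor
      · rintro ⟨⟨s', a, t⟩ | ⟨s', x, t⟩, ht, h1, h2, h3⟩
        · obtain rfl : s' = s := Fin.ext h1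
          obtain rfl : t = M.init := Fin.ext h3
          cases a <;> simp [Trans.fields, Trans.act, actCode] at h2
          exact ht
        · simp [Trans.fields, Trans.act] at h2
      · exact fun h => ⟨_, h, rfl, rfl, rfl⟩
    exact ⟨fun h s => (key s).1 (h s s.isLt), fun h s hs => (key ⟨s, hs⟩).2 (h ⟨s, hs⟩)⟩
  rw [Valid, h]
  refine ⟨fun h => h.2.2.2, fun h => ⟨M.init.isLt, f.isLt, ?_, h⟩⟩
  exact (hz.forall_iff fun x => ValidTrans n m x.1 x.2.1 x.2.2.1 x.2.2.2).2
    fun t ht => validTrans_fields (act_ne_four hb ht)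

end

open Classical in
/-- The machine with initial location `i` and the transitions of a list. -/
noncomputable def ofList (i : Fin n) (l : List (Trans n m)) (h : ∀ t ∈ l, t.act.1 ≠ 4) :
    NBCM (Fin n) (Fin m) where
  Δ := (l.filterMap Sum.getLeft?).toFinset
  init := i
  testFree s x t hm := h (.inl (s, .isZero x, t)) (by simpa using hm) rfl
  Δnb := (l.filterMap Sum.getRight?).toFinset

theorem injective_num : Injective num := LeftInverse.injective dg_num

/-- The decision procedure is correct when the bounds are chosen large enough. -/
theorem accepts_iff (φ : Prop) (wd : List Sym) {w e : ℕ} (hw : w = num (wd.map symCode))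
    (he : e = (w + 2) ^ wd.length) : Accepts φ (w, e, 2 ^ e ^ 5) ↔
      ∃ (n m : ℕ) (M : NBCM (Fin n) (Fin m)) (f : Fin n), Represents wd M f ∧ (φ → M.IsRestore) ∧
        M.Coverable f := by
  have hw2 : 2 ^ wd.length ≤ w + 1 := by
    have := two_pow_le_num (wd.map symCode)
    rwa [List.length_map, ← hw] at this
  constructor
  · rintro ⟨z, -, n, -, m, -, i, -, f, -, r, -, hv, hi, hc⟩
    obtain ⟨l, rfl, hz⟩ := exists_codes hv.2.2.1
    have h4 : ∀ t ∈ l, t.act.1 ≠ 4 := by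
      refine (hz.forall_iff fun x => x.2.1 ≠ 4).1 fun j hj => ?_
      have := (hv.2.2.1 j hj).2.2
      change dig (w + 8) (4 * j + 1) z ≠ 4
      dsimp only at this
      omega
    lift i to Fin n using hv.1
    lift f to Fin n using hv.2.1
    set M := ofList i l h4 with hM
    have hb : ∀ t, Sum.inl t ∈ l ↔ t ∈ M.Δ := fun t => by simp [hM, ofList]
    have hnb : ∀ t, Sum.inr t ∈ l ↔ t ∈ M.Δnb := fun t => by simp [hM, ofList]
    have hwd : wd = encodeInstance i f l := by
      dsimp only at hi
      rw [encInst_eq, hz.instWord_eq] at hi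
      have : num ((encodeInstance i f l).map symCode) = w := by omega
      rw [hw] at this
      exact (List.map_injective_iff.2 symCode.injective (injective_num this)).symm
    have hl := length_encodeInstance i f l
    rw [← hwd] at hl
    exact ⟨n, m, M, f, ⟨l, hb, hnb, hwd⟩, (valid_iff hb hz f).1 hv,
      (cover_iff hb hnb hz (by omega) hw2 he rfl f).1 hc⟩
  · rintro ⟨n, m, M, f, ⟨l, hb, hnb, hwd⟩, hr, hc⟩
    have hl := length_encodeInstance M.init f l
    rw [← hwd] at hl
    obtain ⟨hNw, -, -, -, -, -, -, hq⟩ :=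
      bounds (m := m) M.init.pos (N := wd.length) (by omega) hw2 he rfl
    have hf : ∀ t : Trans n m, t ∈ l →
        t.src < w + 8 ∧ t.act.1 < w + 8 ∧ t.act.2 < w + 8 ∧ t.tgt < w + 8 := by
      intro t ht
      have h := validTrans_fields (act_ne_four hb ht)
      have h1 := h.1
      have h2 := h.2.1
      have h3 := h.2.2
      omega
    obtain ⟨z, hzB, hz⟩ := exists_codes_of_list l hf (by omega)
    have hn := M.init.pos
    refine ⟨z, hzB.trans_le (hq _ (by omega)), n, ?_, m, ?_, M.init, ?_, f, ?_, l.length, ?_,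
      (valid_iff hb hz f).2 hr, ?_, (cover_iff hb hnb hz (by omega) hw2 he rfl f).2 hc⟩
    · dsimp only; omega
    · dsimp only; omega
    · dsimp only; omega
    · dsimp only; omega
    · dsimp only; omega
    · dsimp only
      rw [encInst_eq, hz.instWord_eq, ← hwd, ← hw]
      omega

end CoverCode

/-! ### Exponential space -/

namespace StackProgram

open Function Ctx

/-- The register contents with given values in the registers 2 to 6, and zero elsewhere. -/
def five (w e k b o : ℕ) : Regs := fun r =>
  if r = 2 then w else if r = 3 then e else if r = 4 then k else if r = 5 then b else
    if r = 6 then o else 0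

theorem clean_five {w e k b o : ℕ} : Clean 7 (five w e k b o) := by
  refine ⟨rfl, rfl, fun r hr => ?_⟩
  unfold five
  repeat rw [if_neg (by omega)]

theorem five_le {w e k b o B : ℕ} (hw : w ≤ B) (he : e ≤ B) (hk : k ≤ B) (hb : b ≤ B) (ho : o ≤ B)
    (r : ℕ) : five w e k b o r ≤ B := by
  unfold five
  split_ifs <;> first | assumption | exact Nat.zero_le _

theorem update_five {w e k b o x : ℕ} :
    update (five w e k b o) 3 x = five w x k b o ∧ update (five w e k b o) 4 x = five w e x b o ∧
    update (five w e k b o) 5 x = five w e k x o := by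
  refine ⟨?_, ?_, ?_⟩ <;>
  · funext r
    simp only [update_apply, five]
    split_ifs <;> first | rfl | omega

/-- An assignment between the registers 2 to 6 by a function of the registers 2 to 5. -/
theorem exists_assign {f : ℕ × ℕ × ℕ × ℕ → ℕ} (hf : LinSpace f) {r : ℕ} (h2 : 2 ≤ r)
    (h7 : r < 7) : ∃ P d, ∀ w e k b B M, 2 ≤ B → w ≤ B → e ≤ B → k ≤ B → b ≤ B → B ^ (d + 1) ≤ M →
      RRun M P (five w e k b 0) (update (five w e k b 0) r (f (w, e, k, b))) := by
  obtain ⟨P, d, hP⟩ := hf.2 0 Nat.one_pos (fun j => min (j + 2) 5) 7 r (fun j => by omega) h2 h7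
  refine ⟨P, d, fun w e k b B M hB hw he hk hb hM => ?_⟩
  refine hP (w, e, k, b) _ B M clean_five hB ?_ (by simp [hw, he, hk, hb])
    (pow_le_of_le hB (Nat.le_succ d) hM) fun r => ?_
  · intro j (hj : j < 4)
    interval_cases j <;> rfl
  · exact (five_le hw he hk hb (Nat.zero_le _) r).trans
      ((Nat.le_self_pow (Nat.succ_ne_zero d) B).trans hM)

/-- Removing the top digit of a numeral. -/
theorem num_tail (l : List (Fin 7)) : (num l - 1) / 7 = num l.tail := by
  cases l with
  | nil => rfl
  | cons d l =>
    have := d.isLt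
    simp only [num, List.tail_cons]
    omega

/-- A program that computes the bounds `(w + 2) ^ n` and `2 ^ (w + 2) ^ (5 * n)`, where `n` is the
number of digits of `w`, and then evaluates a predicate. The digits are counted by removing them one
by one. -/
theorem LinSpace.exists_prog {p : ℕ × ℕ × ℕ → Prop} (hp : LinSpace p) :
    ∃ P d, ∀ (ds : List (Fin 7)) (w e M : ℕ), w = num ds → e = (w + 2) ^ ds.length →
      (2 ^ e ^ 5) ^ (d + 1) ≤ M →
      ∃ ρ, RRun M P (five w 0 0 0 0) ρ ∧ (ρ 6 ≠ 0 ↔ p (w, e, 2 ^ e ^ 5)) := by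
  obtain ⟨P₁, d₁, h₁⟩ := exists_assign (f := fun c => c.1) (by fun_prop) (r := 4) (by omega)
    (by omega)
  obtain ⟨P₂, d₂, h₂⟩ := exists_assign (f := fun _ => 1) (by fun_prop) (r := 3) (by omega)
    (by omega)
  obtain ⟨P₃, d₃, h₃⟩ := exists_assign (f := fun c => c.2.1 * (c.1 + 2)) (by fun_prop) (r := 3)
    (by omega) (by omega)
  obtain ⟨P₄, d₄, h₄⟩ := exists_assign
    (f := fun c => c.2.1 * c.2.1 * c.2.1 * c.2.1 * c.2.1) (by fun_prop) (r := 4)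
    (by omega) (by omega)
  obtain ⟨P₅, d₅, h₅⟩ := exists_assign (f := fun _ => 1) (by fun_prop) (r := 5) (by omega)
    (by omega)
  obtain ⟨P₆, d₆, h₆⟩ := exists_assign (f := fun c => c.2.2.2 + c.2.2.2) (by fun_prop) (r := 5)
    (by omega) (by omega)
  have hq := linSpace_prop_iff.1
    (hp.comp (g := fun c : ℕ × ℕ × ℕ × ℕ => (c.1, c.2.1, c.2.2.2)) (by fun_prop))
  obtain ⟨P₇, d₇, h₇⟩ := exists_assign hq (r := 6) (by omega) (by omega)
  refine ⟨.seq P₁ (.seq P₂ (.seq (.loop 4 (.seq (.pop 4 fun _ => .skip) P₃))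
    (.seq P₄ (.seq P₅ (.seq (.loop 4 (.seq (dec 4) P₆)) P₇))))),
    d₁ + d₂ + d₃ + d₄ + d₅ + d₆ + d₇, fun ds w e M hw he hM => ?_⟩
  set B := 2 ^ e ^ 5 with hB
  have he1 : 1 ≤ e := he ▸ Nat.one_le_pow _ _ (by omega)
  have hee : e ≤ e ^ 5 := Nat.le_self_pow (by norm_num) _
  have heB : e ^ 5 ≤ B := Nat.lt_two_pow_self.le
  have hwe : w ≤ e := by
    cases ds with
    | nil => simp [hw, num]
    | cons d l =>
      rw [he, List.length_cons]
      exact (Nat.le_add_right w 2).trans (Nat.le_self_pow (by omega) _)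
  have hB2 : 2 ≤ B := Nat.le_self_pow (by omega) 2
  have hBM : ∀ {d}, d ≤ d₁ + d₂ + d₃ + d₄ + d₅ + d₆ + d₇ → B ^ (d + 1) ≤ M := fun h =>
    pow_le_of_le hB2 (by omega) hM
  have hBM' : B ≤ M := (pow_one B).symm.le.trans (hBM (d := 0) (by omega))
  have hpow : ∀ t ≤ ds.length, (w + 2) ^ t ≤ e := fun t ht =>
    he ▸ Nat.pow_le_pow_right (by omega) ht
  have hdrop : ∀ t, num (ds.drop t) ≤ w := by
    intro t
    induction t with
    | zero => simp [hw]
    | succ t ih =>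
      rw [← List.tail_drop, ← num_tail]
      omega
  have e1 := h₁ w 0 0 0 B M hB2 (by omega) (by omega) (by omega) (by omega) (hBM (by omega))
  rw [update_five.2.1] at e1
  have e2 := h₂ w 0 w 0 B M hB2 (by omega) (by omega) (by omega) (by omega) (hBM (by omega))
  rw [update_five.1] at e2
  -- The first loop removes the digits of the copy of `w` in register 4, with a multiplication by
  -- `w + 2` for each of them.
  have e3 : RRun M (.loop 4 (.seq (.pop 4 fun _ => .skip) P₃)) (five w 1 w 0 0)
      (five w e 0 0 0) := by
    refine (RRun.loop (n := ds.length) (fun t => five w ((w + 2) ^ t) (num (ds.drop t)) 0 0)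
      (fun t ht => ⟨?_, ?_⟩) ?_ ?_).of_eq ?_ ?_
    · show num (ds.drop t) ≠ 0
      rw [List.drop_eq_getElem_cons ht, num]
      omega
    · have := hpow t (by omega)
      have := hdrop t
      have := hdrop (t + 1)
      have f1 := RRun.shift (M := M) (r := 4) (ρ := five w ((w + 2) ^ t) (num (ds.drop t)) 0 0)
        (five_le (by omega) (by omega) (by omega) (by omega) (by omega))
      rw [update_five.2.1, show five w ((w + 2) ^ t) (num (ds.drop t)) 0 0 4 =
        num (ds.drop t) from rfl, num_tail, List.tail_drop] at f1
      have f2 := h₃ w ((w + 2) ^ t) (num (ds.drop (t + 1))) 0 B M hB2 (by omega) (by omega)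
        (by omega) (by omega) (hBM (by omega))
      rw [update_five.1, ← pow_succ] at f2
      exact f1.seq f2
    · show num (ds.drop ds.length) = 0
      rw [List.drop_length, num]
    · have := hpow _ le_rfl
      have := hdrop ds.length
      exact five_le (by omega) (by omega) (by omega) (by omega) (by omega)
    · simp [hw]
    · simp [he, num]
  have e4 := h₄ w e 0 0 B M hB2 (by omega) (by omega) (by omega) (by omega) (hBM (by omega))
  rw [update_five.2.1, show e * e * e * e * e = e ^ 5 by ring] at e4
  have e5 := h₅ w e (e ^ 5) 0 B M hB2 (by omega) (by omega) (by omega) (by omega) (hBM (by omega))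
  rw [update_five.2.2] at e5
  -- The second loop counts down from `e ^ 5`, with a doubling in each pass.
  have e6 : RRun M (.loop 4 (.seq (dec 4) P₆)) (five w e (e ^ 5) 1 0) (five w e 0 B 0) := by
    have hpow : ∀ t ≤ e ^ 5, 2 ^ t ≤ B := fun t ht => Nat.pow_le_pow_right (by omega) ht
    refine (RRun.loop (n := e ^ 5) (fun t => five w e (e ^ 5 - t) (2 ^ t) 0)
      (fun t ht => ⟨?_, ?_⟩) ?_ ?_).of_eq ?_ ?_
    · show e ^ 5 - t ≠ 0
      omega
    · have := hpow t (by omega)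
      have f1 := RRun.dec (M := M) (r := 4) (ρ := five w e (e ^ 5 - t) (2 ^ t) 0) (by omega) rfl rfl
        (five_le (by omega) (by omega) (by omega) (by omega) (by omega))
      rw [update_five.2.1, show five w e (e ^ 5 - t) (2 ^ t) 0 4 = e ^ 5 - t from rfl,
        Nat.sub_sub] at f1
      have f2 := h₆ w e (e ^ 5 - (t + 1)) (2 ^ t) B M hB2 (by omega) (by omega) (by omega)
        (by omega) (hBM (by omega))
      rw [update_five.2.2, ← Nat.two_mul, ← pow_succ'] at f2
      exact f1.seq f2
    · exact Nat.sub_self _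
    · exact five_le (by omega) (by omega) (by omega) (by omega) (by omega)
    · simp
    · simp [hB]
  have e7 := h₇ w e 0 B B M hB2 (by omega) (by omega) (by omega) (by omega) (hBM (by omega))
  refine ⟨_, e1.seq (e2.seq (e3.seq (e4.seq (e5.seq (e6.seq e7))))), ?_⟩
  rw [update_self]
  simp

/-- A language is decidable in exponential space if membership is expressed by a predicate in
`LinSpace` about the numeral of the word and two numbers with exponentially many digits. -/
theorem mem_EXPSPACE {α : Type} (ι : α ↪ Fin 7) {p : ℕ × ℕ × ℕ → Prop} (hp : LinSpace p)
    {Lang : Language α} (h : ∀ (wd : List α) (w e : ℕ), w = num (wd.map ι) →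
      e = (w + 2) ^ wd.length → (p (w, e, 2 ^ e ^ 5) ↔ wd ∈ Lang)) :
    Lang ∈ SpaceComplexity.EXPSPACE := by
  obtain ⟨P, d, hP⟩ := hp.exists_prog
  obtain ⟨N, tm, ι', A, hfin, htm⟩ := exists_machine ι P 2 6
  -- For a word of length `n`, `w + 2 ≤ 2 ^ (3 * (n + 1))`, so `e ^ 5 ≤ 2 ^ (15 * (n * (n + 1)))`.
  -- The bound on the registers may depend on the length of the word only.
  let M : ℕ → ℕ := fun n => 2 ^ (2 ^ (15 * (n * (n + 1))) * (d + 1))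
  have hdec := htm Lang (fun n => (dg (M n)).length + 1) fun wd => by
    obtain ⟨ρ, hρ, hρ6⟩ := hP (wd.map ι) _ _ (M wd.length) rfl rfl (by
      rw [← pow_mul]
      refine Nat.pow_le_pow_right (by norm_num) (Nat.mul_le_mul_right _ ?_)
      rw [List.length_map]
      set n := wd.length
      have hw : num (wd.map ι) + 2 ≤ 2 ^ (3 * (n + 1)) := by
        have := num_add_two_le (wd.map ι)
        rw [List.length_map] at this
        refine this.trans ?_
        rw [pow_mul, pow_succ']
        exact Nat.mul_le_mul (by norm_num) (Nat.pow_le_pow_left (by norm_num) _)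
      calc ((num (wd.map ι) + 2) ^ n) ^ 5 ≤ ((2 ^ (3 * (n + 1))) ^ n) ^ 5 :=
            Nat.pow_le_pow_left (Nat.pow_le_pow_left hw _) _
        _ = 2 ^ (15 * (n * (n + 1))) := by
            rw [← pow_mul, ← pow_mul]
            congr 1
            ring)
    refine ⟨store ρ, ?_, ?_⟩
    · refine Eq.subst (motive := fun s => Runs _ P s _) ?_ hρ
      funext r
      by_cases hr : r = 2
      · subst hr
        rw [update_self]
        exact dg_num _
      · rw [update_of_ne hr, store, five, if_neg hr]
        simp
    · rw [← h wd _ _ rfl rfl, ← List.length_map ι, ← hρ6]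
      exact not_congr dg_eq_nil
  refine ⟨tm, ι', A, .C (N + d + 4) + .C 15 * (.X * (.X + 1)), hfin, fun wd => ⟨(hdec wd).1,
    fun c hc => ((hdec wd).2 c hc).trans ?_⟩⟩
  set n := wd.length
  simp only [Polynomial.eval_add, Polynomial.eval_mul, Polynomial.eval_C, Polynomial.eval_X,
    Polynomial.eval_one]
  set x := 2 ^ (15 * (n * (n + 1))) with hx
  have hx1 : 1 ≤ x := Nat.one_le_two_pow
  have hl : (dg (M n)).length ≤ x * (d + 1) + 1 := by
    refine length_dg_le ?_
    rw [pow_succ]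
    have : 1 ≤ 2 ^ (x * (d + 1)) := Nat.one_le_two_pow
    show 2 ^ (x * (d + 1)) + 1 ≤ _
    omega
  calc (N + 1) * ((dg (M n)).length + 1) ≤ (N + 1) * ((d + 3) * x) :=
        Nat.mul_le_mul_left _ (by nlinarith)
    _ = (N + 1) * (d + 3) * x := by ring
    _ ≤ 2 ^ (N + 1) * 2 ^ (d + 3) * x :=
        Nat.mul_le_mul_right _ (Nat.mul_le_mul Nat.lt_two_pow_self.le Nat.lt_two_pow_self.le)
    _ = 2 ^ (N + d + 4 + 15 * (n * (n + 1))) := by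
        rw [hx]
        ring

end StackProgram

theorem mainTheorem2 :
    CounterMachine.coverNBCM ∈ SpaceComplexity.EXPSPACE ∧
      CounterMachine.coverNBRCM ∈ SpaceComplexity.EXPSPACE := by
  constructor
  · refine StackProgram.mem_EXPSPACE CoverCode.symCode (CoverCode.linSpace_accepts False)
      fun wd w e hw he => ?_
    exact (CoverCode.accepts_iff False wd hw he).trans (by simp only [false_imp_iff, true_and]; rfl)
  · refine StackProgram.mem_EXPSPACE CoverCode.symCode (CoverCode.linSpace_accepts True)
      fun wd w e hw he => ?_
    exact (CoverCode.accepts_iff True wd hw he).trans (by simp only [true_imp_iff]; rfl)
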